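/- **Setting.** Let $K$ be a field, let $m\ge 2$ be an integer and let $q\in K$ be a primitive $m$-th root of unity. Let $k,l,n\ge 1$ be integers with $k^l\equiv 1 \pmod n$, and let $$D^k_{ln}=\langle c,d \mid c^l=1,\ d^n=1,\ cd=d^kc\rangle .$$ For a positive integer $r$ let $U_r(K)=\{\zeta\in K : \zeta^r=1\}$, and let $(n,k-1)$ be the greatest common divisor of $n$ and $k-1$ (so $(n,0)=n$). The Taft Hopf algebra $T_{m^2}(q)$ is the $K$-algebra generated by $h,x$ subject to $h^m=1$, $x^m=0$, $xh=q\,hx$, with $\Delta(h)=h\otimes h$, $\Delta(x)=x\otimes h+1\otimes x$, $\varepsilon(h)=1$, $\varepsilon(x)=0$, $S(h)=h^{m-1}$, $S(x)=-xh^{m-1}$. The group algebra $K[D^k_{ln}]$ carries its usual Hopf algebra structure. A matched pair of Hopf algebras $(A,H,\triangleleft,\triangleright)$ consists of Hopf algebras $A,H$ and linear maps $\triangleright:H\otimes A\to A$, $\triangleleft:H\otimes A\to H$ such that $A$ is a left $H$-module coalgebra via $\triangleright$, $H$ is a right $A$-module coalgebra via $\triangleleft$, and for all $a,b\in A$, $y,z\in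 H$ (in Sweedler notation) $$y\triangleright 1=\varepsilon(y)1,\qquad 1\triangleleft a=\varepsilon(a)1,$$ $$y\triangleright(ab)=(y_{(1)}\triangleright a_{(1)})\bigl((y_{(2)}\triangleleft a_{(2)})\triangleright b\bigr),\qquad (yz)\triangleleft a=\bigl(y\triangleleft(z_{(1)}\triangleright a_{(1)})\bigr)(z_{(2)}\triangleleft a_{(2)}),$$ $$y_{(1)}\triangleleft a_{(1)}\otimes y_{(2)}\triangleright a_{(2)}=y_{(2)}\triangleleft a_{(2)}\otimes y_{(1)}\triangleright a_{(1)} .$$ Its bicrossed product $A\bowtie H$ is the Hopf algebra on the tensor product coalgebra $A\otimes H$ (write $a\bowtie y$ for $a\otimes y$) with unit $1\bowtie 1$ and multiplication $(a\bowtie y)(b\bowtie z)=a\,(y_{(1)}\triangleright b_{(1)})\bowtie(y_{(2)}\triangleleft b_{(2)})\,z$; its antipode is $S(a\bowtie y)=S(y_{(2)})\triangleright S(a_{(2)})\bowtie S(y_{(1)})\triangleleft S(a_{(1)})$. For $\beta\in U_l(K)$ and $\sigma\in U_{(n,k-1)}(K)$ let $T^{\beta,\sigma}_{lnm^2}(q)$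 be the Hopf algebra generated as an algebra by $c,d,h,x$ subject to $$c^l=d^n=h^m=1,\quad x^m=0,\quad ch=hc,\quad dh=hd,\quad cd=d^kc,\quad cx=\beta\,xc,\quad dx=\sigma\,xd,\quad xh=q\,hx,$$ with $$\Delta(c)=c\otimes c,\quad \Delta(d)=d\otimes d,\quad \Delta(h)=h\otimes h,\quad \Delta(x)=x\otimes h+1\otimes x,$$ $$\varepsilon(c)=\varepsilon(d)=\varepsilon(h)=1,\quad \varepsilon(x)=0,\quad S(c)=c^{l-1},\quad S(d)=d^{n-1},\quad S(h)=h^{m-1},\quad S(x)=-xh^{m-1}.$$ **Theorem.** There is a bijection between $U_l(K)\times U_{(n,k-1)}(K)$ and the set of all matched pairs $(T_{m^2}(q),K[D^k_{ln}],\triangleleft,\triangleright)$ such that the matched pair corresponding to $(\beta,\sigma)$ is given by $$d^tc^i\triangleright h^{j'}x^j=\beta^{ij}\sigma^{tj}\,h^{j'}x^j,\qquad d^tc^i\triangleleft h^{j'}x^j=\varepsilon(h^{j'}x^j)\,d^tc^i$$ for all $0\le t\le n-1$, $0\le i\le l-1$ and $0\le j,j'\le m-1$. Furthermore, every bicrossed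 product of $T_{m^2}(q)$ and $K[D^k_{ln}]$ is isomorphic, as a Hopf algebra, to $T^{\beta,\sigma}_{lnm^2}(q)$ for some $(\beta,\sigma)\in U_l(K)\times U_{(n,k-1)}(K)$, namely for the pair $(\beta,\sigma)$ that corresponds to its matched pair. -/

import Mathlib

set_option linter.unusedSimpArgs false

open scoped TensorProduct

universe u v w

namespace CoalgebraAux

open Coalgebra

theorem comul_comul {K C : Type*} [Field K] [AddCommGroup C] [Module K C] [Coalgebra K C] (t : C) :
    TensorProduct.map (comul (R := K)) comul (comul t) =
      (TensorProduct.assoc K C C (C ⊗[K] C)).symm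
        (LinearMap.lTensor C (TensorProduct.assoc K C C C).toLinearMap
          (LinearMap.lTensor C (comul.rTensor C ∘ₗ comul) (comul (R := K) t))) := by
  have h1 : ∀ r : C ⊗[K] C, TensorProduct.map (comul (R := K)) comul r =
      comul.lTensor (C ⊗[K] C) (comul.rTensor C r) := by
    intro r
    rw [← LinearMap.comp_apply, LinearMap.lTensor_comp_rTensor]
  have h2 : ∀ r : C ⊗[K] (C ⊗[K] C),
      comul.lTensor (C ⊗[K] C) ((TensorProduct.assoc K C C C).symm r) =
        (TensorProduct.assoc K C C (C ⊗[K] C)).symm ((comul.lTensor C).lTensor C r) := by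
    intro r
    induction r with
    | zero => simp only [map_zero, TensorProduct.zero_tmul, TensorProduct.tmul_zero]
    | add s t hs ht => simp only [LinearMap.map_add, LinearEquiv.map_add, hs, ht]
    | tmul a r =>
      induction r with
      | zero => simp only [map_zero, TensorProduct.zero_tmul, TensorProduct.tmul_zero]
      | add s t hs ht => simp only [LinearMap.map_add, LinearEquiv.map_add, hs, ht, TensorProduct.tmul_add]
      | tmul b c => rfl
  have h3 : (comul (R := K) (A := C)).lTensor C ∘ₗ comul =
      (TensorProduct.assoc K C C C).toLinearMap ∘ₗ (comul.rTensor C ∘ₗ comul) :=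
    coassoc.symm
  rw [h1, ← coassoc_symm_apply, h2, ← LinearMap.comp_apply (LinearMap.lTensor C (comul.lTensor C)),
    ← LinearMap.lTensor_comp, h3, LinearMap.lTensor_comp]
  rfl

variable {K A H C : Type*} [Field K] [AddCommGroup A] [AddCommGroup H] [AddCommGroup C]
  [Module K A] [Module K H] [Module K C]

theorem shuffle_left (L : C →ₗ[K] A) (R : C →ₗ[K] H) (r z : C) (v : C ⊗[K] C) :
    TensorProduct.map (TensorProduct.map L R) (TensorProduct.map L R)
      ((TensorProduct.assoc K _ _ _).symm (LinearMap.lTensor C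
        (TensorProduct.assoc K _ _ _).toLinearMap (r ⊗ₜ (v ⊗ₜ z)))) =
      (TensorProduct.assoc K A H (A ⊗[K] H)).symm
        (L r ⊗ₜ TensorProduct.assoc K H A H (TensorProduct.map R L v ⊗ₜ R z)) := by
  induction v with
  | zero => simp only [map_zero, TensorProduct.zero_tmul, TensorProduct.tmul_zero]
  | add s t hs ht =>
    simp only [LinearMap.map_add, LinearEquiv.map_add, hs, ht, TensorProduct.tmul_add, TensorProduct.add_tmul]
  | tmul v w => rfl

theorem shuffle_right (L : C →ₗ[K] A) (R : C →ₗ[K] H) (r z : C) (v : C ⊗[K] C) :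
    TensorProduct.AlgebraTensorModule.tensorTensorTensorComm K K K K A A H H
      (TensorProduct.map (TensorProduct.map L L) (TensorProduct.map R R)
        ((TensorProduct.assoc K _ _ _).symm (LinearMap.lTensor C
          (TensorProduct.assoc K _ _ _).toLinearMap (r ⊗ₜ (v ⊗ₜ z))))) =
      (TensorProduct.assoc K A H (A ⊗[K] H)).symm
        (L r ⊗ₜ TensorProduct.assoc K H A H
          (TensorProduct.comm K A H (TensorProduct.map L R v) ⊗ₜ R z)) := by
  induction v with
  | zero => simp only [map_zero, TensorProduct.zero_tmul, TensorProduct.tmul_zero]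
  | add s t hs ht =>
    simp only [LinearMap.map_add, LinearEquiv.map_add, hs, ht, TensorProduct.tmul_add, TensorProduct.add_tmul]
  | tmul v w => rfl

theorem comul_map_comul [Coalgebra K A] [Coalgebra K H] [Coalgebra K C]
    (L : C →ₗc[K] A) (R : C →ₗc[K] H)
    (h : ∀ t : C, TensorProduct.map R.toLinearMap L.toLinearMap (comul t) =
      TensorProduct.comm K A H (TensorProduct.map L.toLinearMap R.toLinearMap (comul t)))
    (t : C) :
    comul (R := K) (TensorProduct.map L.toLinearMap R.toLinearMap (comul t)) =
      TensorProduct.map (TensorProduct.map L.toLinearMap R.toLinearMap ∘ₗ comul)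
        (TensorProduct.map L.toLinearMap R.toLinearMap ∘ₗ comul) (comul t) := by
  have h1 : ∀ r : C ⊗[K] C,
      comul (R := K) (TensorProduct.map L.toLinearMap R.toLinearMap r) =
        TensorProduct.AlgebraTensorModule.tensorTensorTensorComm K K K K A A H H
          (TensorProduct.map (TensorProduct.map L.toLinearMap L.toLinearMap)
            (TensorProduct.map R.toLinearMap R.toLinearMap)
            (TensorProduct.map comul comul r)) := by
    intro r
    induction r with
    | zero => simp only [map_zero, TensorProduct.zero_tmul, TensorProduct.tmul_zero]
    | add s t hs ht => simp only [LinearMap.map_add, LinearEquiv.map_add, hs, ht]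
    | tmul s t =>
      simp only [TensorProduct.map_tmul, TensorProduct.comul_tmul]
      congr 2
      · exact (CoalgHomClass.map_comp_comul_apply L s).symm
      · exact (CoalgHomClass.map_comp_comul_apply R t).symm
  rw [h1, TensorProduct.map_comp, LinearMap.comp_apply, comul_comul]
  generalize comul (R := K) t = r
  induction r with
  | zero => simp only [map_zero]
  | add s t hs ht => simp only [LinearMap.map_add, LinearEquiv.map_add, hs, ht]
  | tmul r s =>
    rw [LinearMap.lTensor_tmul C (comul.rTensor C ∘ₗ comul), LinearMap.comp_apply]
    generalize comul (R := K) s = u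
    induction u with
    | zero => simp only [map_zero, TensorProduct.tmul_zero]
    | add s t hs ht => simp only [LinearMap.map_add, LinearEquiv.map_add, hs, ht, TensorProduct.tmul_add]
    | tmul s z =>
      rw [LinearMap.rTensor_tmul, shuffle_left, shuffle_right, h]

end CoalgebraAux

section

open Coalgebra

/-- A bialgebra structure on the coalgebra `V`: a unit and a multiplication which make `V` a unital
associative algebra and which are coalgebra maps. -/
structure BialgebraData (K V : Type*) [Field K] [AddCommGroup V] [Module K V] [Coalgebra K V] where
  mul : V ⊗[K] V →ₗ[K] V
  one : V
  protected mul_assoc (r s t : V) : mul (mul (r ⊗ₜ s) ⊗ₜ t) = mul (r ⊗ₜ mul (s ⊗ₜ t))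
  protected one_mul (s : V) : mul (one ⊗ₜ s) = s
  protected mul_one (s : V) : mul (s ⊗ₜ one) = s
  protected counit_one : counit (R := K) one = 1
  protected comul_one : comul (R := K) one = one ⊗ₜ one
  protected counit_mul (s t : V) : counit (R := K) (mul (s ⊗ₜ t)) = counit (R := K) s * counit (R := K) t
  protected comul_mul (s t : V) : comul (R := K) (mul (s ⊗ₜ t)) =
    TensorProduct.map mul mul
      (TensorProduct.AlgebraTensorModule.tensorTensorTensorComm K K K K _ _ _ _
        (comul s ⊗ₜ comul t))

namespace BialgebraData

variable {K V : Type*} [Field K] [AddCommGroup V] [Module K V] [Coalgebra K V]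

/-- The space `V`, wrapped so as to carry the bialgebra structure given by the data `D`. -/
@[ext] structure Carrier (_ : BialgebraData K V) where
  of ::
  val : V

namespace Carrier

variable (D : BialgebraData K V)

/-- The identity map between the wrapped space and `V`. -/
def equiv : Carrier D ≃ V where
  toFun := val
  invFun := of
  left_inv _ := rfl
  right_inv _ := rfl

noncomputable instance : Ring (Carrier D) where
  __ := (equiv D).addCommGroup
  mul s t := of (D.mul (s.val ⊗ₜ t.val))
  one := of D.one
  mul_assoc r s t := Carrier.ext (D.mul_assoc r.val s.val t.val)
  one_mul s := Carrier.ext (D.one_mul s.val)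
  mul_one s := Carrier.ext (D.mul_one s.val)
  left_distrib r s t := Carrier.ext
    ((congrArg D.mul (TensorProduct.tmul_add r.val s.val t.val)).trans (map_add _ _ _))
  right_distrib r s t := Carrier.ext
    ((congrArg D.mul (TensorProduct.add_tmul r.val s.val t.val)).trans (map_add _ _ _))
  zero_mul r := Carrier.ext
    ((congrArg D.mul (TensorProduct.zero_tmul _ r.val)).trans (map_zero _))
  mul_zero r := Carrier.ext
    ((congrArg D.mul (TensorProduct.tmul_zero _ r.val)).trans (map_zero _))

theorem val_mul (s t : Carrier D) : (s * t).val = D.mul (s.val ⊗ₜ t.val) := rfl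

theorem val_one : (1 : Carrier D).val = D.one := rfl

theorem val_add (s t : Carrier D) : (s + t).val = s.val + t.val := rfl

theorem val_zero : (0 : Carrier D).val = 0 := rfl

noncomputable instance : Algebra K (Carrier D) where
  smul r s := of (r • s.val)
  algebraMap :=
    { toFun := fun r => of (r • D.one)
      map_one' := Carrier.ext (one_smul K D.one)
      map_zero' := Carrier.ext (zero_smul K D.one)
      map_add' := fun r s => Carrier.ext (add_smul r s D.one)
      map_mul' := fun r s => Carrier.ext (by
        rw [val_mul, ← TensorProduct.smul_tmul', map_smul, D.one_mul, smul_smul]) }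
  commutes' r s := Carrier.ext (by
    rw [val_mul, val_mul]
    change D.mul ((r • D.one) ⊗ₜ s.val) = D.mul (s.val ⊗ₜ (r • D.one))
    rw [← TensorProduct.smul_tmul', TensorProduct.tmul_smul, map_smul, map_smul, D.one_mul,
      D.mul_one])
  smul_def' r s := Carrier.ext (by
    rw [val_mul]
    change r • s.val = D.mul ((r • D.one) ⊗ₜ s.val)
    rw [← TensorProduct.smul_tmul', map_smul, D.one_mul])

theorem val_smul (r : K) (s : Carrier D) : (r • s).val = r • s.val := rfl

/-- The identity map between the wrapped space and `V`. -/
noncomputable def linearEquiv : Carrier D ≃ₗ[K] V where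
  __ := equiv D
  map_add' _ _ := rfl
  map_smul' _ _ := rfl

noncomputable instance : CoalgebraStruct K (Carrier D) where
  comul := TensorProduct.map (linearEquiv D).symm.toLinearMap (linearEquiv D).symm.toLinearMap ∘ₗ
    comul ∘ₗ (linearEquiv D).toLinearMap
  counit := counit ∘ₗ (linearEquiv D).toLinearMap

theorem comul_of (v : V) : comul (R := K) (of v : Carrier D) =
    TensorProduct.map (linearEquiv D).symm.toLinearMap (linearEquiv D).symm.toLinearMap
      (comul v) := rfl

theorem counit_of (v : V) : counit (R := K) (of v : Carrier D) = counit v := rfl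

noncomputable instance : Coalgebra K (Carrier D) where
  coassoc := by
    ext s
    obtain ⟨v⟩ := s
    simp only [LinearMap.comp_apply, comul_of, LinearEquiv.coe_coe]
    have h1 : ∀ t : V ⊗[K] V, TensorProduct.assoc K _ _ _ (comul.rTensor _
        (TensorProduct.map (linearEquiv D).symm.toLinearMap (linearEquiv D).symm.toLinearMap t)) =
        TensorProduct.map (linearEquiv D).symm.toLinearMap
          (TensorProduct.map (linearEquiv D).symm.toLinearMap (linearEquiv D).symm.toLinearMap)
          (TensorProduct.assoc K _ _ _ (comul.rTensor _ t)) := by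
      intro t
      induction t with
      | zero => simp only [map_zero, TensorProduct.zero_tmul, TensorProduct.tmul_zero]
      | add s t hs ht => simp only [LinearMap.map_add, LinearEquiv.map_add, hs, ht]
      | tmul v w =>
        rw [TensorProduct.map_tmul, LinearMap.rTensor_tmul, LinearMap.rTensor_tmul]
        change TensorProduct.assoc K _ _ _
          (TensorProduct.map _ _ (comul v) ⊗ₜ (linearEquiv D).symm w) = _
        generalize comul (R := K) v = u
        induction u with
        | zero => simp only [map_zero, TensorProduct.zero_tmul, TensorProduct.tmul_zero]
        | add s t hs ht => simp only [LinearMap.map_add, LinearEquiv.map_add, hs, ht, TensorProduct.add_tmul]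
        | tmul a b => rfl
    have h2 : ∀ t : V ⊗[K] V, comul.lTensor _
        (TensorProduct.map (linearEquiv D).symm.toLinearMap (linearEquiv D).symm.toLinearMap t) =
        TensorProduct.map (linearEquiv D).symm.toLinearMap
          (TensorProduct.map (linearEquiv D).symm.toLinearMap (linearEquiv D).symm.toLinearMap)
          (comul.lTensor _ t) := by
      intro t
      induction t with
      | zero => simp only [map_zero, TensorProduct.zero_tmul, TensorProduct.tmul_zero]
      | add s t hs ht => simp only [LinearMap.map_add, LinearEquiv.map_add, hs, ht]
      | tmul v w => rfl
    rw [h1, h2, coassoc_apply]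
  rTensor_counit_comp_comul := by
    ext s
    obtain ⟨v⟩ := s
    simp only [LinearMap.comp_apply, comul_of]
    have h1 : ∀ t : V ⊗[K] V, (counit (R := K) (A := Carrier D)).rTensor _
        (TensorProduct.map (linearEquiv D).symm.toLinearMap (linearEquiv D).symm.toLinearMap t) =
        (linearEquiv D).symm.toLinearMap.lTensor K (counit.rTensor _ t) := by
      intro t
      induction t with
      | zero => simp only [map_zero, TensorProduct.zero_tmul, TensorProduct.tmul_zero]
      | add s t hs ht => simp only [LinearMap.map_add, LinearEquiv.map_add, hs, ht]
      | tmul v w => rfl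
    rw [h1, rTensor_counit_comul]
    rfl
  lTensor_counit_comp_comul := by
    ext s
    obtain ⟨v⟩ := s
    simp only [LinearMap.comp_apply, comul_of]
    have h1 : ∀ t : V ⊗[K] V, (counit (R := K) (A := Carrier D)).lTensor _
        (TensorProduct.map (linearEquiv D).symm.toLinearMap (linearEquiv D).symm.toLinearMap t) =
        (linearEquiv D).symm.toLinearMap.rTensor K (counit.lTensor _ t) := by
      intro t
      induction t with
      | zero => simp only [map_zero, TensorProduct.zero_tmul, TensorProduct.tmul_zero]
      | add s t hs ht => simp only [LinearMap.map_add, LinearEquiv.map_add, hs, ht]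
      | tmul v w => rfl
    rw [h1, lTensor_counit_comul]
    rfl

theorem map_mul_map (u v : V ⊗[K] V) :
    TensorProduct.map (linearEquiv D).symm.toLinearMap (linearEquiv D).symm.toLinearMap u *
      TensorProduct.map (linearEquiv D).symm.toLinearMap (linearEquiv D).symm.toLinearMap v =
    TensorProduct.map (linearEquiv D).symm.toLinearMap (linearEquiv D).symm.toLinearMap
      (TensorProduct.map D.mul D.mul
        (TensorProduct.AlgebraTensorModule.tensorTensorTensorComm K K K K _ _ _ _ (u ⊗ₜ v))) := by
  induction u with
  | zero => simp only [map_zero, TensorProduct.zero_tmul, TensorProduct.tmul_zero, zero_mul, mul_zero]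
  | add s t hs ht => simp only [LinearMap.map_add, LinearEquiv.map_add, add_mul, hs, ht, TensorProduct.add_tmul]
  | tmul s t =>
    induction v with
    | zero => simp only [map_zero, TensorProduct.zero_tmul, TensorProduct.tmul_zero, zero_mul, mul_zero]
    | add s t hs ht => simp only [LinearMap.map_add, LinearEquiv.map_add, mul_add, hs, ht, TensorProduct.tmul_add]
    | tmul s' t' =>
      rw [TensorProduct.map_tmul, TensorProduct.map_tmul, Algebra.TensorProduct.tmul_mul_tmul]
      rfl

noncomputable instance : Bialgebra K (Carrier D) :=
  Bialgebra.mk' K (Carrier D) D.counit_one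
    (fun {a b} => D.counit_mul a.val b.val)
    (by
      change TensorProduct.map _ _ (comul (R := K) D.one) = _
      rw [D.comul_one]
      rfl)
    (fun {a b} => by
      obtain ⟨a⟩ := a
      obtain ⟨b⟩ := b
      exact (congrArg _ (D.comul_mul a b)).trans (map_mul_map D _ _).symm)

end Carrier

end BialgebraData

end

/-- A matched pair of Hopf algebras `(A, H, ◁, ▷)` over `K`: linear maps `left = ▷ : H ⊗ A → A` and
`right = ◁ : H ⊗ A → H` making `A` a left `H`-module coalgebra (a left module whose action is a
coalgebra map for the tensor product coalgebra `H ⊗ A`) and `H` a right `A`-module coalgebra,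
subject to the compatibility conditions. -/
structure MatchedPair (K : Type u) (A : Type v) (H : Type w) [Field K] [Ring A] [Ring H]
    [HopfAlgebra K A] [HopfAlgebra K H] where
  /-- The left action `y ▷ a`, a coalgebra map. -/
  left : H ⊗[K] A →ₗc[K] A
  /-- The right action `y ◁ a`, a coalgebra map. -/
  right : H ⊗[K] A →ₗc[K] H
  one_left (a : A) : left (1 ⊗ₜ a) = a
  mul_left (y z : H) (a : A) : left ((y * z) ⊗ₜ a) = left (y ⊗ₜ left (z ⊗ₜ a))
  right_one (y : H) : right (y ⊗ₜ 1) = y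
  right_mul (y : H) (a b : A) : right (y ⊗ₜ (a * b)) = right (right (y ⊗ₜ a) ⊗ₜ b)
  /-- `y ▷ 1 = ε(y) 1`. -/
  left_one (y : H) : left (y ⊗ₜ 1) = algebraMap K A (Coalgebra.counit y)
  /-- `1 ◁ a = ε(a) 1`. -/
  one_right (a : A) : right (1 ⊗ₜ a) = algebraMap K H (Coalgebra.counit a)
  /-- `y ▷ (a b) = (y₁ ▷ a₁) ((y₂ ◁ a₂) ▷ b)`. -/
  left_mul (y : H) (a b : A) :
    left (y ⊗ₜ (a * b)) =
      LinearMap.mul' K A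
        (TensorProduct.map left.toLinearMap
          (left.toLinearMap ∘ₗ (TensorProduct.mk K H A).flip b ∘ₗ right.toLinearMap)
          (Coalgebra.comul (y ⊗ₜ[K] a)))
  /-- `(y z) ◁ a = (y ◁ (z₁ ▷ a₁)) (z₂ ◁ a₂)`. -/
  mul_right (y z : H) (a : A) :
    right ((y * z) ⊗ₜ a) =
      LinearMap.mul' K H
        (TensorProduct.map
          (right.toLinearMap ∘ₗ TensorProduct.mk K H A y ∘ₗ left.toLinearMap)
          right.toLinearMap
          (Coalgebra.comul (z ⊗ₜ[K] a)))
  /-- `(y₁ ◁ a₁) ⊗ (y₂ ▷ a₂) = (y₂ ◁ a₂) ⊗ (y₁ ▷ a₁)`. -/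
  compat (y : H) (a : A) :
    TensorProduct.map right.toLinearMap left.toLinearMap (Coalgebra.comul (y ⊗ₜ[K] a)) =
      TensorProduct.comm K A H
        (TensorProduct.map left.toLinearMap right.toLinearMap (Coalgebra.comul (y ⊗ₜ[K] a)))

namespace MatchedPair

variable {K : Type u} {A : Type v} {H : Type w} [Field K] [Ring A] [Ring H]
  [HopfAlgebra K A] [HopfAlgebra K H] (P : MatchedPair K A H)

open Coalgebra

/-- The map `y ⊗ a ↦ (y₁ ▷ a₁) ⊗ (y₂ ◁ a₂)`. -/
noncomputable def braid : H ⊗[K] A →ₗ[K] A ⊗[K] H :=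
  TensorProduct.map P.left.toLinearMap P.right.toLinearMap ∘ₗ comul

/-- The multiplication of the bicrossed product, on the tensor product `A ⊗ H`:
`(a ⋈ y) (b ⋈ z) = a (y₁ ▷ b₁) ⋈ (y₂ ◁ b₂) z`. -/
noncomputable def mulMap : (A ⊗[K] H) ⊗[K] (A ⊗[K] H) →ₗ[K] A ⊗[K] H :=
  TensorProduct.map (LinearMap.mul' K A) (LinearMap.mul' K H) ∘ₗ
    (TensorProduct.assoc K A A (H ⊗[K] H)).symm.toLinearMap ∘ₗ
    TensorProduct.map LinearMap.id
      ((TensorProduct.assoc K A H H).toLinearMap ∘ₗ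
        TensorProduct.map P.braid LinearMap.id ∘ₗ
        (TensorProduct.assoc K H A H).symm.toLinearMap) ∘ₗ
    (TensorProduct.assoc K A H (A ⊗[K] H)).toLinearMap

/-- The map `b ⊗ y ↦ a b ⊗ y z`. -/
noncomputable def lr (a : A) (z : H) : A ⊗[K] H →ₗ[K] A ⊗[K] H :=
  TensorProduct.map (LinearMap.mulLeft K a) (LinearMap.mulRight K z)

@[simp] theorem lr_tmul (a b : A) (y z : H) :
    lr (K := K) a z (b ⊗ₜ y) = (a * b) ⊗ₜ (y * z) := rfl

theorem lr_lr (a b : A) (y z : H) (s : A ⊗[K] H) :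
    lr a z (lr b y s) = lr (a * b) (y * z) s := by
  induction s with
  | zero => simp only [map_zero, TensorProduct.zero_tmul, TensorProduct.tmul_zero]
  | add s t hs ht => simp only [LinearMap.map_add, LinearEquiv.map_add, hs, ht]
  | tmul c w => simp [mul_assoc]

@[simp] theorem lr_one_one (s : A ⊗[K] H) : lr (1 : A) (1 : H) s = s := by
  induction s with
  | zero => simp only [map_zero, TensorProduct.zero_tmul, TensorProduct.tmul_zero]
  | add s t hs ht => simp only [LinearMap.map_add, LinearEquiv.map_add, hs, ht]
  | tmul c w => simp

theorem mulMap_tmul (a b : A) (y z : H) :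
    P.mulMap ((a ⊗ₜ y) ⊗ₜ (b ⊗ₜ z)) = lr a z (P.braid (y ⊗ₜ b)) := by
  simp only [mulMap, LinearMap.comp_apply, LinearEquiv.coe_coe, TensorProduct.assoc_tmul,
    TensorProduct.map_tmul, LinearMap.id_apply, TensorProduct.assoc_symm_tmul]
  generalize P.braid (y ⊗ₜ b) = s
  induction s with
  | zero => simp only [map_zero, TensorProduct.zero_tmul, TensorProduct.tmul_zero]
  | tmul p r => simp
  | add s t hs ht => simp only [TensorProduct.add_tmul, TensorProduct.tmul_add, LinearMap.map_add, LinearEquiv.map_add, hs, ht]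

theorem lr_mulMap (a : A) (z : H) (s t : A ⊗[K] H) :
    P.mulMap (lr a 1 s ⊗ₜ lr 1 z t) = lr a z (P.mulMap (s ⊗ₜ t)) := by
  induction s with
  | zero => simp only [map_zero, TensorProduct.zero_tmul, TensorProduct.tmul_zero]
  | add s s' hs hs' => simp only [TensorProduct.add_tmul, LinearMap.map_add, LinearEquiv.map_add, hs, hs']
  | tmul b y =>
    induction t with
    | zero => simp only [map_zero, TensorProduct.zero_tmul, TensorProduct.tmul_zero]
    | add s s' hs hs' => simp only [TensorProduct.tmul_add, LinearMap.map_add, LinearEquiv.map_add, hs, hs']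
    | tmul c w =>
      simp only [lr_tmul, mulMap_tmul, one_mul, mul_one, lr_lr]

theorem braid_one_left (a : A) : P.braid (1 ⊗ₜ a) = a ⊗ₜ 1 := by
  have key : ∀ t : A ⊗[K] A, TensorProduct.map P.left.toLinearMap P.right.toLinearMap
      (TensorProduct.AlgebraTensorModule.tensorTensorTensorComm K K K K H H A A
        ((1 ⊗ₜ 1) ⊗ₜ t)) = (TensorProduct.rid K A (counit.lTensor A t)) ⊗ₜ (1 : H) := by
    intro t
    induction t with
    | zero => simp only [map_zero, TensorProduct.zero_tmul, TensorProduct.tmul_zero]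
    | add s s' hs hs' => simp only [TensorProduct.tmul_add, LinearMap.map_add, LinearEquiv.map_add, hs, hs', TensorProduct.add_tmul]
    | tmul c w =>
      simp [P.one_left, P.one_right, Algebra.algebraMap_eq_smul_one, TensorProduct.smul_tmul]
  rw [braid, LinearMap.comp_apply, TensorProduct.comul_tmul, Bialgebra.comul_one,
    Algebra.TensorProduct.one_def, key, lTensor_counit_comul]
  simp

theorem braid_one_right (y : H) : P.braid (y ⊗ₜ 1) = 1 ⊗ₜ y := by
  have key : ∀ t : H ⊗[K] H, TensorProduct.map P.left.toLinearMap P.right.toLinearMap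
      (TensorProduct.AlgebraTensorModule.tensorTensorTensorComm K K K K H H A A
        (t ⊗ₜ (1 ⊗ₜ 1))) = (1 : A) ⊗ₜ (TensorProduct.lid K H (counit.rTensor H t)) := by
    intro t
    induction t with
    | zero => simp only [map_zero, TensorProduct.zero_tmul, TensorProduct.tmul_zero]
    | add s s' hs hs' => simp only [TensorProduct.add_tmul, LinearMap.map_add, LinearEquiv.map_add, hs, hs', TensorProduct.tmul_add]
    | tmul c w =>
      simp [P.left_one, P.right_one, Algebra.algebraMap_eq_smul_one, TensorProduct.smul_tmul]
  rw [braid, LinearMap.comp_apply, TensorProduct.comul_tmul, Bialgebra.comul_one,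
    Algebra.TensorProduct.one_def, key, rTensor_counit_comul]
  simp

/-- `r ⊗ (v ⊗ w) ↦ (left r) (left (right v ⊗ c)) ⊗ right (right w ⊗ d)` -/
noncomputable def auxR (c d : A) :
    (H ⊗[K] A) ⊗[K] ((H ⊗[K] A) ⊗[K] (H ⊗[K] A)) →ₗ[K] A ⊗[K] H :=
  (LinearMap.mul' K A).rTensor H ∘ₗ (TensorProduct.assoc K A A H).symm.toLinearMap ∘ₗ
    TensorProduct.map P.left.toLinearMap
      (TensorProduct.map
        (P.left.toLinearMap ∘ₗ (TensorProduct.mk K H A).flip c ∘ₗ P.right.toLinearMap)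
        (P.right.toLinearMap ∘ₗ (TensorProduct.mk K H A).flip d ∘ₗ P.right.toLinearMap))

theorem auxR_tmul (c d : A) (r v w : H ⊗[K] A) :
    P.auxR c d (r ⊗ₜ (v ⊗ₜ w)) =
      (P.left r * P.left (P.right v ⊗ₜ c)) ⊗ₜ P.right (P.right w ⊗ₜ d) := rfl

theorem left_lTensor (c : A) (t : H ⊗[K] A) :
    P.left ((LinearMap.mulRight K c).lTensor H t) =
      LinearMap.mul' K A
        (TensorProduct.map P.left.toLinearMap
          (P.left.toLinearMap ∘ₗ (TensorProduct.mk K H A).flip c ∘ₗ P.right.toLinearMap)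
          (comul t)) := by
  induction t with
  | zero => simp
  | add s t hs ht => simp only [map_add, hs, ht]
  | tmul y b => exact P.left_mul y b c

theorem right_lTensor (c : A) (t : H ⊗[K] A) :
    P.right ((LinearMap.mulRight K c).lTensor H t) = P.right (P.right t ⊗ₜ c) := by
  induction t with
  | zero => simp
  | add s t hs ht => simp only [map_add, hs, ht, TensorProduct.add_tmul]
  | tmul y b => exact P.right_mul y b c

theorem auxR_left (c d : A) (r : (H ⊗[K] A) ⊗[K] (H ⊗[K] A)) :
    TensorProduct.map (P.left.toLinearMap ∘ₗ (LinearMap.mulRight K c).lTensor H)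
      (P.right.toLinearMap ∘ₗ (LinearMap.mulRight K d).lTensor H) r =
    P.auxR c d (TensorProduct.assoc K _ _ _ (comul.rTensor _ r)) := by
  induction r with
  | zero => simp only [map_zero, TensorProduct.zero_tmul, TensorProduct.tmul_zero]
  | add s t hs ht => simp only [LinearMap.map_add, LinearEquiv.map_add, hs, ht]
  | tmul s t =>
    simp only [TensorProduct.map_tmul, LinearMap.comp_apply, LinearMap.rTensor_tmul]
    erw [left_lTensor, right_lTensor]
    generalize comul (R := K) s = u
    induction u with
    | zero => simp only [map_zero, TensorProduct.zero_tmul, TensorProduct.tmul_zero]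
    | add s t hs ht => simp only [LinearMap.map_add, LinearEquiv.map_add, hs, ht, TensorProduct.add_tmul]
    | tmul v w => rfl

theorem braid_repr_right {ι : Type*} {c : A} (𝓡 : Coalgebra.Repr K c ι) (y : H) :
    P.braid (y ⊗ₜ c) = ∑ i ∈ 𝓡.index,
      TensorProduct.map (P.left.toLinearMap ∘ₗ (TensorProduct.mk K H A).flip (𝓡.left i))
        (P.right.toLinearMap ∘ₗ (TensorProduct.mk K H A).flip (𝓡.right i)) (comul y) := by
  rw [braid, LinearMap.comp_apply, TensorProduct.comul_tmul, ← 𝓡.eq]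
  generalize comul (R := K) y = u
  simp only [TensorProduct.tmul_sum, map_sum]
  refine Finset.sum_congr rfl fun i _ => ?_
  induction u with
  | zero => simp only [map_zero, TensorProduct.zero_tmul, TensorProduct.tmul_zero]
  | add s t hs ht => simp only [LinearMap.map_add, LinearEquiv.map_add, hs, ht, TensorProduct.add_tmul]
  | tmul v w => rfl

theorem auxR_right {ι : Type*} {c : A} (𝓡 : Coalgebra.Repr K c ι)
    (r : (H ⊗[K] A) ⊗[K] (H ⊗[K] A)) :
    P.mulMap (TensorProduct.map P.left.toLinearMap P.right.toLinearMap r ⊗ₜ (c ⊗ₜ 1)) =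
      ∑ i ∈ 𝓡.index, P.auxR (𝓡.left i) (𝓡.right i) (comul.lTensor _ r) := by
  induction r with
  | zero => simp only [LinearMap.map_zero, LinearEquiv.map_zero, TensorProduct.zero_tmul,
    TensorProduct.tmul_zero, Finset.sum_const_zero, zero_mul, mul_zero]
  | add s t hs ht =>
    simp only [LinearMap.map_add, LinearEquiv.map_add, hs, ht, TensorProduct.add_tmul, Finset.sum_add_distrib]
  | tmul s t =>
    simp only [TensorProduct.map_tmul, LinearMap.lTensor_tmul, mulMap_tmul]
    rw [P.braid_repr_right 𝓡]
    have h : comul (R := K) (P.right t) =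
        TensorProduct.map P.right.toLinearMap P.right.toLinearMap (comul t) :=
      (CoalgHomClass.map_comp_comul_apply P.right t).symm
    erw [h]
    generalize comul (R := K) t = u
    rw [map_sum]
    refine Finset.sum_congr rfl fun i _ => ?_
    induction u with
    | zero => simp only [map_zero, TensorProduct.zero_tmul, TensorProduct.tmul_zero]
    | add s t hs ht => simp only [LinearMap.map_add, LinearEquiv.map_add, hs, ht, TensorProduct.tmul_add]
    | tmul v w => simp [auxR_tmul]

theorem braid_mul_right (y : H) (b c : A) :
    P.braid (y ⊗ₜ (b * c)) = P.mulMap (P.braid (y ⊗ₜ b) ⊗ₜ (c ⊗ₜ 1)) := by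
  have h1 : P.braid (y ⊗ₜ (b * c)) = ∑ i ∈ (ℛ K c).index,
      TensorProduct.map
        (P.left.toLinearMap ∘ₗ (LinearMap.mulRight K ((ℛ K c).left i)).lTensor H)
        (P.right.toLinearMap ∘ₗ (LinearMap.mulRight K ((ℛ K c).right i)).lTensor H)
        (comul (y ⊗ₜ[K] b)) := by
    rw [braid, LinearMap.comp_apply, TensorProduct.comul_tmul, TensorProduct.comul_tmul,
      Bialgebra.comul_mul, ← (ℛ K c).eq]
    generalize comul (R := K) b = u
    generalize comul (R := K) y = v
    simp only [Finset.mul_sum, TensorProduct.tmul_sum, map_sum]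
    refine Finset.sum_congr rfl fun i _ => ?_
    induction u with
    | zero => simp only [map_zero, TensorProduct.zero_tmul, TensorProduct.tmul_zero, zero_mul, mul_zero]
    | add s t hs ht => simp only [LinearMap.map_add, LinearEquiv.map_add, hs, ht, TensorProduct.tmul_add, add_mul]
    | tmul a a' =>
      induction v with
      | zero => simp only [map_zero, TensorProduct.zero_tmul, TensorProduct.tmul_zero]
      | add s t hs ht => simp only [LinearMap.map_add, LinearEquiv.map_add, hs, ht, TensorProduct.add_tmul]
      | tmul z z' => simp
  rw [h1, braid, LinearMap.comp_apply, P.auxR_right (ℛ K c)]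
  refine Finset.sum_congr rfl fun i _ => ?_
  rw [auxR_left, coassoc_apply]

/-- `(r ⊗ v) ⊗ w ↦ left (y ⊗ left r) ⊗ right (z ⊗ left v) (right w)` -/
noncomputable def auxL (y z : H) :
    ((H ⊗[K] A) ⊗[K] (H ⊗[K] A)) ⊗[K] (H ⊗[K] A) →ₗ[K] A ⊗[K] H :=
  (LinearMap.mul' K H).lTensor A ∘ₗ (TensorProduct.assoc K A H H).toLinearMap ∘ₗ
    TensorProduct.map
      (TensorProduct.map
        (P.left.toLinearMap ∘ₗ TensorProduct.mk K H A y ∘ₗ P.left.toLinearMap)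
        (P.right.toLinearMap ∘ₗ TensorProduct.mk K H A z ∘ₗ P.left.toLinearMap))
      P.right.toLinearMap

theorem auxL_tmul (y z : H) (r v w : H ⊗[K] A) :
    P.auxL y z ((r ⊗ₜ v) ⊗ₜ w) =
      P.left (y ⊗ₜ P.left r) ⊗ₜ (P.right (z ⊗ₜ P.left v) * P.right w) := rfl

theorem right_rTensor (y : H) (t : H ⊗[K] A) :
    P.right ((LinearMap.mulLeft K y).rTensor A t) =
      LinearMap.mul' K H
        (TensorProduct.map
          (P.right.toLinearMap ∘ₗ TensorProduct.mk K H A y ∘ₗ P.left.toLinearMap)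
          P.right.toLinearMap (comul t)) := by
  induction t with
  | zero => simp
  | add s t hs ht => simp only [map_add, hs, ht]
  | tmul z b => exact P.mul_right y z b

theorem left_rTensor (y : H) (t : H ⊗[K] A) :
    P.left ((LinearMap.mulLeft K y).rTensor A t) = P.left (y ⊗ₜ P.left t) := by
  induction t with
  | zero => simp
  | add s t hs ht => simp only [map_add, hs, ht, TensorProduct.tmul_add]
  | tmul z b => exact P.mul_left y z b

theorem auxL_right (y z : H) (r : (H ⊗[K] A) ⊗[K] (H ⊗[K] A)) :
    TensorProduct.map (P.left.toLinearMap ∘ₗ (LinearMap.mulLeft K y).rTensor A)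
      (P.right.toLinearMap ∘ₗ (LinearMap.mulLeft K z).rTensor A) r =
    P.auxL y z ((TensorProduct.assoc K _ _ _).symm (comul.lTensor _ r)) := by
  induction r with
  | zero => simp only [map_zero, TensorProduct.zero_tmul, TensorProduct.tmul_zero]
  | add s t hs ht => simp only [LinearMap.map_add, LinearEquiv.map_add, hs, ht]
  | tmul s t =>
    simp only [TensorProduct.map_tmul, LinearMap.comp_apply, LinearMap.lTensor_tmul]
    erw [left_rTensor, right_rTensor]
    generalize comul (R := K) t = u
    induction u with
    | zero => simp only [map_zero, TensorProduct.zero_tmul, TensorProduct.tmul_zero]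
    | add s t hs ht => simp only [LinearMap.map_add, LinearEquiv.map_add, hs, ht, TensorProduct.tmul_add]
    | tmul v w => rfl

theorem braid_repr_left {ι : Type*} {y : H} (𝓡 : Coalgebra.Repr K y ι) (c : A) :
    P.braid (y ⊗ₜ c) = ∑ i ∈ 𝓡.index,
      TensorProduct.map (P.left.toLinearMap ∘ₗ TensorProduct.mk K H A (𝓡.left i))
        (P.right.toLinearMap ∘ₗ TensorProduct.mk K H A (𝓡.right i)) (comul c) := by
  rw [braid, LinearMap.comp_apply, TensorProduct.comul_tmul, ← 𝓡.eq]
  generalize comul (R := K) c = u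
  simp only [TensorProduct.sum_tmul, map_sum]
  refine Finset.sum_congr rfl fun i _ => ?_
  induction u with
  | zero => simp only [map_zero, TensorProduct.zero_tmul, TensorProduct.tmul_zero]
  | add s t hs ht => simp only [LinearMap.map_add, LinearEquiv.map_add, hs, ht, TensorProduct.tmul_add]
  | tmul v w => rfl

theorem auxL_left {ι : Type*} {y : H} (𝓡 : Coalgebra.Repr K y ι)
    (r : (H ⊗[K] A) ⊗[K] (H ⊗[K] A)) :
    P.mulMap ((1 ⊗ₜ y) ⊗ₜ TensorProduct.map P.left.toLinearMap P.right.toLinearMap r) =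
      ∑ i ∈ 𝓡.index, P.auxL (𝓡.left i) (𝓡.right i) (comul.rTensor _ r) := by
  induction r with
  | zero => simp only [LinearMap.map_zero, LinearEquiv.map_zero, TensorProduct.zero_tmul,
    TensorProduct.tmul_zero, Finset.sum_const_zero, zero_mul, mul_zero]
  | add s t hs ht =>
    simp only [LinearMap.map_add, LinearEquiv.map_add, hs, ht, TensorProduct.tmul_add, Finset.sum_add_distrib]
  | tmul s t =>
    simp only [TensorProduct.map_tmul, LinearMap.rTensor_tmul, mulMap_tmul]
    rw [P.braid_repr_left 𝓡]
    have h : comul (R := K) (P.left s) =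
        TensorProduct.map P.left.toLinearMap P.left.toLinearMap (comul s) :=
      (CoalgHomClass.map_comp_comul_apply P.left s).symm
    erw [h]
    generalize comul (R := K) s = u
    rw [map_sum]
    refine Finset.sum_congr rfl fun i _ => ?_
    induction u with
    | zero => simp only [map_zero, TensorProduct.zero_tmul, TensorProduct.tmul_zero]
    | add s t hs ht => simp only [LinearMap.map_add, LinearEquiv.map_add, hs, ht, TensorProduct.add_tmul]
    | tmul v w => simp [auxL_tmul]

theorem braid_mul_left (y z : H) (c : A) :
    P.braid ((y * z) ⊗ₜ c) = P.mulMap ((1 ⊗ₜ y) ⊗ₜ P.braid (z ⊗ₜ c)) := by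
  have h1 : P.braid ((y * z) ⊗ₜ c) = ∑ i ∈ (ℛ K y).index,
      TensorProduct.map
        (P.left.toLinearMap ∘ₗ (LinearMap.mulLeft K ((ℛ K y).left i)).rTensor A)
        (P.right.toLinearMap ∘ₗ (LinearMap.mulLeft K ((ℛ K y).right i)).rTensor A)
        (comul (z ⊗ₜ[K] c)) := by
    rw [braid, LinearMap.comp_apply, TensorProduct.comul_tmul, TensorProduct.comul_tmul,
      Bialgebra.comul_mul, ← (ℛ K y).eq]
    generalize comul (R := K) c = u
    generalize comul (R := K) z = v
    simp only [Finset.sum_mul, TensorProduct.sum_tmul, map_sum]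
    refine Finset.sum_congr rfl fun i _ => ?_
    induction u with
    | zero => simp only [map_zero, TensorProduct.zero_tmul, TensorProduct.tmul_zero]
    | add s t hs ht => simp only [LinearMap.map_add, LinearEquiv.map_add, hs, ht, TensorProduct.tmul_add]
    | tmul a a' =>
      induction v with
      | zero => simp only [map_zero, TensorProduct.zero_tmul, TensorProduct.tmul_zero, zero_mul, mul_zero]
      | add s t hs ht => simp only [LinearMap.map_add, LinearEquiv.map_add, hs, ht, TensorProduct.add_tmul, mul_add]
      | tmul z z' => simp
  rw [h1, braid, LinearMap.comp_apply, P.auxL_left (ℛ K y)]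
  refine Finset.sum_congr rfl fun i _ => ?_
  rw [auxL_right, coassoc_symm_apply]

theorem lr_left (a : A) (s t : A ⊗[K] H) :
    P.mulMap (lr a 1 s ⊗ₜ t) = lr a 1 (P.mulMap (s ⊗ₜ t)) := by
  simpa [lr_one_one] using P.lr_mulMap a 1 s t

theorem lr_right (z : H) (s t : A ⊗[K] H) :
    P.mulMap (s ⊗ₜ lr 1 z t) = lr 1 z (P.mulMap (s ⊗ₜ t)) := by
  simpa [lr_one_one] using P.lr_mulMap 1 z s t

theorem lr_comp (a : A) (z : H) (s : A ⊗[K] H) : lr a z s = lr (1 : A) z (lr a (1 : H) s) := by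
  simp [lr_lr]

theorem lr_comp' (a : A) (z : H) (s : A ⊗[K] H) : lr a z s = lr a (1 : H) (lr (1 : A) z s) := by
  simp [lr_lr]

/-- `(1 y) ((b 1) s) = braid (y b) s` -/
theorem aux1 (y : H) (b : A) (s : A ⊗[K] H) :
    P.mulMap ((1 ⊗ₜ y) ⊗ₜ lr b 1 s) = P.mulMap (P.braid (y ⊗ₜ b) ⊗ₜ s) := by
  induction s with
  | zero => simp only [map_zero, TensorProduct.zero_tmul, TensorProduct.tmul_zero]
  | add s s' hs hs' => simp only [TensorProduct.tmul_add, LinearMap.map_add, LinearEquiv.map_add, hs, hs']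
  | tmul c w =>
    have : (c ⊗ₜ[K] w) = lr 1 w (c ⊗ₜ[K] (1:H)) := by simp
    rw [this, lr_right, ← braid_mul_right, ← lr_comp', lr_comp, lr_right]
    simp [mulMap_tmul]

theorem aux2 (z : H) (c : A) (s : A ⊗[K] H) :
    P.mulMap (lr 1 z s ⊗ₜ (c ⊗ₜ 1)) = P.mulMap (s ⊗ₜ P.braid (z ⊗ₜ c)) := by
  induction s with
  | zero => simp only [map_zero, TensorProduct.zero_tmul, TensorProduct.tmul_zero]
  | add s s' hs hs' => simp only [TensorProduct.add_tmul, LinearMap.map_add, LinearEquiv.map_add, hs, hs']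
  | tmul a y =>
    have : (a ⊗ₜ[K] y) = lr a 1 ((1:A) ⊗ₜ[K] y) := by simp
    rw [this, lr_left, ← braid_mul_left, ← lr_comp, lr_comp', lr_left]
    simp [mulMap_tmul]

theorem mulMap_assoc (r s t : A ⊗[K] H) :
    P.mulMap (P.mulMap (r ⊗ₜ s) ⊗ₜ t) = P.mulMap (r ⊗ₜ P.mulMap (s ⊗ₜ t)) := by
  induction r with
  | zero => simp only [map_zero, TensorProduct.zero_tmul, TensorProduct.tmul_zero]
  | add s s' hs hs' => simp only [TensorProduct.add_tmul, LinearMap.map_add, LinearEquiv.map_add, hs, hs']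
  | tmul a y =>
  induction s with
  | zero => simp only [map_zero, TensorProduct.zero_tmul, TensorProduct.tmul_zero]
  | add s s' hs hs' => simp only [TensorProduct.add_tmul, TensorProduct.tmul_add, LinearMap.map_add, LinearEquiv.map_add, hs, hs']
  | tmul b z =>
  induction t with
  | zero => simp only [map_zero, TensorProduct.zero_tmul, TensorProduct.tmul_zero]
  | add s s' hs hs' => simp only [TensorProduct.tmul_add, LinearMap.map_add, LinearEquiv.map_add, hs, hs']
  | tmul c w =>
    have h1 : (c ⊗ₜ[K] w) = lr 1 w (c ⊗ₜ[K] (1:H)) := by simp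
    have h2 : (a ⊗ₜ[K] y) = lr a 1 ((1:A) ⊗ₜ[K] y) := by simp
    rw [h1, h2]
    simp only [lr_left, lr_right]
    rw [mulMap_tmul, mulMap_tmul, lr_comp', lr_one_one, aux2,
      lr_comp b, lr_one_one, aux1]

theorem one_mulMap (s : A ⊗[K] H) : P.mulMap ((1 ⊗ₜ 1) ⊗ₜ s) = s := by
  induction s with
  | zero => simp only [map_zero, TensorProduct.zero_tmul, TensorProduct.tmul_zero]
  | add s t hs ht => simp only [LinearMap.map_add, LinearEquiv.map_add, hs, ht, TensorProduct.tmul_add]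
  | tmul a y => simp [mulMap_tmul, braid_one_left]

theorem mulMap_one (s : A ⊗[K] H) : P.mulMap (s ⊗ₜ (1 ⊗ₜ 1)) = s := by
  induction s with
  | zero => simp only [map_zero, TensorProduct.zero_tmul, TensorProduct.tmul_zero]
  | add s t hs ht => simp only [LinearMap.map_add, LinearEquiv.map_add, hs, ht, TensorProduct.add_tmul]
  | tmul a y => simp [mulMap_tmul, braid_one_right]

theorem counit_braid (t : H ⊗[K] A) : counit (R := K) (P.braid t) = counit (R := K) t := by
  have key : ∀ r : (H ⊗[K] A) ⊗[K] (H ⊗[K] A),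
      counit (R := K) (TensorProduct.map P.left.toLinearMap P.right.toLinearMap r) =
        counit (R := K) r := by
    intro r
    induction r with
    | zero => simp only [map_zero, TensorProduct.zero_tmul, TensorProduct.tmul_zero]
    | add s t hs ht => simp only [LinearMap.map_add, LinearEquiv.map_add, hs, ht]
    | tmul s t =>
      simp only [TensorProduct.map_tmul, TensorProduct.counit_tmul]
      erw [CoalgHomClass.counit_comp_apply P.left, CoalgHomClass.counit_comp_apply P.right]
  have key2 : ∀ r : (H ⊗[K] A) ⊗[K] (H ⊗[K] A),
      counit (R := K) r = counit (R := K) (TensorProduct.lid K _ (counit.rTensor _ r)) := by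
    intro r
    induction r with
    | zero => simp only [map_zero, TensorProduct.zero_tmul, TensorProduct.tmul_zero]
    | add s t hs ht => simp only [LinearMap.map_add, LinearEquiv.map_add, hs, ht]
    | tmul s t => simp [mul_comm]
  rw [braid, LinearMap.comp_apply, key, key2, rTensor_counit_comul]
  simp

theorem compat_apply (t : H ⊗[K] A) :
    TensorProduct.map P.right.toLinearMap P.left.toLinearMap (comul t) =
      TensorProduct.comm K A H
        (TensorProduct.map P.left.toLinearMap P.right.toLinearMap (comul t)) := by
  induction t with
  | zero => simp only [map_zero, TensorProduct.zero_tmul, TensorProduct.tmul_zero]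
  | add s t hs ht => simp only [LinearMap.map_add, LinearEquiv.map_add, hs, ht]
  | tmul y a => exact P.compat y a


theorem comul_braid (t : H ⊗[K] A) :
    comul (R := K) (P.braid t) = TensorProduct.map P.braid P.braid (comul t) :=
  CoalgebraAux.comul_map_comul P.left P.right P.compat_apply t

theorem comul_lr {ι κ : Type*} {a : A} {z : H} (𝓡 : Coalgebra.Repr K a ι)
    (𝓢 : Coalgebra.Repr K z κ) (w : A ⊗[K] H) :
    comul (R := K) (lr a z w) = ∑ i ∈ 𝓡.index, ∑ j ∈ 𝓢.index,
      TensorProduct.map (lr (𝓡.left i) (𝓢.left j)) (lr (𝓡.right i) (𝓢.right j)) (comul w) := by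
  induction w with
  | zero => simp only [LinearMap.map_zero, LinearEquiv.map_zero, TensorProduct.zero_tmul,
    TensorProduct.tmul_zero, Finset.sum_const_zero, zero_mul, mul_zero]
  | add s t hs ht => simp only [LinearMap.map_add, LinearEquiv.map_add, hs, ht, Finset.sum_add_distrib]
  | tmul b y =>
    rw [lr_tmul, TensorProduct.comul_tmul, TensorProduct.comul_tmul, Bialgebra.comul_mul,
      Bialgebra.comul_mul, ← 𝓡.eq, ← 𝓢.eq]
    generalize comul (R := K) b = u
    generalize comul (R := K) y = v
    simp only [Finset.sum_mul, Finset.mul_sum, TensorProduct.sum_tmul, TensorProduct.tmul_sum,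
      map_sum]
    rw [Finset.sum_comm]
    refine Finset.sum_congr rfl fun i _ => Finset.sum_congr rfl fun j _ => ?_
    induction u with
    | zero => simp only [map_zero, TensorProduct.zero_tmul, TensorProduct.tmul_zero, zero_mul, mul_zero]
    | add s t hs ht => simp only [LinearMap.map_add, LinearEquiv.map_add, hs, ht, TensorProduct.add_tmul, mul_add]
    | tmul p r =>
      induction v with
      | zero => simp only [map_zero, TensorProduct.zero_tmul, TensorProduct.tmul_zero, zero_mul, mul_zero]
      | add s t hs ht => simp only [LinearMap.map_add, LinearEquiv.map_add, hs, ht, TensorProduct.tmul_add, add_mul]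
      | tmul p r => simp

theorem counit_lr (a : A) (z : H) (w : A ⊗[K] H) :
    counit (R := K) (lr a z w) = counit (R := K) a * counit (R := K) z * counit (R := K) w := by
  induction w with
  | zero => simp only [map_zero, TensorProduct.zero_tmul, TensorProduct.tmul_zero, zero_mul, mul_zero]
  | add s t hs ht => simp only [LinearMap.map_add, LinearEquiv.map_add, hs, ht, mul_add]
  | tmul b y =>
    rw [lr_tmul, TensorProduct.counit_tmul, TensorProduct.counit_tmul, Bialgebra.counit_mul,
      Bialgebra.counit_mul, smul_eq_mul, smul_eq_mul]
    ring

theorem mulMap_counit (s t : A ⊗[K] H) :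
    counit (R := K) (P.mulMap (s ⊗ₜ t)) = counit (R := K) s * counit (R := K) t := by
  induction s with
  | zero => simp only [map_zero, TensorProduct.zero_tmul, TensorProduct.tmul_zero, zero_mul, mul_zero]
  | add s s' hs hs' => simp only [TensorProduct.add_tmul, LinearMap.map_add, LinearEquiv.map_add, hs, hs', add_mul]
  | tmul a y =>
    induction t with
    | zero => simp only [map_zero, TensorProduct.zero_tmul, TensorProduct.tmul_zero, zero_mul, mul_zero]
    | add s s' hs hs' => simp only [TensorProduct.tmul_add, LinearMap.map_add, LinearEquiv.map_add, hs, hs', mul_add]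
    | tmul b z =>
      rw [mulMap_tmul, counit_lr, counit_braid, TensorProduct.counit_tmul,
        TensorProduct.counit_tmul, TensorProduct.counit_tmul, smul_eq_mul, smul_eq_mul,
        smul_eq_mul]
      ring

theorem mulMap_comul (s t : A ⊗[K] H) :
    comul (R := K) (P.mulMap (s ⊗ₜ t)) =
      TensorProduct.map P.mulMap P.mulMap
        (TensorProduct.AlgebraTensorModule.tensorTensorTensorComm K K K K _ _ _ _
          (comul s ⊗ₜ comul t)) := by
  induction s with
  | zero => simp only [map_zero, TensorProduct.zero_tmul, TensorProduct.tmul_zero]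
  | add s s' hs hs' => simp only [TensorProduct.add_tmul, LinearMap.map_add, LinearEquiv.map_add, hs, hs']
  | tmul a y =>
    induction t with
    | zero => simp only [map_zero, TensorProduct.zero_tmul, TensorProduct.tmul_zero]
    | add s s' hs hs' => simp only [TensorProduct.tmul_add, LinearMap.map_add, LinearEquiv.map_add, hs, hs']
    | tmul b z =>
      rw [mulMap_tmul, comul_lr (ℛ K a) (ℛ K z), comul_braid, TensorProduct.comul_tmul,
        TensorProduct.comul_tmul, TensorProduct.comul_tmul]
      conv_rhs => rw [← (ℛ K a).eq, ← (ℛ K z).eq]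
      generalize comul (R := K) b = u
      generalize comul (R := K) y = v
      simp only [TensorProduct.sum_tmul, TensorProduct.tmul_sum, map_sum]
      rw [Finset.sum_comm]
      refine Finset.sum_congr rfl fun i _ => Finset.sum_congr rfl fun j _ => ?_
      induction u with
      | zero => simp only [map_zero, TensorProduct.zero_tmul, TensorProduct.tmul_zero]
      | add s t hs ht => simp only [LinearMap.map_add, LinearEquiv.map_add, hs, ht, TensorProduct.add_tmul, TensorProduct.tmul_add]
      | tmul p r =>
        induction v with
        | zero => simp only [map_zero, TensorProduct.zero_tmul, TensorProduct.tmul_zero]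
        | add s t hs ht =>
          simp only [LinearMap.map_add, LinearEquiv.map_add, hs, ht, TensorProduct.add_tmul, TensorProduct.tmul_add]
        | tmul p' r' => simp [mulMap_tmul]

theorem comul_one_tmul_one :
    comul (R := K) ((1 : A) ⊗ₜ[K] (1 : H)) = (1 ⊗ₜ 1) ⊗ₜ (1 ⊗ₜ 1) := by
  rw [TensorProduct.comul_tmul, Bialgebra.comul_one, Bialgebra.comul_one]
  rfl

theorem counit_one_tmul_one : counit (R := K) ((1 : A) ⊗ₜ[K] (1 : H)) = 1 := by
  rw [TensorProduct.counit_tmul, Bialgebra.counit_one, Bialgebra.counit_one, smul_eq_mul, mul_one]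

/-- The tensor product coalgebra `A ⊗ H` with the unit and the multiplication of the bicrossed
product. -/
noncomputable def bialgebraData : BialgebraData K (A ⊗[K] H) where
  mul := P.mulMap
  one := 1 ⊗ₜ 1
  mul_assoc := P.mulMap_assoc
  one_mul := P.one_mulMap
  mul_one := P.mulMap_one
  counit_one := counit_one_tmul_one
  comul_one := comul_one_tmul_one
  counit_mul := P.mulMap_counit
  comul_mul := P.mulMap_comul

/-- The bicrossed product `A ⋈ H`: the tensor product coalgebra `A ⊗ H` with unit `1 ⋈ 1` and
multiplication `(a ⋈ y) (b ⋈ z) = a (y₁ ▷ b₁) ⋈ (y₂ ◁ b₂) z`. -/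
abbrev BicrossedProduct : Type (max v w) := BialgebraData.Carrier P.bialgebraData

namespace BicrossedProduct

open BialgebraData

/-- The element `a ⋈ y`. -/
noncomputable def mk (a : A) (y : H) : P.BicrossedProduct := Carrier.of (a ⊗ₜ[K] y)

theorem mk_mul_mk (a b : A) (y z : H) :
    mk P a y * mk P b z = Carrier.of (lr a z (P.braid (y ⊗ₜ b))) :=
  Carrier.ext (P.mulMap_tmul a b y z)

/-- The rearrangement `(a ⊗ b) ⊗ (y ⊗ z) ↦ (a ⋈ y) ⊗ (b ⋈ z)`. -/
noncomputable def shuffle : (A ⊗[K] A) ⊗[K] (H ⊗[K] H) →ₗ[K]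
    P.BicrossedProduct ⊗[K] P.BicrossedProduct :=
  TensorProduct.map (Carrier.linearEquiv _).symm.toLinearMap
    (Carrier.linearEquiv _).symm.toLinearMap ∘ₗ
  (TensorProduct.AlgebraTensorModule.tensorTensorTensorComm K K K K A A H H).toLinearMap

theorem shuffle_tmul (a b : A) (y z : H) :
    shuffle P ((a ⊗ₜ b) ⊗ₜ (y ⊗ₜ z)) = mk P a y ⊗ₜ mk P b z := rfl

theorem comul_mk (a : A) (y : H) :
    comul (R := K) (mk P a y) = shuffle P (comul a ⊗ₜ comul y) := rfl

theorem counit_mk (a : A) (y : H) :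
    counit (R := K) (mk P a y) = counit (R := K) y * counit (R := K) a := rfl

/-- The embedding `a ↦ a ⋈ 1`. -/
noncomputable def inl : A →ₗ[K] P.BicrossedProduct :=
  (Carrier.linearEquiv _).symm.toLinearMap ∘ₗ (TensorProduct.mk K A H).flip 1

/-- The embedding `y ↦ 1 ⋈ y`. -/
noncomputable def inr : H →ₗ[K] P.BicrossedProduct :=
  (Carrier.linearEquiv _).symm.toLinearMap ∘ₗ TensorProduct.mk K A H 1

theorem inl_apply (a : A) : inl P a = mk P a 1 := rfl

theorem inr_apply (y : H) : inr P y = mk P 1 y := rfl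

theorem inl_mul (a b : A) : inl P (a * b) = inl P a * inl P b := by
  rw [inl_apply, inl_apply, inl_apply, mk_mul_mk, braid_one_left, lr_tmul, mul_one]
  rfl

theorem inr_mul (y z : H) : inr P (y * z) = inr P y * inr P z := by
  rw [inr_apply, inr_apply, inr_apply, mk_mul_mk, braid_one_right, lr_tmul, mul_one]
  rfl

theorem inl_mul_inr (a : A) (y : H) : inl P a * inr P y = mk P a y := by
  rw [inl_apply, inr_apply, mk_mul_mk, braid_one_left, lr_tmul, mul_one, one_mul]
  rfl

theorem inl_algebraMap (r : K) : inl P (algebraMap K A r) = algebraMap K _ r := by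
  rw [Algebra.algebraMap_eq_smul_one, map_smul, Algebra.algebraMap_eq_smul_one]
  rfl

theorem inr_algebraMap (r : K) : inr P (algebraMap K H r) = algebraMap K _ r := by
  rw [Algebra.algebraMap_eq_smul_one, map_smul, Algebra.algebraMap_eq_smul_one]
  rfl

/-- The antipode `S(a ⋈ y) = (1 ⋈ S(y)) (S(a) ⋈ 1) = S(y₂) ▷ S(a₂) ⋈ S(y₁) ◁ S(a₁)`. -/
noncomputable def antipodeLin : P.BicrossedProduct →ₗ[K] P.BicrossedProduct :=
  TensorProduct.lift
    ((LinearMap.mul K P.BicrossedProduct).compl₁₂ (inr P ∘ₗ HopfAlgebra.antipode K)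
      (inl P ∘ₗ HopfAlgebra.antipode K)).flip ∘ₗ (Carrier.linearEquiv _).toLinearMap

theorem antipodeLin_mk (a : A) (y : H) : antipodeLin P (mk P a y) =
    inr P (HopfAlgebra.antipode K y) * inl P (HopfAlgebra.antipode K a) := rfl

theorem antipode_aux1 (u : A ⊗[K] A) (y z : H) :
    LinearMap.mul' K _ ((antipodeLin P).rTensor _ (shuffle P (u ⊗ₜ (y ⊗ₜ z)))) =
      inr P (HopfAlgebra.antipode K y) *
        inl P (LinearMap.mul' K A ((HopfAlgebra.antipode K).rTensor A u)) * inr P z := by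
  induction u with
  | zero => rw [TensorProduct.zero_tmul]; simp only [map_zero, mul_zero, zero_mul]
  | add s t hs ht =>
    rw [TensorProduct.add_tmul]; simp only [LinearMap.map_add, LinearEquiv.map_add, mul_add, add_mul, hs, ht]
  | tmul a b =>
    rw [shuffle_tmul, LinearMap.rTensor_tmul, LinearMap.mul'_apply, antipodeLin_mk,
      LinearMap.rTensor_tmul, LinearMap.mul'_apply, inl_mul, ← inl_mul_inr]
    simp only [mul_assoc]

theorem antipode_aux2 (a b : A) (v : H ⊗[K] H) :
    LinearMap.mul' K _ ((antipodeLin P).lTensor _ (shuffle P ((a ⊗ₜ b) ⊗ₜ v))) =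
      inl P a * inr P (LinearMap.mul' K H ((HopfAlgebra.antipode K).lTensor H v)) *
        inl P (HopfAlgebra.antipode K b) := by
  induction v with
  | zero => rw [TensorProduct.tmul_zero]; simp only [map_zero, mul_zero, zero_mul]
  | add s t hs ht =>
    rw [TensorProduct.tmul_add]; simp only [LinearMap.map_add, LinearEquiv.map_add, mul_add, add_mul, hs, ht]
  | tmul y z =>
    rw [shuffle_tmul, LinearMap.lTensor_tmul, LinearMap.mul'_apply, antipodeLin_mk,
      LinearMap.lTensor_tmul, LinearMap.mul'_apply, inr_mul, ← inl_mul_inr]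
    simp only [mul_assoc]

theorem antipode_mk_left (a : A) (y : H) :
    LinearMap.mul' K _ ((antipodeLin P).rTensor _ (comul (mk P a y))) =
      algebraMap K _ (counit (mk P a y)) := by
  have key : ∀ v : H ⊗[K] H,
      LinearMap.mul' K _ ((antipodeLin P).rTensor _ (shuffle P (comul a ⊗ₜ v))) =
      counit (R := K) a • inr P (LinearMap.mul' K H ((HopfAlgebra.antipode K).rTensor H v)) := by
    intro v
    induction v with
    | zero => rw [TensorProduct.tmul_zero]; simp only [map_zero, smul_zero]
    | add s t hs ht =>
      rw [TensorProduct.tmul_add]; simp only [LinearMap.map_add, LinearEquiv.map_add, smul_add, hs, ht]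
    | tmul y z =>
      rw [antipode_aux1, HopfAlgebra.mul_antipode_rTensor_comul_apply, inl_algebraMap,
        LinearMap.rTensor_tmul, LinearMap.mul'_apply, inr_mul, ← Algebra.commutes, mul_assoc,
        Algebra.smul_def]
  rw [comul_mk, key, HopfAlgebra.mul_antipode_rTensor_comul_apply, inr_algebraMap, counit_mk,
    Algebra.smul_def, mul_comm, map_mul]

theorem antipode_mk_right (a : A) (y : H) :
    LinearMap.mul' K _ ((antipodeLin P).lTensor _ (comul (mk P a y))) =
      algebraMap K _ (counit (mk P a y)) := by
  have key : ∀ u : A ⊗[K] A,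
      LinearMap.mul' K _ ((antipodeLin P).lTensor _ (shuffle P (u ⊗ₜ comul y))) =
      counit (R := K) y • inl P (LinearMap.mul' K A ((HopfAlgebra.antipode K).lTensor A u)) := by
    intro u
    induction u with
    | zero => rw [TensorProduct.zero_tmul]; simp only [map_zero, smul_zero]
    | add s t hs ht =>
      rw [TensorProduct.add_tmul]; simp only [LinearMap.map_add, LinearEquiv.map_add, smul_add, hs, ht]
    | tmul y z =>
      rw [antipode_aux2, HopfAlgebra.mul_antipode_lTensor_comul_apply, inr_algebraMap,
        LinearMap.lTensor_tmul, LinearMap.mul'_apply, inl_mul, ← Algebra.commutes, mul_assoc,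
        Algebra.smul_def]
  rw [comul_mk, key, HopfAlgebra.mul_antipode_lTensor_comul_apply, inl_algebraMap, counit_mk,
    Algebra.smul_def, map_mul]

theorem ext_mk {W : Type*} [AddCommGroup W] [Module K W] {f g : P.BicrossedProduct →ₗ[K] W}
    (h : ∀ (a : A) (y : H), f (mk P a y) = g (mk P a y)) : f = g := by
  have h1 : f ∘ₗ (Carrier.linearEquiv P.bialgebraData).symm.toLinearMap =
      g ∘ₗ (Carrier.linearEquiv P.bialgebraData).symm.toLinearMap :=
    TensorProduct.ext' h
  ext s
  exact LinearMap.congr_fun h1 s.val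

noncomputable instance : HopfAlgebra K P.BicrossedProduct where
  antipode := antipodeLin P
  mul_antipode_rTensor_comul := ext_mk P (antipode_mk_left P)
  mul_antipode_lTensor_comul := ext_mk P (antipode_mk_right P)

end BicrossedProduct

end MatchedPair

namespace QBinomial

variable {K : Type*} [Field K]

/-- The Gaussian binomial coefficients. -/
def coeff (q : K) : ℕ → ℕ → K
  | _, 0 => 1
  | 0, _ + 1 => 0
  | n + 1, j + 1 => coeff q n j + q ^ (j + 1) * coeff q n (j + 1)

theorem coeff_zero_right (q : K) (n : ℕ) : coeff q n 0 = 1 := by cases n <;> rfl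

theorem coeff_succ_succ (q : K) (n j : ℕ) :
    coeff q (n + 1) (j + 1) = coeff q n j + q ^ (j + 1) * coeff q n (j + 1) := rfl

theorem coeff_eq_zero (q : K) (n j : ℕ) (h : n < j) : coeff q n j = 0 := by
  induction n generalizing j with
  | zero => cases j with
    | zero => omega
    | succ j => rfl
  | succ n ih => cases j with
    | zero => omega
    | succ j => rw [coeff_succ_succ, ih _ (by omega), ih _ (by omega)]; simp

theorem absorb (q : K) (n j : ℕ) :
    (q ^ (j + 1) - 1) * coeff q (n + 1) (j + 1) = (q ^ (n + 1) - 1) * coeff q n j := by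
  induction n generalizing j with
  | zero => cases j with
    | zero => simp [coeff]
    | succ j => simp [coeff]
  | succ n ih =>
    rw [coeff_succ_succ q (n + 1) j, mul_add, mul_left_comm, ih]
    cases j with
    | zero => simp only [coeff_zero_right]; ring
    | succ j =>
      have h := ih j
      rw [coeff_succ_succ q n j] at h ⊢
      linear_combination q * h

theorem coeff_eq_zero_of_primitive {q : K} {m : ℕ} (hq : IsPrimitiveRoot q m) {j : ℕ}
    (h0 : 0 < j) (hj : j < m) : coeff q m j = 0 := by
  obtain ⟨j, rfl⟩ := Nat.exists_eq_succ_of_ne_zero h0.ne'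
  obtain ⟨m, rfl⟩ := Nat.exists_eq_succ_of_ne_zero (by omega : m ≠ 0)
  have h := absorb q m j
  rw [show q ^ (m + 1) = 1 from hq.pow_eq_one, sub_self, zero_mul] at h
  refine (mul_eq_zero.mp h).resolve_left ?_
  refine sub_ne_zero.mpr ?_
  exact hq.pow_ne_one_of_pos_of_lt (by omega) hj

theorem mul_pow_comm {B : Type*} [Ring B] [Algebra K B] {q : K} {a b : B}
    (h : b * a = q • (a * b)) (j : ℕ) : b * a ^ j = q ^ j • (a ^ j * b) := by
  induction j with
  | zero => simp
  | succ j ih =>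
    rw [pow_succ, ← mul_assoc, ih, smul_mul_assoc, mul_assoc, h, mul_smul_comm, smul_smul,
      mul_assoc, pow_succ]

theorem add_pow {B : Type*} [Ring B] [Algebra K B] {q : K} {a b : B}
    (h : b * a = q • (a * b)) (n : ℕ) :
    (a + b) ^ n = ∑ j ∈ Finset.range (n + 1), coeff q n j • (a ^ j * b ^ (n - j)) := by
  induction n with
  | zero => simp [coeff]
  | succ n ih =>
    rw [pow_succ', ih, add_mul, Finset.mul_sum, Finset.mul_sum]
    rw [Finset.sum_range_succ' _ (n + 1)]
    simp only [coeff_succ_succ, add_smul, Finset.sum_add_distrib]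
    rw [add_assoc]
    congr 1
    · refine Finset.sum_congr rfl fun j _ => ?_
      rw [mul_smul_comm, ← mul_assoc, ← pow_succ', Nat.add_sub_add_right]
    · rw [Finset.sum_range_succ' _ n, Finset.sum_range_succ _ n,
        coeff_eq_zero q n (n + 1) (by omega)]
      simp only [mul_zero, zero_smul, add_zero, coeff_zero_right, pow_zero, one_mul, one_smul,
        Nat.sub_zero, pow_succ']
      congr 1
      refine Finset.sum_congr rfl fun j hj => ?_
      have hj' : j < n := Finset.mem_range.mp hj
      rw [mul_smul_comm, ← pow_succ', ← mul_assoc, mul_pow_comm h, smul_mul_assoc, smul_smul,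
        mul_comm (coeff q n (j + 1)), mul_assoc (a ^ (j + 1)), ← pow_succ' b,
        show n - (j + 1) + 1 = n + 1 - (j + 1) by omega, ← pow_succ' q]

theorem add_pow_eq_zero {B : Type*} [Ring B] [Algebra K B] {q : K} {m : ℕ} (hm : m ≠ 0)
    (hq : IsPrimitiveRoot q m) {a b : B}
    (h : b * a = q • (a * b)) (ha : a ^ m = 0) (hb : b ^ m = 0) : (a + b) ^ m = 0 := by
  rw [add_pow h]
  refine Finset.sum_eq_zero fun j hj => ?_
  rw [Finset.mem_range] at hj
  rcases Nat.eq_zero_or_pos j with rfl | h0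
  · simp [hb]
  · rcases Nat.lt_or_ge j m with h1 | h1
    · rw [coeff_eq_zero_of_primitive hq h0 h1, zero_smul]
    · obtain rfl : j = m := by omega
      simp [ha]

theorem mul_pow_eq_zero {B : Type*} [Ring B] [Algebra K B] {q : K} {m : ℕ} {a b : B}
    (h : b * a = q • (a * b)) (ha : a ^ m = 0) : (a * b) ^ m = 0 := by
  have key : ∀ j : ℕ, ∃ r : K, (a * b) ^ j = r • (a ^ j * b ^ j) := by
    intro j
    induction j with
    | zero => exact ⟨1, by simp⟩
    | succ j ih =>
      obtain ⟨r, hr⟩ := ih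
      refine ⟨r * q ^ j, ?_⟩
      rw [pow_succ', hr, mul_smul_comm, mul_assoc, ← mul_assoc b, mul_pow_comm h, smul_mul_assoc,
        mul_smul_comm, smul_smul, mul_assoc, ← pow_succ', ← mul_assoc, ← pow_succ']
  obtain ⟨r, hr⟩ := key m
  rw [hr, ha, zero_mul, smul_zero]

end QBinomial

namespace PresentationAux

theorem inv_mul_of_mul {K B : Type*} [Field K] [Ring B] [Algebra K B] {h h' x : B} {q : K}
    (h1 : h * h' = 1) (h2 : h' * h = 1) (h3 : x * h = q • (h * x)) :
    h' * x = q • (x * h') := by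
  calc h' * x = h' * (x * h) * h' := by rw [mul_assoc, mul_assoc, h1, mul_one]
    _ = q • (x * h') := by
      rw [h3, mul_smul_comm, ← mul_assoc, h2, one_mul, smul_mul_assoc]

theorem inv_mul_inv {B : Type*} [Ring B] {c c' d d' e e' : B} (h1 : c * c' = 1)
    (h2 : c' * c = 1) (h3 : d * d' = 1) (h4 : e' * e = 1) (h5 : c * d = e * c) :
    d' * c' = c' * e' := by
  calc d' * c' = c' * (e' * e) * c * d' * c' := by rw [h4, mul_one, h2, one_mul]
    _ = c' * e' * (c * d) * d' * c' := by rw [h5]; simp only [mul_assoc]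
    _ = c' * e' * c * (d * d') * c' := by simp only [mul_assoc]
    _ = c' * e' := by rw [h3, mul_one, mul_assoc, h1, mul_one]

theorem neg_mul_inv {K B : Type*} [Field K] [Ring B] [Algebra K B] {c c' h' x : B} {b : K}
    (h1 : c * c' = 1) (h2 : c' * c = 1) (h3 : c' * h' = h' * c')
    (h4 : c * x = b • (x * c)) :
    -(x * h') * c' = b • (c' * -(x * h')) := by
  have h5 : x * c' = b • (c' * x) := by
    calc x * c' = c' * (c * x) * c' := by rw [← mul_assoc, h2, one_mul]
      _ = b • (c' * x) := by
        rw [h4, mul_smul_comm, smul_mul_assoc, mul_assoc, mul_assoc, h1, mul_one]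
  rw [neg_mul, mul_assoc, ← h3, ← mul_assoc, h5, smul_mul_assoc, mul_neg, smul_neg, mul_assoc]

/-- If an algebra antihomomorphism of a bialgebra satisfies the antipode identities on a set of
algebra generators, then it satisfies them everywhere. -/
theorem antipode_axioms_of_adjoin {K B : Type*} [Field K] [Ring B] [Bialgebra K B]
    (S : B →ₐ[K] Bᵐᵒᵖ) (G : Set B) (hG : Algebra.adjoin K G = ⊤)
    (SL : B →ₗ[K] B) (hSL : ∀ b, SL b = (S b).unop)
    (h1 : ∀ g ∈ G, LinearMap.mul' K B (SL.rTensor B (Coalgebra.comul g)) =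
      algebraMap K B (Coalgebra.counit g))
    (h2 : ∀ g ∈ G, LinearMap.mul' K B (SL.lTensor B (Coalgebra.comul g)) =
      algebraMap K B (Coalgebra.counit g)) :
    (LinearMap.mul' K B ∘ₗ SL.rTensor B ∘ₗ Coalgebra.comul =
      Algebra.linearMap K B ∘ₗ Coalgebra.counit) ∧
    (LinearMap.mul' K B ∘ₗ SL.lTensor B ∘ₗ Coalgebra.comul =
      Algebra.linearMap K B ∘ₗ Coalgebra.counit) := by
  have hS1 : SL 1 = 1 := by simp [hSL]
  have hSm : ∀ a b, SL (a * b) = SL b * SL a := fun a b => by simp [hSL]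
  have e1 : ∀ (s t : B ⊗[K] B) (r : K),
      LinearMap.mul' K B (SL.rTensor B s) = algebraMap K B r →
      LinearMap.mul' K B (SL.rTensor B (s * t)) =
        algebraMap K B r * LinearMap.mul' K B (SL.rTensor B t) := by
    intro s t r hr
    have : ∀ c d : B, LinearMap.mul' K B (SL.rTensor B (s * (c ⊗ₜ d))) =
        SL c * LinearMap.mul' K B (SL.rTensor B s) * d := by
      intro c d
      clear hr
      induction s with
      | zero => simp
      | add s t hs ht => simp only [add_mul, map_add, hs, ht, mul_add]
      | tmul a b => simp [hSm, mul_assoc]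
    induction t with
    | zero => simp
    | add s t hs ht => simp only [mul_add, map_add, hs, ht]
    | tmul a b =>
      rw [this, hr, ← Algebra.commutes]
      simp [mul_assoc]
  have e2 : ∀ (s t : B ⊗[K] B) (r : K),
      LinearMap.mul' K B (SL.lTensor B t) = algebraMap K B r →
      LinearMap.mul' K B (SL.lTensor B (s * t)) =
        algebraMap K B r * LinearMap.mul' K B (SL.lTensor B s) := by
    intro s t r hr
    have : ∀ c d : B, LinearMap.mul' K B (SL.lTensor B ((c ⊗ₜ d) * t)) =
        c * LinearMap.mul' K B (SL.lTensor B t) * SL d := by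
      intro c d
      clear hr
      induction t with
      | zero => simp
      | add s t hs ht => simp only [add_mul, map_add, hs, ht, mul_add]
      | tmul a b => simp [hSm, mul_assoc]
    induction s with
    | zero => simp
    | add s t hs ht => simp only [add_mul, mul_add, map_add, hs, ht]
    | tmul a b =>
      rw [this, hr, ← Algebra.commutes]
      simp [mul_assoc]
  constructor
  · ext b
    have hb : b ∈ Algebra.adjoin K G := hG ▸ Algebra.mem_top
    simp only [LinearMap.comp_apply, Algebra.linearMap_apply]
    induction hb using Algebra.adjoin_induction with
    | mem x hx => exact h1 x hx
    | algebraMap r => simp [Algebra.algebraMap_eq_smul_one, Algebra.TensorProduct.one_def, hS1]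
    | add x y _ _ hx hy => simp only [map_add, hx, hy]
    | mul x y _ _ hx hy =>
      rw [Bialgebra.comul_mul, e1 _ _ _ hx, hy, Bialgebra.counit_mul, map_mul]
  · ext b
    have hb : b ∈ Algebra.adjoin K G := hG ▸ Algebra.mem_top
    simp only [LinearMap.comp_apply, Algebra.linearMap_apply]
    induction hb using Algebra.adjoin_induction with
    | mem x hx => exact h2 x hx
    | algebraMap r => simp [Algebra.algebraMap_eq_smul_one, Algebra.TensorProduct.one_def, hS1]
    | add x y _ _ hx hy => simp only [map_add, hx, hy]
    | mul x y _ _ hx hy =>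
      rw [Bialgebra.comul_mul, e2 _ _ _ hy, hx, Bialgebra.counit_mul, map_mul]
      exact Algebra.commutes _ _

end PresentationAux

/-- Generators of the Taft algebra. -/
inductive TaftGen
  | h
  | x

/-- Defining relations of the Taft algebra: `h ^ m = 1`, `x ^ m = 0`, `x h = q h x`. -/
inductive TaftRel (K : Type*) [Field K] (m : ℕ) (q : K) :
    FreeAlgebra K TaftGen → FreeAlgebra K TaftGen → Prop
  | h_pow : TaftRel K m q (FreeAlgebra.ι K TaftGen.h ^ m) 1
  | x_pow : TaftRel K m q (FreeAlgebra.ι K TaftGen.x ^ m) 0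
  | x_mul_h : TaftRel K m q (FreeAlgebra.ι K TaftGen.x * FreeAlgebra.ι K TaftGen.h)
      (q • (FreeAlgebra.ι K TaftGen.h * FreeAlgebra.ι K TaftGen.x))

/-- The Taft algebra `T_{m²}(q)`, as an algebra presented by generators and relations. -/
def Taft {K : Type u} [Field K] {m : ℕ} {q : K} (_hm : 2 ≤ m) (_hq : IsPrimitiveRoot q m) :
    Type u :=
  RingQuot (TaftRel K m q)

namespace Taft

variable {K : Type u} [Field K] {m : ℕ} {q : K} (hm : 2 ≤ m) (hq : IsPrimitiveRoot q m)

instance : Ring (Taft hm hq) := inferInstanceAs (Ring (RingQuot (TaftRel K m q)))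

instance : Algebra K (Taft hm hq) := inferInstanceAs (Algebra K (RingQuot (TaftRel K m q)))

/-- The quotient map from the free algebra. -/
def proj : FreeAlgebra K TaftGen →ₐ[K] Taft hm hq := RingQuot.mkAlgHom K (TaftRel K m q)

/-- The generator `h`. -/
def h : Taft hm hq := proj hm hq (FreeAlgebra.ι K TaftGen.h)

/-- The generator `x`. -/
def x : Taft hm hq := proj hm hq (FreeAlgebra.ι K TaftGen.x)

theorem h_pow : h hm hq ^ m = 1 := by
  rw [h, ← map_pow]
  exact (RingQuot.mkAlgHom_rel K TaftRel.h_pow).trans (map_one _)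

theorem x_pow : x hm hq ^ m = 0 := by
  rw [x, ← map_pow]
  exact (RingQuot.mkAlgHom_rel K TaftRel.x_pow).trans (map_zero _)

theorem x_mul_h : x hm hq * h hm hq = q • (h hm hq * x hm hq) := by
  rw [x, h, ← map_mul, ← map_mul, ← map_smul]
  exact RingQuot.mkAlgHom_rel K TaftRel.x_mul_h

variable {hm hq}

/-- Two algebra maps which agree on the generators are equal. -/
theorem algHom_ext {B : Type*} [Semiring B] [Algebra K B] {f g : Taft hm hq →ₐ[K] B}
    (h1 : f (h hm hq) = g (h hm hq)) (h2 : f (x hm hq) = g (x hm hq)) : f = g := by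
  refine RingQuot.ringQuot_ext' K f g (FreeAlgebra.hom_ext ?_)
  funext i
  cases i
  · exact h1
  · exact h2

variable (hm hq) in
theorem adjoin_eq_top : Algebra.adjoin K {h hm hq, x hm hq} = ⊤ := by
  have h1 : (proj hm hq).range = ⊤ := AlgHom.range_eq_top _ |>.mpr
    (RingQuot.mkAlgHom_surjective K (TaftRel K m q))
  rw [← h1, ← Algebra.map_top, ← FreeAlgebra.adjoin_range_ι, AlgHom.map_adjoin]
  congr 1
  ext b
  constructor
  · rintro (rfl | rfl)
    · exact ⟨_, ⟨TaftGen.h, rfl⟩, rfl⟩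
    · exact ⟨_, ⟨TaftGen.x, rfl⟩, rfl⟩
  · rintro ⟨_, ⟨i, rfl⟩, rfl⟩
    cases i
    · exact Or.inl rfl
    · exact Or.inr rfl

/-- The universal property of the presentation. -/
def lift {B : Type*} [Semiring B] [Algebra K B] (h' x' : B) (h1 : h' ^ m = 1) (h2 : x' ^ m = 0)
    (h3 : x' * h' = q • (h' * x')) : Taft hm hq →ₐ[K] B :=
  RingQuot.liftAlgHom K ⟨FreeAlgebra.lift K fun | TaftGen.h => h' | TaftGen.x => x', by
    intro a b r
    cases r <;> simp [h1, h2, h3]⟩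

section

variable {B : Type*} [Semiring B] [Algebra K B] {h' x' : B} (h1 : h' ^ m = 1) (h2 : x' ^ m = 0)
  (h3 : x' * h' = q • (h' * x'))

@[simp] theorem lift_h : lift (hm := hm) (hq := hq) h' x' h1 h2 h3 (h hm hq) = h' :=
  (RingQuot.liftAlgHom_mkAlgHom_apply _ _ _ _).trans (by simp)

@[simp] theorem lift_x : lift (hm := hm) (hq := hq) h' x' h1 h2 h3 (x hm hq) = x' :=
  (RingQuot.liftAlgHom_mkAlgHom_apply _ _ _ _).trans (by simp)

end

variable (hm hq)

/-- `Δ(h) = h ⊗ h` and `Δ(x) = x ⊗ h + 1 ⊗ x`. -/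
noncomputable def comulHom : Taft hm hq →ₐ[K] Taft hm hq ⊗[K] Taft hm hq :=
  lift (h hm hq ⊗ₜ h hm hq) (x hm hq ⊗ₜ h hm hq + 1 ⊗ₜ x hm hq)
    (by rw [Algebra.TensorProduct.tmul_pow, h_pow]; rfl)
    (QBinomial.add_pow_eq_zero (by omega) hq
      (by simp [x_mul_h])
      (by rw [Algebra.TensorProduct.tmul_pow, x_pow, TensorProduct.zero_tmul])
      (by rw [Algebra.TensorProduct.tmul_pow, x_pow, TensorProduct.tmul_zero]))
    (by simp [x_mul_h, add_mul, mul_add, TensorProduct.smul_tmul'])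

/-- `ε(h) = 1` and `ε(x) = 0`. -/
noncomputable def counitHom : Taft hm hq →ₐ[K] K :=
  lift 1 0 (one_pow m) (zero_pow (by omega)) (by simp)

noncomputable instance : Bialgebra K (Taft hm hq) :=
  Bialgebra.ofAlgHom (comulHom hm hq) (counitHom hm hq)
    (algHom_ext (by simp [comulHom]) (by
      simp [comulHom, TensorProduct.add_tmul, TensorProduct.tmul_add, add_assoc,
        Algebra.TensorProduct.one_def]))
    (algHom_ext (by simp [comulHom, counitHom]) (by simp [comulHom, counitHom]))
    (algHom_ext (by simp [comulHom, counitHom]) (by simp [comulHom, counitHom]))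

theorem comul_h : Coalgebra.comul (R := K) (h hm hq) = h hm hq ⊗ₜ h hm hq := lift_h _ _ _

theorem comul_x : Coalgebra.comul (R := K) (x hm hq) = x hm hq ⊗ₜ h hm hq + 1 ⊗ₜ x hm hq :=
  lift_x _ _ _

theorem counit_h : Coalgebra.counit (R := K) (h hm hq) = 1 := lift_h _ _ _

theorem counit_x : Coalgebra.counit (R := K) (x hm hq) = 0 := lift_x _ _ _

theorem h_mul_inv : h hm hq * h hm hq ^ (m - 1) = 1 := by
  rw [← pow_succ', show m - 1 + 1 = m by omega, h_pow]

theorem inv_mul_h : h hm hq ^ (m - 1) * h hm hq = 1 := by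
  rw [← pow_succ, show m - 1 + 1 = m by omega, h_pow]

theorem inv_mul_x : h hm hq ^ (m - 1) * x hm hq = q • (x hm hq * h hm hq ^ (m - 1)) :=
  PresentationAux.inv_mul_of_mul (h_mul_inv hm hq) (inv_mul_h hm hq) (x_mul_h hm hq)

/-- The antihomomorphism with `S(h) = h ^ (m - 1)` and `S(x) = - x h ^ (m - 1)`. -/
noncomputable def antipodeHom : Taft hm hq →ₐ[K] (Taft hm hq)ᵐᵒᵖ :=
  lift (MulOpposite.op (h hm hq ^ (m - 1))) (MulOpposite.op (-(x hm hq * h hm hq ^ (m - 1))))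
    (by rw [← MulOpposite.op_pow, ← pow_mul, mul_comm, pow_mul, h_pow, one_pow, MulOpposite.op_one])
    (by rw [← MulOpposite.op_pow, neg_pow,
          QBinomial.mul_pow_eq_zero (inv_mul_x hm hq) (x_pow hm hq), mul_zero, MulOpposite.op_zero])
    (by
      rw [← MulOpposite.op_mul, ← MulOpposite.op_mul, ← MulOpposite.op_smul]
      congr 1
      rw [mul_neg, ← mul_assoc, inv_mul_x, neg_mul, smul_neg, smul_mul_assoc])

/-- The antipode as a linear map. -/
noncomputable def antipodeLin : Taft hm hq →ₗ[K] Taft hm hq :=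
  (MulOpposite.opLinearEquiv K).symm.toLinearMap ∘ₗ (antipodeHom hm hq).toLinearMap

theorem antipodeLin_h : antipodeLin hm hq (h hm hq) = h hm hq ^ (m - 1) := by
  simp [antipodeLin, antipodeHom]

theorem antipodeLin_x : antipodeLin hm hq (x hm hq) = -(x hm hq * h hm hq ^ (m - 1)) := by
  simp [antipodeLin, antipodeHom]

theorem antipodeLin_one : antipodeLin hm hq 1 = 1 := by
  simp [antipodeLin]

theorem antipode_axioms :
    (LinearMap.mul' K _ ∘ₗ (antipodeLin hm hq).rTensor _ ∘ₗ Coalgebra.comul =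
      Algebra.linearMap K _ ∘ₗ Coalgebra.counit) ∧
    (LinearMap.mul' K _ ∘ₗ (antipodeLin hm hq).lTensor _ ∘ₗ Coalgebra.comul =
      Algebra.linearMap K _ ∘ₗ Coalgebra.counit) :=
  PresentationAux.antipode_axioms_of_adjoin (antipodeHom hm hq) _ (adjoin_eq_top hm hq)
    (antipodeLin hm hq) (fun _ => rfl)
    (by
      rintro g (rfl | rfl)
      · simp [comul_h, counit_h, antipodeLin_h, inv_mul_h]
      · simp [comul_x, counit_x, antipodeLin_x, antipodeLin_one, mul_assoc, inv_mul_h])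
    (by
      rintro g (rfl | rfl)
      · simp [comul_h, counit_h, antipodeLin_h, h_mul_inv]
      · simp [comul_x, counit_x, antipodeLin_h, antipodeLin_x])

noncomputable instance : HopfAlgebra K (Taft hm hq) where
  antipode := antipodeLin hm hq
  mul_antipode_rTensor_comul := (antipode_axioms hm hq).1
  mul_antipode_lTensor_comul := (antipode_axioms hm hq).2

end Taft

/-- Generators of the split metacyclic group. -/
inductive MetacyclicGen
  | c
  | d

/-- The relators of `⟨c, d | c ^ l = 1, d ^ n = 1, c d = d ^ k c⟩`. -/
inductive MetacyclicRel (k l n : ℕ) : FreeGroup MetacyclicGen → Prop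
  | c_pow : MetacyclicRel k l n (FreeGroup.of MetacyclicGen.c ^ l)
  | d_pow : MetacyclicRel k l n (FreeGroup.of MetacyclicGen.d ^ n)
  | c_mul_d : MetacyclicRel k l n
      ((FreeGroup.of MetacyclicGen.c * FreeGroup.of MetacyclicGen.d) *
        (FreeGroup.of MetacyclicGen.d ^ k * FreeGroup.of MetacyclicGen.c)⁻¹)

/-- The split metacyclic group `D_{ln}^k = ⟨c, d | c ^ l = 1, d ^ n = 1, c d = d ^ k c⟩`. -/
abbrev Metacyclic (k l n : ℕ) : Type := PresentedGroup {r | MetacyclicRel k l n r}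

namespace Metacyclic

/-- The generator `c`. -/
def c (k l n : ℕ) : Metacyclic k l n := PresentedGroup.of MetacyclicGen.c

/-- The generator `d`. -/
def d (k l n : ℕ) : Metacyclic k l n := PresentedGroup.of MetacyclicGen.d

end Metacyclic

/-- Generators of the algebra `T_{lnm²}^{β,σ}(q)`. -/
inductive TaftMetacyclicGen
  | c
  | d
  | h
  | x

/-- Defining relations of the algebra `T_{lnm²}^{β,σ}(q)`. -/
inductive TaftMetacyclicRel (K : Type*) [Field K] (m : ℕ) (q : K) (k l n : ℕ) (β σ : K) :
    FreeAlgebra K TaftMetacyclicGen → FreeAlgebra K TaftMetacyclicGen → Prop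
  | c_pow : TaftMetacyclicRel K m q k l n β σ (FreeAlgebra.ι K .c ^ l) 1
  | d_pow : TaftMetacyclicRel K m q k l n β σ (FreeAlgebra.ι K .d ^ n) 1
  | h_pow : TaftMetacyclicRel K m q k l n β σ (FreeAlgebra.ι K .h ^ m) 1
  | x_pow : TaftMetacyclicRel K m q k l n β σ (FreeAlgebra.ι K .x ^ m) 0
  | c_mul_h : TaftMetacyclicRel K m q k l n β σ (FreeAlgebra.ι K .c * FreeAlgebra.ι K .h)
      (FreeAlgebra.ι K .h * FreeAlgebra.ι K .c)
  | d_mul_h : TaftMetacyclicRel K m q k l n β σ (FreeAlgebra.ι K .d * FreeAlgebra.ι K .h)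
      (FreeAlgebra.ι K .h * FreeAlgebra.ι K .d)
  | c_mul_d : TaftMetacyclicRel K m q k l n β σ (FreeAlgebra.ι K .c * FreeAlgebra.ι K .d)
      (FreeAlgebra.ι K .d ^ k * FreeAlgebra.ι K .c)
  | c_mul_x : TaftMetacyclicRel K m q k l n β σ (FreeAlgebra.ι K .c * FreeAlgebra.ι K .x)
      (β • (FreeAlgebra.ι K .x * FreeAlgebra.ι K .c))
  | d_mul_x : TaftMetacyclicRel K m q k l n β σ (FreeAlgebra.ι K .d * FreeAlgebra.ι K .x)
      (σ • (FreeAlgebra.ι K .x * FreeAlgebra.ι K .d))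
  | x_mul_h : TaftMetacyclicRel K m q k l n β σ (FreeAlgebra.ι K .x * FreeAlgebra.ι K .h)
      (q • (FreeAlgebra.ι K .h * FreeAlgebra.ι K .x))

/-- The algebra `T_{lnm²}^{β,σ}(q)`, presented by the generators `c, d, h, x` and the relations
`c ^ l = d ^ n = h ^ m = 1`, `x ^ m = 0`, `c h = h c`, `d h = h d`, `c d = d ^ k c`, `c x = β x c`,
`d x = σ x d`, `x h = q h x`. -/
def TaftMetacyclic {K : Type u} [Field K] {m : ℕ} {q : K} (_hm : 2 ≤ m)
    (_hq : IsPrimitiveRoot q m) {k l n : ℕ} (_hl : 1 ≤ l) (_hn : 1 ≤ n) (β σ : K) : Type u :=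
  RingQuot (TaftMetacyclicRel K m q k l n β σ)

namespace TaftMetacyclic

variable {K : Type u} [Field K] {m : ℕ} {q : K} (hm : 2 ≤ m) (hq : IsPrimitiveRoot q m)
  {k l n : ℕ} (hl : 1 ≤ l) (hn : 1 ≤ n) (β σ : K)

local notation "T" => TaftMetacyclic hm hq (k := k) hl hn β σ

instance : Ring T := inferInstanceAs (Ring (RingQuot (TaftMetacyclicRel K m q k l n β σ)))

instance : Algebra K T :=
  inferInstanceAs (Algebra K (RingQuot (TaftMetacyclicRel K m q k l n β σ)))

/-- The quotient map from the free algebra. -/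
def proj : FreeAlgebra K TaftMetacyclicGen →ₐ[K] T :=
  RingQuot.mkAlgHom K (TaftMetacyclicRel K m q k l n β σ)

/-- The generator `c`. -/
def c : T := proj hm hq hl hn β σ (FreeAlgebra.ι K .c)

/-- The generator `d`. -/
def d : T := proj hm hq hl hn β σ (FreeAlgebra.ι K .d)

/-- The generator `h`. -/
def h : T := proj hm hq hl hn β σ (FreeAlgebra.ι K .h)

/-- The generator `x`. -/
def x : T := proj hm hq hl hn β σ (FreeAlgebra.ι K .x)

local notation "cc" => c hm hq (k := k) hl hn β σ
local notation "dd" => d hm hq (k := k) hl hn β σ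
local notation "hh" => h hm hq (k := k) hl hn β σ
local notation "xx" => x hm hq (k := k) hl hn β σ

theorem c_pow : cc ^ l = 1 := by
  rw [c, ← map_pow]
  exact (RingQuot.mkAlgHom_rel K TaftMetacyclicRel.c_pow).trans (map_one _)

theorem d_pow : dd ^ n = 1 := by
  rw [d, ← map_pow]
  exact (RingQuot.mkAlgHom_rel K TaftMetacyclicRel.d_pow).trans (map_one _)

theorem h_pow : hh ^ m = 1 := by
  rw [h, ← map_pow]
  exact (RingQuot.mkAlgHom_rel K TaftMetacyclicRel.h_pow).trans (map_one _)

theorem x_pow : xx ^ m = 0 := by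
  rw [x, ← map_pow]
  exact (RingQuot.mkAlgHom_rel K TaftMetacyclicRel.x_pow).trans (map_zero _)

theorem c_mul_h : cc * hh = hh * cc := by
  rw [c, h, ← map_mul, ← map_mul]
  exact RingQuot.mkAlgHom_rel K TaftMetacyclicRel.c_mul_h

theorem d_mul_h : dd * hh = hh * dd := by
  rw [d, h, ← map_mul, ← map_mul]
  exact RingQuot.mkAlgHom_rel K TaftMetacyclicRel.d_mul_h

theorem c_mul_d : cc * dd = dd ^ k * cc := by
  rw [c, d, ← map_pow, ← map_mul, ← map_mul]
  exact RingQuot.mkAlgHom_rel K TaftMetacyclicRel.c_mul_d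

theorem c_mul_x : cc * xx = β • (xx * cc) := by
  rw [c, x, ← map_mul, ← map_mul, ← map_smul]
  exact RingQuot.mkAlgHom_rel K TaftMetacyclicRel.c_mul_x

theorem d_mul_x : dd * xx = σ • (xx * dd) := by
  rw [d, x, ← map_mul, ← map_mul, ← map_smul]
  exact RingQuot.mkAlgHom_rel K TaftMetacyclicRel.d_mul_x

theorem x_mul_h : xx * hh = q • (hh * xx) := by
  rw [x, h, ← map_mul, ← map_mul, ← map_smul]
  exact RingQuot.mkAlgHom_rel K TaftMetacyclicRel.x_mul_h

variable {hm hq hl hn β σ}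

/-- Two algebra maps which agree on the generators are equal. -/
theorem algHom_ext {B : Type*} [Semiring B] [Algebra K B] {f g : T →ₐ[K] B}
    (h1 : f cc = g cc) (h2 : f dd = g dd) (h3 : f hh = g hh) (h4 : f xx = g xx) : f = g := by
  refine RingQuot.ringQuot_ext' K f g (FreeAlgebra.hom_ext ?_)
  funext i
  cases i
  · exact h1
  · exact h2
  · exact h3
  · exact h4

variable (hm hq hl hn β σ) in
theorem adjoin_eq_top : Algebra.adjoin K {cc, dd, hh, xx} = ⊤ := by
  have h1 : (proj hm hq (k := k) hl hn β σ).range = ⊤ := AlgHom.range_eq_top _ |>.mpr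
    (RingQuot.mkAlgHom_surjective K (TaftMetacyclicRel K m q k l n β σ))
  rw [← h1, ← Algebra.map_top, ← FreeAlgebra.adjoin_range_ι, AlgHom.map_adjoin]
  congr 1
  ext b
  constructor
  · rintro (rfl | rfl | rfl | rfl)
    · exact ⟨_, ⟨.c, rfl⟩, rfl⟩
    · exact ⟨_, ⟨.d, rfl⟩, rfl⟩
    · exact ⟨_, ⟨.h, rfl⟩, rfl⟩
    · exact ⟨_, ⟨.x, rfl⟩, rfl⟩
  · rintro ⟨_, ⟨i, rfl⟩, rfl⟩
    cases i
    · exact Or.inl rfl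
    · exact Or.inr (Or.inl rfl)
    · exact Or.inr (Or.inr (Or.inl rfl))
    · exact Or.inr (Or.inr (Or.inr rfl))

section

variable {B : Type*} [Semiring B] [Algebra K B] (c' d' h' x' : B)
  (h1 : c' ^ l = 1) (h2 : d' ^ n = 1) (h3 : h' ^ m = 1) (h4 : x' ^ m = 0)
  (h5 : c' * h' = h' * c') (h6 : d' * h' = h' * d') (h7 : c' * d' = d' ^ k * c')
  (h8 : c' * x' = β • (x' * c')) (h9 : d' * x' = σ • (x' * d')) (h10 : x' * h' = q • (h' * x'))

/-- The universal property of the presentation. -/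
def lift : T →ₐ[K] B :=
  RingQuot.liftAlgHom K ⟨FreeAlgebra.lift K fun | .c => c' | .d => d' | .h => h' | .x => x', by
    intro a b r
    cases r <;> simp [h1, h2, h3, h4, h5, h6, h7, h8, h9, h10]⟩

@[simp] theorem lift_c : lift c' d' h' x' h1 h2 h3 h4 h5 h6 h7 h8 h9 h10 cc = c' :=
  (RingQuot.liftAlgHom_mkAlgHom_apply _ _ _ _).trans (by simp)

@[simp] theorem lift_d : lift c' d' h' x' h1 h2 h3 h4 h5 h6 h7 h8 h9 h10 dd = d' :=
  (RingQuot.liftAlgHom_mkAlgHom_apply _ _ _ _).trans (by simp)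

@[simp] theorem lift_h : lift c' d' h' x' h1 h2 h3 h4 h5 h6 h7 h8 h9 h10 hh = h' :=
  (RingQuot.liftAlgHom_mkAlgHom_apply _ _ _ _).trans (by simp)

@[simp] theorem lift_x : lift c' d' h' x' h1 h2 h3 h4 h5 h6 h7 h8 h9 h10 xx = x' :=
  (RingQuot.liftAlgHom_mkAlgHom_apply _ _ _ _).trans (by simp)

end

variable (hm hq hl hn β σ)

/-- `Δ(c) = c ⊗ c`, `Δ(d) = d ⊗ d`, `Δ(h) = h ⊗ h`, `Δ(x) = x ⊗ h + 1 ⊗ x`. -/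
noncomputable def comulHom : T →ₐ[K] T ⊗[K] T :=
  lift (cc ⊗ₜ cc) (dd ⊗ₜ dd) (hh ⊗ₜ hh) (xx ⊗ₜ hh + 1 ⊗ₜ xx)
    (by rw [Algebra.TensorProduct.tmul_pow, c_pow]; rfl)
    (by rw [Algebra.TensorProduct.tmul_pow, d_pow]; rfl)
    (by rw [Algebra.TensorProduct.tmul_pow, h_pow]; rfl)
    (QBinomial.add_pow_eq_zero (by omega) hq
      (by simp [x_mul_h])
      (by rw [Algebra.TensorProduct.tmul_pow, x_pow, TensorProduct.zero_tmul])
      (by rw [Algebra.TensorProduct.tmul_pow, x_pow, TensorProduct.tmul_zero]))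
    (by simp [c_mul_h])
    (by simp [d_mul_h])
    (by simp [c_mul_d])
    (by simp [c_mul_x, c_mul_h, add_mul, mul_add, TensorProduct.smul_tmul'])
    (by simp [d_mul_x, d_mul_h, add_mul, mul_add, TensorProduct.smul_tmul'])
    (by simp [x_mul_h, add_mul, mul_add, TensorProduct.smul_tmul'])

/-- `ε(c) = ε(d) = ε(h) = 1` and `ε(x) = 0`. -/
noncomputable def counitHom : T →ₐ[K] K :=
  lift 1 1 1 0 (one_pow l) (one_pow n) (one_pow m) (zero_pow (by omega)) rfl rfl (by simp)
    (by simp) (by simp) (by simp)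

theorem comulHom_c : comulHom hm hq (k := k) hl hn β σ cc = cc ⊗ₜ cc :=
  (RingQuot.liftAlgHom_mkAlgHom_apply _ _ _ _).trans (by simp)

theorem comulHom_d : comulHom hm hq (k := k) hl hn β σ dd = dd ⊗ₜ dd :=
  (RingQuot.liftAlgHom_mkAlgHom_apply _ _ _ _).trans (by simp)

theorem comulHom_h : comulHom hm hq (k := k) hl hn β σ hh = hh ⊗ₜ hh :=
  (RingQuot.liftAlgHom_mkAlgHom_apply _ _ _ _).trans (by simp)

theorem comulHom_x : comulHom hm hq (k := k) hl hn β σ xx = xx ⊗ₜ hh + 1 ⊗ₜ xx :=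
  (RingQuot.liftAlgHom_mkAlgHom_apply _ _ _ _).trans (by simp)

theorem counitHom_c : counitHom hm hq (k := k) hl hn β σ cc = 1 :=
  (RingQuot.liftAlgHom_mkAlgHom_apply _ _ _ _).trans (by simp)

theorem counitHom_d : counitHom hm hq (k := k) hl hn β σ dd = 1 :=
  (RingQuot.liftAlgHom_mkAlgHom_apply _ _ _ _).trans (by simp)

theorem counitHom_h : counitHom hm hq (k := k) hl hn β σ hh = 1 :=
  (RingQuot.liftAlgHom_mkAlgHom_apply _ _ _ _).trans (by simp)

theorem counitHom_x : counitHom hm hq (k := k) hl hn β σ xx = 0 :=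
  (RingQuot.liftAlgHom_mkAlgHom_apply _ _ _ _).trans (by simp)

noncomputable instance : Bialgebra K T :=
  Bialgebra.ofAlgHom (comulHom hm hq hl hn β σ) (counitHom hm hq hl hn β σ)
    (algHom_ext (by simp [comulHom_c]) (by simp [comulHom_d]) (by simp [comulHom_h]) (by
      simp [comulHom_h, comulHom_x, TensorProduct.add_tmul, TensorProduct.tmul_add, add_assoc,
        Algebra.TensorProduct.one_def]))
    (algHom_ext (by simp [comulHom_c, counitHom_c]) (by simp [comulHom_d, counitHom_d])
      (by simp [comulHom_h, counitHom_h]) (by simp [comulHom_x, counitHom_h, counitHom_x]))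
    (algHom_ext (by simp [comulHom_c, counitHom_c]) (by simp [comulHom_d, counitHom_d])
      (by simp [comulHom_h, counitHom_h]) (by simp [comulHom_x, counitHom_h, counitHom_x]))

theorem comul_c : Coalgebra.comul (R := K) cc = cc ⊗ₜ cc :=
  comulHom_c hm hq hl hn β σ

theorem comul_d : Coalgebra.comul (R := K) dd = dd ⊗ₜ dd :=
  comulHom_d hm hq hl hn β σ

theorem comul_h : Coalgebra.comul (R := K) hh = hh ⊗ₜ hh :=
  comulHom_h hm hq hl hn β σ

theorem comul_x : Coalgebra.comul (R := K) xx = xx ⊗ₜ hh + 1 ⊗ₜ xx :=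
  comulHom_x hm hq hl hn β σ

theorem counit_c : Coalgebra.counit (R := K) cc = 1 :=
  counitHom_c hm hq hl hn β σ

theorem counit_d : Coalgebra.counit (R := K) dd = 1 :=
  counitHom_d hm hq hl hn β σ

theorem counit_h : Coalgebra.counit (R := K) hh = 1 :=
  counitHom_h hm hq hl hn β σ

theorem counit_x : Coalgebra.counit (R := K) xx = 0 :=
  counitHom_x hm hq hl hn β σ

theorem c_mul_inv : cc * cc ^ (l - 1) = 1 := by
  rw [← pow_succ', show l - 1 + 1 = l by omega, c_pow]

theorem inv_mul_c : cc ^ (l - 1) * cc = 1 := by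
  rw [← pow_succ, show l - 1 + 1 = l by omega, c_pow]

theorem d_mul_inv : dd * dd ^ (n - 1) = 1 := by
  rw [← pow_succ', show n - 1 + 1 = n by omega, d_pow]

theorem inv_mul_d : dd ^ (n - 1) * dd = 1 := by
  rw [← pow_succ, show n - 1 + 1 = n by omega, d_pow]

theorem h_mul_inv : hh * hh ^ (m - 1) = 1 := by
  rw [← pow_succ', show m - 1 + 1 = m by omega, h_pow]

theorem inv_mul_h : hh ^ (m - 1) * hh = 1 := by
  rw [← pow_succ, show m - 1 + 1 = m by omega, h_pow]

theorem inv_mul_x : hh ^ (m - 1) * xx = q • (xx * hh ^ (m - 1)) :=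
  PresentationAux.inv_mul_of_mul (h_mul_inv hm hq hl hn β σ) (inv_mul_h hm hq hl hn β σ)
    (x_mul_h hm hq hl hn β σ)

/-- The antihomomorphism with `S(c) = c ^ (l - 1)`, `S(d) = d ^ (n - 1)`, `S(h) = h ^ (m - 1)`
and `S(x) = - x h ^ (m - 1)`. -/
noncomputable def antipodeHom : T →ₐ[K] (T)ᵐᵒᵖ :=
  lift (MulOpposite.op (cc ^ (l - 1))) (MulOpposite.op (dd ^ (n - 1)))
    (MulOpposite.op (hh ^ (m - 1))) (MulOpposite.op (-(xx * hh ^ (m - 1))))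
    (by rw [← MulOpposite.op_pow, ← pow_mul, mul_comm, pow_mul, c_pow, one_pow, MulOpposite.op_one])
    (by rw [← MulOpposite.op_pow, ← pow_mul, mul_comm, pow_mul, d_pow, one_pow, MulOpposite.op_one])
    (by rw [← MulOpposite.op_pow, ← pow_mul, mul_comm, pow_mul, h_pow, one_pow, MulOpposite.op_one])
    (by rw [← MulOpposite.op_pow, neg_pow, QBinomial.mul_pow_eq_zero (inv_mul_x hm hq hl hn β σ)
          (x_pow hm hq hl hn β σ), mul_zero, MulOpposite.op_zero])
    (by
      rw [← MulOpposite.op_mul, ← MulOpposite.op_mul]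
      exact congrArg _ ((show Commute cc hh from c_mul_h hm hq hl hn β σ).pow_pow _ _).eq.symm)
    (by
      rw [← MulOpposite.op_mul, ← MulOpposite.op_mul]
      exact congrArg _ ((show Commute dd hh from d_mul_h hm hq hl hn β σ).pow_pow _ _).eq.symm)
    (by
      rw [← MulOpposite.op_pow, ← MulOpposite.op_mul, ← MulOpposite.op_mul]
      refine congrArg _ (PresentationAux.inv_mul_inv (c_mul_inv hm hq hl hn β σ)
        (inv_mul_c hm hq hl hn β σ) (d_mul_inv hm hq hl hn β σ) ?_ (c_mul_d hm hq hl hn β σ))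
      rw [← (Commute.refl dd).pow_right (n - 1) |>.symm.mul_pow, inv_mul_d, one_pow])
    (by
      rw [← MulOpposite.op_mul, ← MulOpposite.op_mul, ← MulOpposite.op_smul]
      refine congrArg _ (PresentationAux.neg_mul_inv (c_mul_inv hm hq hl hn β σ)
        (inv_mul_c hm hq hl hn β σ)
        ((show Commute cc hh from c_mul_h hm hq hl hn β σ).pow_pow _ _).eq
        (c_mul_x hm hq hl hn β σ)))
    (by
      rw [← MulOpposite.op_mul, ← MulOpposite.op_mul, ← MulOpposite.op_smul]
      refine congrArg _ (PresentationAux.neg_mul_inv (d_mul_inv hm hq hl hn β σ)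
        (inv_mul_d hm hq hl hn β σ)
        ((show Commute dd hh from d_mul_h hm hq hl hn β σ).pow_pow _ _).eq
        (d_mul_x hm hq hl hn β σ)))
    (by
      rw [← MulOpposite.op_mul, ← MulOpposite.op_mul, ← MulOpposite.op_smul]
      congr 1
      rw [mul_neg, ← mul_assoc, inv_mul_x, neg_mul, smul_neg, smul_mul_assoc])

/-- The antipode as a linear map. -/
noncomputable def antipodeLin : T →ₗ[K] T :=
  (MulOpposite.opLinearEquiv K).symm.toLinearMap ∘ₗ (antipodeHom hm hq hl hn β σ).toLinearMap

local notation "SS" => antipodeLin hm hq (k := k) hl hn β σ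

theorem antipodeLin_c : SS cc = cc ^ (l - 1) := by
  simp [antipodeLin, antipodeHom]

theorem antipodeLin_d : SS dd = dd ^ (n - 1) := by
  simp [antipodeLin, antipodeHom]

theorem antipodeLin_h : SS hh = hh ^ (m - 1) := by
  simp [antipodeLin, antipodeHom]

theorem antipodeLin_x : SS xx = -(xx * hh ^ (m - 1)) := by
  simp [antipodeLin, antipodeHom]

theorem antipodeLin_one : SS 1 = 1 := by
  simp [antipodeLin]

theorem antipode_axioms :
    (LinearMap.mul' K _ ∘ₗ (SS).rTensor _ ∘ₗ Coalgebra.comul =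
      Algebra.linearMap K _ ∘ₗ Coalgebra.counit) ∧
    (LinearMap.mul' K _ ∘ₗ (SS).lTensor _ ∘ₗ Coalgebra.comul =
      Algebra.linearMap K _ ∘ₗ Coalgebra.counit) :=
  PresentationAux.antipode_axioms_of_adjoin (antipodeHom hm hq hl hn β σ) _
    (adjoin_eq_top hm hq hl hn β σ) SS (fun _ => rfl)
    (by
      rintro g (rfl | rfl | rfl | rfl)
      · simp [comul_c, counit_c, antipodeLin_c, inv_mul_c]
      · simp [comul_d, counit_d, antipodeLin_d, inv_mul_d]
      · simp [comul_h, counit_h, antipodeLin_h, inv_mul_h]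
      · simp [comul_x, counit_x, antipodeLin_x, antipodeLin_one, mul_assoc, inv_mul_h])
    (by
      rintro g (rfl | rfl | rfl | rfl)
      · simp [comul_c, counit_c, antipodeLin_c, c_mul_inv]
      · simp [comul_d, counit_d, antipodeLin_d, d_mul_inv]
      · simp [comul_h, counit_h, antipodeLin_h, h_mul_inv]
      · simp [comul_x, counit_x, antipodeLin_h, antipodeLin_x])

noncomputable instance : HopfAlgebra K T where
  antipode := SS
  mul_antipode_rTensor_comul := (antipode_axioms hm hq hl hn β σ).1
  mul_antipode_lTensor_comul := (antipode_axioms hm hq hl hn β σ).2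

/-- `S(c) = c ^ (l - 1)`. -/
theorem antipode_c : HopfAlgebra.antipode K cc = cc ^ (l - 1) :=
  antipodeLin_c hm hq hl hn β σ

/-- `S(d) = d ^ (n - 1)`. -/
theorem antipode_d : HopfAlgebra.antipode K dd = dd ^ (n - 1) :=
  antipodeLin_d hm hq hl hn β σ

/-- `S(h) = h ^ (m - 1)`. -/
theorem antipode_h : HopfAlgebra.antipode K hh = hh ^ (m - 1) :=
  antipodeLin_h hm hq hl hn β σ

/-- `S(x) = - x h ^ (m - 1)`. -/
theorem antipode_x : HopfAlgebra.antipode K xx = -(xx * hh ^ (m - 1)) :=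
  antipodeLin_x hm hq hl hn β σ

end TaftMetacyclic

/-!
A character `γ` of a group `G` acts on the Taft algebra by the Hopf algebra maps `h ↦ h`,
`x ↦ γ(g) x`; together with the trivial right action this is a matched pair (`MatchedPair.ofChar`).
Conversely every matched pair of the Taft algebra with `K[G]` is of this form
(`MatchedPair.ofChar_toChar`), and the characters of the split metacyclic group are given by their
values on `c` and `d` (`Metacyclic.charEquiv`).

For the converse let `g ∈ G`. Since `g` is group-like and invertible, `a ↦ g ▷ a` is a coalgebra
automorphism. It preserves the span of the group-like elements, so `g ▷ x`, like `x`, lies outside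
this span. The compatibility condition of a matched pair at `g` and `x` reads
`(g ◁ x) ⊗ (g ▷ h - 1) = (g ◁ h - g) ⊗ (g ▷ x)`. If `g ◁ h ≠ g`, a linear form on the left factor
would express `g ▷ x` through group-like elements; hence `g ◁ h = g`, and then `g ◁ x = 0` because
`g ▷ h ≠ 1`. So the right action is trivial (`MatchedPair.rightAct_eq`) and `g` acts on the Taft
algebra by algebra maps. Now `g ▷ h = h ^ i` for some `i`, and `g ▷ x` is skew-primitive for the
pair `1, h ^ i`. Such an element outside the span of the group-likes exists only for `h ^ i = h`,
and is then `γ x + δ (h - 1)` (`Taft.skew_classification`); the relation `x h = q h x` forces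
`δ = 0` (`MatchedPair.leftAct_h_and_x`).

The classification of group-like and skew-primitive elements is a computation with the coefficients
of the elements `h ^ a x ^ j`. These are linear forms on the Taft algebra, obtained from an explicit
regular representation (`Taft.coord`), and `Taft.coord_comul` expresses the comultiplication in them
through Gaussian binomial coefficients.

Finally, the presentation of `T^{β,σ}` gives a map to the bicrossed product. It is bijective because
it is left inverse to `a ⋈ y ↦ a y`, which is onto: products `a y` span the presented algebra.
-/

/-! ### Coordinates on the Taft algebra -/

namespace Taft

variable {K : Type u} [Field K] {m : ℕ} {q : K} (hm : 2 ≤ m) (hq : IsPrimitiveRoot q m)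

/-- The action of `h` in the regular representation, where a family `f a j` stands for
`∑ f a j • h ^ a x ^ j`: translation of the first index. -/
def regH (K : Type u) [Field K] (m : ℕ) : Module.End K (ZMod m → ℕ → K) where
  toFun f a j := f (a - 1) j
  map_add' _ _ := rfl
  map_smul' _ _ := rfl

/-- The function `a ↦ q ^ a` is well defined on `ZMod m`. -/
theorem exists_char {m : ℕ} (hm : 2 ≤ m) {q : K} (hq : IsPrimitiveRoot q m) :
    ∃ χ : ZMod m → K, χ 0 = 1 ∧ ∀ a, χ a = q * χ (a - 1) := by
  have : NeZero m := ⟨by omega⟩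
  refine ⟨AddChar.zmodChar m hq.pow_eq_one, AddChar.map_zero_eq_one _, fun a => ?_⟩
  have h1 : AddChar.zmodChar m hq.pow_eq_one 1 = q := by
    have : Fact (1 < m) := ⟨by omega⟩
    rw [AddChar.zmodChar_apply, ZMod.val_one, pow_one]
  calc AddChar.zmodChar m hq.pow_eq_one a
      = AddChar.zmodChar m hq.pow_eq_one (1 + (a - 1)) := by rw [add_sub_cancel]
    _ = q * AddChar.zmodChar m hq.pow_eq_one (a - 1) := by rw [AddChar.map_add_eq_mul, h1]

/-- The character `a ↦ q ^ a` of `ZMod m`. -/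
noncomputable def char : ZMod m → K := (exists_char hm hq).choose

theorem char_zero : char hm hq 0 = 1 := (exists_char hm hq).choose_spec.1

theorem char_eq (a : ZMod m) : char hm hq a = q * char hm hq (a - 1) :=
  (exists_char hm hq).choose_spec.2 a

/-- The action of `x` in the regular representation: `x h ^ a x ^ j = q ^ a h ^ a x ^ (j + 1)`,
truncated in degrees `≥ m`. -/
noncomputable def regX : Module.End K (ZMod m → ℕ → K) where
  toFun f a j := if 0 < j ∧ j < m then char hm hq a * f a (j - 1) else 0
  map_add' f g := by
    funext a j
    simp only [Pi.add_apply]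
    split_ifs <;> ring
  map_smul' r f := by
    funext a j
    simp only [Pi.smul_apply, smul_eq_mul, RingHom.id_apply]
    split_ifs <;> ring

theorem regH_pow_apply (b : ℕ) (f : ZMod m → ℕ → K) (a : ZMod m) (j : ℕ) :
    (regH K m ^ b) f a j = f (a - b) j := by
  induction b generalizing f a with
  | zero => simp
  | succ b ih =>
    rw [pow_succ', Module.End.mul_apply]
    change (regH K m ^ b) f (a - 1) j = _
    rw [ih]
    push_cast
    congr 1
    ring

theorem regX_pow_apply_of_lt (r : ℕ) (f : ZMod m → ℕ → K) (a : ZMod m) (j : ℕ) (h : j < r) :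
    (regX hm hq ^ r) f a j = 0 := by
  induction r generalizing a j with
  | zero => omega
  | succ r ih =>
    rw [pow_succ', Module.End.mul_apply]
    change (if 0 < j ∧ j < m then char hm hq a * (regX hm hq ^ r) f a (j - 1) else 0) = 0
    split_ifs with h1
    · rw [ih _ _ (by omega), mul_zero]
    · rfl

/-- The regular representation of the Taft algebra, in the coordinates given by the elements
`h ^ a x ^ j`. -/
noncomputable def regRep : Taft hm hq →ₐ[K] Module.End K (ZMod m → ℕ → K) :=
  lift (regH K m) (regX hm hq)
    (by
      refine LinearMap.ext fun f => funext fun a => funext fun j => ?_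
      rw [regH_pow_apply]
      simp)
    (by
      refine LinearMap.ext fun f => funext fun a => funext fun j => ?_
      rcases lt_or_ge j m with h | h
      · exact regX_pow_apply_of_lt hm hq m f a j h
      · obtain ⟨r, rfl⟩ := Nat.exists_eq_succ_of_ne_zero (show m ≠ 0 by omega)
        rw [pow_succ', Module.End.mul_apply]
        exact if_neg (by omega))
    (by
      refine LinearMap.ext fun f => funext fun a => funext fun j => ?_
      change (if 0 < j ∧ j < m then char hm hq a * f (a - 1) (j - 1) else 0) =
        q * (if 0 < j ∧ j < m then char hm hq (a - 1) * f (a - 1) (j - 1) else 0)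
      rw [char_eq hm hq a]
      split_ifs <;> ring)

/-- The coordinates of `1 = h ^ 0 x ^ 0`. -/
def unitVec (K : Type u) [Field K] (m : ℕ) : ZMod m → ℕ → K :=
  fun a j => if a = 0 ∧ j = 0 then 1 else 0

/-- The coefficient of `h ^ a x ^ j`. It vanishes for `m ≤ j`. -/
noncomputable def coord (a : ZMod m) (j : ℕ) : Taft hm hq →ₗ[K] K :=
  LinearMap.proj j ∘ₗ LinearMap.proj a ∘ₗ LinearMap.applyₗ (unitVec K m) ∘ₗ
    (regRep hm hq).toLinearMap

theorem regX_pow_unitVec {j : ℕ} (hj : j < m) :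
    (regX hm hq ^ j) (unitVec K m) = fun a i => if a = 0 ∧ i = j then 1 else 0 := by
  induction j with
  | zero => rfl
  | succ j ih =>
    rw [pow_succ', Module.End.mul_apply, ih (by omega)]
    funext a i
    change (if 0 < i ∧ i < m then char hm hq a * (if a = 0 ∧ i - 1 = j then 1 else 0) else 0) = _
    by_cases h : a = 0 ∧ i = j + 1
    · obtain ⟨rfl, rfl⟩ := h
      simp [char_zero, hj]
    · rw [if_neg h]
      split_ifs with h1 h2
      · exact absurd ⟨h2.1, by omega⟩ h
      · ring
      · rfl

theorem coord_h_pow_mul_x_pow (a : ZMod m) (i b : ℕ) {j : ℕ} (hj : j < m) :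
    coord hm hq a i (h hm hq ^ b * x hm hq ^ j) = if a = b ∧ i = j then 1 else 0 := by
  change regRep hm hq (h hm hq ^ b * x hm hq ^ j) (unitVec K m) a i = _
  rw [map_mul, map_pow, map_pow, regRep, lift_h, lift_x, Module.End.mul_apply, regH_pow_apply,
    regX_pow_unitVec hm hq hj]
  simp only [sub_eq_zero]

theorem x_mul_h_pow (b : ℕ) :
    x hm hq * h hm hq ^ b = q ^ b • (h hm hq ^ b * x hm hq) :=
  QBinomial.mul_pow_comm (x_mul_h hm hq) b

/-- The elements `h ^ b x ^ j` span the Taft algebra: their span is stable under left multiplication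
by `h` and `x`. -/
theorem span_eq_top : Submodule.span K
    {z | ∃ b j : ℕ, j < m ∧ z = h hm hq ^ b * x hm hq ^ j} = ⊤ := by
  set S := Submodule.span K {z | ∃ b j : ℕ, j < m ∧ z = h hm hq ^ b * x hm hq ^ j} with hS
  have hmem : ∀ b j : ℕ, h hm hq ^ b * x hm hq ^ j ∈ S := fun b j => by
    rcases lt_or_ge j m with hj | hj
    · exact Submodule.subset_span ⟨b, j, hj, rfl⟩
    · rw [pow_eq_zero_of_le hj (x_pow hm hq), mul_zero]
      exact S.zero_mem
  have key : ∀ z : Taft hm hq, ∀ s ∈ S, z * s ∈ S := by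
    intro z
    have hz : z ∈ Algebra.adjoin K {h hm hq, x hm hq} := adjoin_eq_top hm hq ▸ Algebra.mem_top
    induction hz using Algebra.adjoin_induction with
    | mem g hg =>
      intro s hs
      induction hs using Submodule.span_induction with
      | mem s hs =>
        obtain ⟨b, j, hj, rfl⟩ := hs
        rcases hg with rfl | rfl
        · rw [← mul_assoc, ← pow_succ']
          exact hmem _ _
        · rw [← mul_assoc, x_mul_h_pow, smul_mul_assoc, mul_assoc, ← pow_succ']
          exact S.smul_mem _ (hmem _ _)
      | zero => rw [mul_zero]; exact S.zero_mem
      | add s t _ _ hs ht => rw [mul_add]; exact S.add_mem hs ht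
      | smul r s _ hs => rw [mul_smul_comm]; exact S.smul_mem _ hs
    | algebraMap r =>
      intro s hs
      rw [← Algebra.smul_def]
      exact S.smul_mem _ hs
    | add y z _ _ hy hz => intro s hs; rw [add_mul]; exact S.add_mem (hy s hs) (hz s hs)
    | mul y z _ _ hy hz => intro s hs; rw [mul_assoc]; exact hy _ (hz s hs)
  refine eq_top_iff.mpr fun z _ => ?_
  have := key z _ (hmem 0 0)
  rwa [pow_zero, pow_zero, mul_one, mul_one] at this

variable {hm hq} in
theorem linearMap_ext {W : Type*} [AddCommGroup W] [Module K W] {f g : Taft hm hq →ₗ[K] W}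
    (hfg : ∀ b j : ℕ, j < m → f (h hm hq ^ b * x hm hq ^ j) = g (h hm hq ^ b * x hm hq ^ j)) :
    f = g := by
  refine LinearMap.ext_on (span_eq_top hm hq) ?_
  rintro _ ⟨b, j, hj, rfl⟩
  exact hfg b j hj

theorem h_pow_mod (b : ℕ) : h hm hq ^ (b % m) = h hm hq ^ b := by
  conv_rhs => rw [← Nat.mod_add_div b m, pow_add, pow_mul, h_pow, one_pow, mul_one]

theorem h_pow_val (b : ℕ) : h hm hq ^ (b : ZMod m).val = h hm hq ^ b := by
  rw [ZMod.val_natCast, h_pow_mod]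

theorem sum_coord [NeZero m] (z : Taft hm hq) :
    z = ∑ a : ZMod m, ∑ j ∈ Finset.range m,
      coord hm hq a j z • (h hm hq ^ a.val * x hm hq ^ j) := by
  have key : LinearMap.id = ∑ a : ZMod m, ∑ j ∈ Finset.range m,
      (coord hm hq a j).smulRight (h hm hq ^ a.val * x hm hq ^ j) := by
    refine linearMap_ext fun b j hj => ?_
    simp only [LinearMap.sum_apply, LinearMap.smulRight_apply, LinearMap.id_apply]
    rw [Finset.sum_eq_single (b : ZMod m), Finset.sum_eq_single j]
    · rw [coord_h_pow_mul_x_pow hm hq _ _ _ hj, if_pos ⟨rfl, rfl⟩, one_smul, h_pow_val]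
    · intro i _ hi
      rw [coord_h_pow_mul_x_pow hm hq _ _ _ hj, if_neg (by tauto), zero_smul]
    · intro h
      exact absurd (Finset.mem_range.mpr hj) h
    · intro a _ ha
      refine Finset.sum_eq_zero fun i _ => ?_
      rw [coord_h_pow_mul_x_pow hm hq _ _ _ hj, if_neg (by tauto), zero_smul]
    · intro h
      exact absurd (Finset.mem_univ _) h
  simpa using LinearMap.congr_fun key z

variable {hm hq} in
theorem coord_ext {y z : Taft hm hq}
    (hyz : ∀ a j, j < m → coord hm hq a j y = coord hm hq a j z) : y = z := by
  have : NeZero m := ⟨by omega⟩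
  rw [sum_coord hm hq y, sum_coord hm hq z]
  exact Finset.sum_congr rfl fun a _ => Finset.sum_congr rfl fun j hj => by
    rw [hyz a j (Finset.mem_range.mp hj)]

theorem comul_h_pow_mul_x_pow (b j : ℕ) :
    Coalgebra.comul (R := K) (h hm hq ^ b * x hm hq ^ j) = ∑ t ∈ Finset.range (j + 1),
      QBinomial.coeff q j t •
        ((h hm hq ^ b * x hm hq ^ t) ⊗ₜ[K] (h hm hq ^ (b + t) * x hm hq ^ (j - t))) := by
  rw [Bialgebra.comul_mul, Bialgebra.comul_pow, Bialgebra.comul_pow, comul_h, comul_x,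
    QBinomial.add_pow (q := q) (by simp [x_mul_h]), Finset.mul_sum]
  refine Finset.sum_congr rfl fun t _ => ?_
  rw [mul_smul_comm]
  simp only [Algebra.TensorProduct.tmul_pow, Algebra.TensorProduct.tmul_mul_tmul, one_pow, mul_one,
    pow_add, mul_assoc]

/-- The comultiplication in coordinates: the coefficient of
`h ^ a x ^ r ⊗ h ^ b x ^ s` in `Δ(z)` is a multiple of the coefficient of `h ^ a x ^ (r + s)`
in `z` if `b = a + r`, and zero otherwise. -/
theorem coord_comul (a b : ZMod m) {r s : ℕ} (z : Taft hm hq) :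
    LinearMap.mul' K K (TensorProduct.map (coord hm hq a r) (coord hm hq b s)
      (Coalgebra.comul z)) =
      if b = a + r then QBinomial.coeff q (r + s) r * coord hm hq a (r + s) z else 0 := by
  have key : LinearMap.mul' K K ∘ₗ TensorProduct.map (coord hm hq a r) (coord hm hq b s) ∘ₗ
      Coalgebra.comul =
      if b = a + r then QBinomial.coeff q (r + s) r • coord hm hq a (r + s) else 0 := by
    refine linearMap_ext fun i j hj => ?_
    simp only [LinearMap.comp_apply, comul_h_pow_mul_x_pow, map_sum, map_smul,
      TensorProduct.map_tmul, LinearMap.mul'_apply]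
    have h1 : ∀ t ∈ Finset.range (j + 1), QBinomial.coeff q j t •
        (coord hm hq a r (h hm hq ^ i * x hm hq ^ t) *
          coord hm hq b s (h hm hq ^ (i + t) * x hm hq ^ (j - t))) =
        if t = r then (if b = a + r ∧ a = i ∧ r + s = j then QBinomial.coeff q (r + s) r else 0)
          else 0 := by
      intro t ht
      rw [Finset.mem_range] at ht
      rw [coord_h_pow_mul_x_pow hm hq _ _ _ (by omega),
        coord_h_pow_mul_x_pow hm hq _ _ _ (by omega)]
      by_cases htr : t = r
      · subst htr
        rw [if_pos rfl]
        by_cases hc : b = a + t ∧ a = i ∧ t + s = j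
        · obtain ⟨rfl, rfl, rfl⟩ := hc
          simp
        · rw [if_neg hc]
          by_cases ha : a = i ∧ t = t
          · rw [if_neg (c := b = _ ∧ _), mul_zero, smul_zero]
            rintro ⟨hb, hs⟩
            refine hc ⟨?_, ha.1, by omega⟩
            rw [hb, ha.1]
            push_cast
            rfl
          · rw [if_neg ha, zero_mul, smul_zero]
      · rw [if_neg htr, if_neg (fun hh => htr hh.2.symm), zero_mul, smul_zero]
    rw [Finset.sum_congr rfl h1, Finset.sum_ite_eq']
    by_cases hb : b = a + r
    · rw [if_pos hb, LinearMap.smul_apply, coord_h_pow_mul_x_pow hm hq _ _ _ hj]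
      by_cases hc : a = i ∧ r + s = j
      · rw [if_pos (by rw [Finset.mem_range]; omega), if_pos ⟨hb, hc⟩, if_pos hc, smul_eq_mul,
          mul_one]
      · rw [if_neg (c := a = i ∧ _) hc, if_neg (c := b = _ ∧ _) (fun hh => hc hh.2), ite_self,
          smul_zero]
    · rw [if_neg hb, if_neg (c := b = _ ∧ _) (fun hh => hb hh.1), ite_self, LinearMap.zero_apply]
  have := LinearMap.congr_fun key z
  rw [LinearMap.comp_apply, LinearMap.comp_apply] at this
  rw [this]
  split_ifs <;> rfl

theorem coord_eq_zero_of_le (a : ZMod m) {j : ℕ} (hj : m ≤ j) (z : Taft hm hq) :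
    coord hm hq a j z = 0 := by
  have key : coord hm hq a j = 0 := linearMap_ext fun b i hi => by
    rw [coord_h_pow_mul_x_pow hm hq _ _ _ hi, if_neg (by omega), LinearMap.zero_apply]
  rw [key, LinearMap.zero_apply]

theorem coord_one (a : ZMod m) (j : ℕ) :
    coord hm hq a j 1 = if a = 0 ∧ j = 0 then 1 else 0 := by
  simpa using coord_h_pow_mul_x_pow hm hq a j 0 (j := 0) (by omega)

theorem coord_h_pow (a : ZMod m) (j b : ℕ) :
    coord hm hq a j (h hm hq ^ b) = if a = b ∧ j = 0 then 1 else 0 := by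
  simpa using coord_h_pow_mul_x_pow hm hq a j b (j := 0) (by omega)

theorem coord_x (a : ZMod m) (j : ℕ) :
    coord hm hq a j (x hm hq) = if a = 0 ∧ j = 1 then 1 else 0 := by
  simpa using coord_h_pow_mul_x_pow hm hq a j 0 (j := 1) (by omega)

end Taft

/-! ### Group-like and skew-primitive elements of the Taft algebra -/

namespace Taft

variable {K : Type u} [Field K] {m : ℕ} {q : K} {hm : 2 ≤ m} {hq : IsPrimitiveRoot q m}

theorem isGroupLikeElem_h : IsGroupLikeElem K (h hm hq) := ⟨counit_h hm hq, comul_h hm hq⟩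

theorem isGroupLikeElem_h_pow (i : ℕ) : IsGroupLikeElem K (h hm hq ^ i) :=
  ⟨by rw [Bialgebra.counit_pow, counit_h, one_pow], by
    rw [Bialgebra.comul_pow, comul_h, Algebra.TensorProduct.tmul_pow]⟩

/-- Group-like elements lie in degree `0` of the grading by the exponent of `x`. -/
theorem coord_eq_zero_of_isGroupLikeElem {u : Taft hm hq} (hu : IsGroupLikeElem K u)
    (a : ZMod m) {r : ℕ} (hr : 0 < r) : coord hm hq a r u = 0 := by
  -- If the coefficient in degree `r` is nonzero, so is the one in degree `2 r`.
  have key : ∀ t r : ℕ, 0 < r → m ≤ r + t → coord hm hq a r u = 0 := by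
    intro t
    induction t with
    | zero => exact fun r _ h => coord_eq_zero_of_le hm hq a h u
    | succ t ih =>
      intro r hr h
      have h1 := coord_comul hm hq a a (r := r) (s := r) u
      rw [hu.comul_eq_tmul_self, TensorProduct.map_tmul, LinearMap.mul'_apply,
        ih (r + r) (by omega) (by omega), mul_zero, ite_self] at h1
      exact mul_self_eq_zero.mp h1
  exact key m r hr (by omega)

theorem coord_eq_zero_of_mem_span {z : Taft hm hq}
    (hz : z ∈ Submodule.span K {u : Taft hm hq | IsGroupLikeElem K u})
    (a : ZMod m) {r : ℕ} (hr : 0 < r) : coord hm hq a r z = 0 := by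
  induction hz using Submodule.span_induction with
  | mem u hu => exact coord_eq_zero_of_isGroupLikeElem hu a hr
  | zero => exact map_zero _
  | add s t _ _ hs ht => rw [map_add, hs, ht, add_zero]
  | smul r s _ hs => rw [map_smul, hs, smul_zero]

theorem mem_span_of_coord_eq_zero {z : Taft hm hq}
    (hz : ∀ (a : ZMod m) (r : ℕ), 0 < r → coord hm hq a r z = 0) :
    z ∈ Submodule.span K {u : Taft hm hq | IsGroupLikeElem K u} := by
  have : NeZero m := ⟨by omega⟩
  rw [sum_coord hm hq z]
  refine Submodule.sum_mem _ fun a _ => Submodule.sum_mem _ fun j _ => ?_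
  rcases Nat.eq_zero_or_pos j with rfl | hj
  · rw [pow_zero, mul_one]
    exact Submodule.smul_mem _ _ (Submodule.subset_span (isGroupLikeElem_h_pow _))
  · rw [hz a j hj, zero_smul]
    exact Submodule.zero_mem _

/-- The element `x` is no combination of group-like elements. -/
theorem x_notMem_span :
    x hm hq ∉ Submodule.span K {u : Taft hm hq | IsGroupLikeElem K u} := fun hx => by
  have h1 := coord_eq_zero_of_mem_span hx 0 one_pos
  rw [coord_x, if_pos ⟨rfl, rfl⟩] at h1
  exact one_ne_zero h1

/-- The group-like elements of the Taft algebra are the powers of `h`. -/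
theorem exists_eq_h_pow {u : Taft hm hq} (hu : IsGroupLikeElem K u) : ∃ i : ℕ, u = h hm hq ^ i := by
  have : NeZero m := ⟨by omega⟩
  have h1 : ∀ a b : ZMod m, coord hm hq a 0 u * coord hm hq b 0 u =
      if b = a then coord hm hq a 0 u else 0 := by
    intro a b
    have h1 := coord_comul hm hq a b (r := 0) (s := 0) u
    rw [hu.comul_eq_tmul_self, TensorProduct.map_tmul, LinearMap.mul'_apply] at h1
    simpa [QBinomial.coeff_zero_right] using h1
  obtain ⟨a, ha⟩ : ∃ a : ZMod m, coord hm hq a 0 u ≠ 0 := by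
    by_contra! hc
    have h0 : u = 0 := coord_ext fun a j _ => by
      rcases Nat.eq_zero_or_pos j with rfl | hj
      · rw [hc, map_zero]
      · rw [coord_eq_zero_of_isGroupLikeElem hu a hj, map_zero]
    have h2 := hu.counit_eq_one
    rw [h0, map_zero] at h2
    exact zero_ne_one h2
  refine ⟨a.val, coord_ext fun b j _ => ?_⟩
  rw [coord_h_pow, ZMod.natCast_zmod_val]
  rcases Nat.eq_zero_or_pos j with rfl | hj
  · by_cases hb : b = a
    · subst hb
      rw [if_pos ⟨rfl, rfl⟩]
      have h2 := h1 b b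
      rw [if_pos rfl] at h2
      exact mul_left_cancel₀ ha (h2.trans (mul_one _).symm)
    · rw [if_neg (by tauto)]
      have h2 := h1 a b
      rw [if_neg hb] at h2
      exact (mul_eq_zero.mp h2).resolve_left ha
  · rw [coord_eq_zero_of_isGroupLikeElem hu b hj, if_neg (by omega)]

/-- The Gaussian integer `(q ^ r - 1) / (q - 1)` is nonzero for `0 < r < m`. -/
theorem coeff_one_ne_zero (hq : IsPrimitiveRoot q m) {r : ℕ} (h1 : 0 < r) (h2 : r < m) :
    QBinomial.coeff q r 1 ≠ 0 := by
  obtain ⟨r, rfl⟩ := Nat.exists_eq_succ_of_ne_zero h1.ne'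
  intro h0
  have h := QBinomial.absorb q r 0
  rw [h0, mul_zero, QBinomial.coeff_zero_right, mul_one] at h
  exact hq.pow_ne_one_of_pos_of_lt (by omega) h2 (sub_eq_zero.mp h.symm)

theorem natCast_one_ne_zero (hm : 2 ≤ m) : (1 : ZMod m) ≠ 0 := by
  have : Fact (1 < m) := ⟨by omega⟩
  exact one_ne_zero

section

variable {w : Taft hm hq} {i : ℕ}
  (hw : Coalgebra.comul (R := K) w = w ⊗ₜ (h hm hq ^ i) + 1 ⊗ₜ w)
include hw

/-- The equation `Δ(w) = w ⊗ h ^ i + 1 ⊗ w` in coordinates. -/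
theorem coord_of_skew (a b : ZMod m) (r s : ℕ) :
    coord hm hq a r w * (if b = i ∧ s = 0 then 1 else 0) +
      (if a = 0 ∧ r = 0 then 1 else 0) * coord hm hq b s w =
    if b = a + r then QBinomial.coeff q (r + s) r * coord hm hq a (r + s) w else 0 := by
  rw [← coord_comul, hw, map_add, map_add, TensorProduct.map_tmul, TensorProduct.map_tmul,
    LinearMap.mul'_apply, LinearMap.mul'_apply, coord_h_pow, coord_one]

/-- A skew-primitive element has no coefficient of positive degree but that of `x`: the coefficient
of `h ^ a x ^ r` with `a ≠ 0` is excluded by the component `h ^ a ⊗ h ^ a x ^ r` of `Δ(w)`, the one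
of `x ^ r` with `r ≥ 2` by the component `x ⊗ h x ^ (r - 1)`. -/
theorem coord_skew_eq_zero_of_ne (a : ZMod m) {r : ℕ} (hr : 0 < r) (hne : r ≠ 1 ∨ a ≠ 0) :
    coord hm hq a r w = 0 := by
  rcases le_or_gt m r with hr' | hr'
  · exact coord_eq_zero_of_le hm hq a hr' w
  by_cases ha : a = 0
  · subst ha
    have hr1 : r ≠ 1 := hne.resolve_right (fun hh => hh rfl)
    have h1 := coord_of_skew hw 0 1 1 (r - 1)
    rw [if_neg (by omega), if_neg (by omega), if_pos (by simp), mul_zero, zero_mul, add_zero,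
      show 1 + (r - 1) = r by omega] at h1
    exact (mul_eq_zero.mp h1.symm).resolve_left (coeff_one_ne_zero hq hr hr')
  · have h1 := coord_of_skew hw a a 0 r
    rw [if_neg (by omega), if_neg (by tauto), if_pos (by simp), mul_zero, zero_mul, add_zero,
      QBinomial.coeff_zero_right, one_mul, zero_add] at h1
    exact h1.symm

theorem natCast_eq_one_of_skew (hc : coord hm hq 0 1 w ≠ 0) : (i : ZMod m) = 1 := by
  by_contra hi
  have h1 := coord_of_skew hw 0 1 1 0
  rw [if_neg (by tauto), if_neg (by omega), if_pos (by simp), mul_zero, zero_mul, add_zero,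
    add_zero] at h1
  exact (mul_ne_zero (coeff_one_ne_zero hq one_pos (by omega)) hc) h1.symm

/-- A skew-primitive element which is no combination of group-like elements exists only for the
group-like `h`, where it is a combination of `x` and `h - 1`. -/
theorem skew_classification
    (hs : w ∉ Submodule.span K {u : Taft hm hq | IsGroupLikeElem K u}) :
    h hm hq ^ i = h hm hq ∧
      ∃ r : K, w = coord hm hq 0 1 w • x hm hq + r • (h hm hq - 1) := by
  have hc : coord hm hq 0 1 w ≠ 0 := fun hc => hs <| mem_span_of_coord_eq_zero fun a r hr => by
    by_cases h1 : r ≠ 1 ∨ a ≠ 0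
    · exact coord_skew_eq_zero_of_ne hw a hr h1
    · push Not at h1
      rw [h1.1, h1.2, hc]
  have hi : (i : ZMod m) = ((1 : ℕ) : ZMod m) := by
    rw [natCast_eq_one_of_skew hw hc, Nat.cast_one]
  refine ⟨by rw [← h_pow_val hm hq i, hi, h_pow_val, pow_one], coord hm hq 1 0 w, ?_⟩
  have hn := natCast_one_ne_zero hm
  have h0 : ∀ a b : ZMod m, coord hm hq a 0 w * (if b = 1 then 1 else 0) +
      (if a = 0 then 1 else 0) * coord hm hq b 0 w = if b = a then coord hm hq a 0 w else 0 := by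
    intro a b
    simpa [hi, QBinomial.coeff_zero_right] using coord_of_skew hw a b 0 0
  refine coord_ext fun a j _ => ?_
  have hh := coord_h_pow hm hq a j 1
  rw [pow_one] at hh
  rw [map_add, map_smul, map_smul, map_sub, coord_x, hh, coord_one, Nat.cast_one]
  simp only [smul_eq_mul]
  rcases Nat.eq_zero_or_pos j with rfl | hj
  · by_cases ha : a = 0
    · subst ha
      have h1 := h0 0 1
      rw [if_pos rfl, if_pos rfl, if_neg hn] at h1
      rw [if_neg (by omega), if_neg (fun hh => hn hh.1.symm), if_pos ⟨rfl, rfl⟩]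
      linear_combination h1
    · have h1 := h0 a a
      rw [if_neg ha, if_pos rfl] at h1
      by_cases ha1 : a = 1
      · subst ha1
        rw [if_neg (by omega), if_pos ⟨rfl, rfl⟩, if_neg (by tauto)]
        ring
      · rw [if_neg ha1] at h1
        rw [if_neg (by omega), if_neg (by tauto), if_neg (by tauto)]
        linear_combination -h1
  · rw [if_neg (c := a = 1 ∧ _) (by omega), if_neg (c := a = 0 ∧ j = 0) (by omega)]
    by_cases h1 : a = 0 ∧ j = 1
    · rw [h1.1, h1.2, if_pos ⟨rfl, rfl⟩]
      ring
    · rw [coord_skew_eq_zero_of_ne hw a hj (by tauto), if_neg h1]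
      ring

end

end Taft

/-! ### Matched pairs evaluated on group-like elements -/

namespace CoalgebraAux

open Coalgebra

variable {K A B H : Type*} [Field K] [AddCommGroup A] [AddCommGroup B] [AddCommGroup H]
  [Module K A] [Module K B] [Module K H] [Coalgebra K A]

theorem comul_tmul_of_isGroupLikeElem [Coalgebra K H] {y : H} (hy : IsGroupLikeElem K y) (a : A) :
    comul (R := K) (y ⊗ₜ[K] a) =
      TensorProduct.map (TensorProduct.mk K H A y) (TensorProduct.mk K H A y) (comul a) := by
  rw [TensorProduct.comul_tmul, hy.comul_eq_tmul_self]
  generalize comul (R := K) a = t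
  induction t with
  | zero => simp only [map_zero, TensorProduct.tmul_zero]
  | add s t hs ht => simp only [TensorProduct.tmul_add, map_add, hs, ht]
  | tmul a b => rfl

/-- If `f = ε(·) y`, then `f(a₁) ⊗ g(a₂) = y ⊗ g(a)`. -/
theorem map_comul_of_counit_left {f : A →ₗ[K] H} {y : H} (hf : ∀ a, f a = counit (R := K) a • y)
    (g : A →ₗ[K] B) (a : A) : TensorProduct.map f g (comul a) = y ⊗ₜ g a := by
  have key : ∀ t : A ⊗[K] A, TensorProduct.map f g t =
      TensorProduct.map (LinearMap.toSpanSingleton K H y) g (counit.rTensor A t) := by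
    intro t
    induction t with
    | zero => simp only [map_zero]
    | add s t hs ht => simp only [map_add, hs, ht]
    | tmul a b => rw [TensorProduct.map_tmul, hf]; rfl
  rw [key, rTensor_counit_comul, TensorProduct.map_tmul, LinearMap.toSpanSingleton_apply, one_smul]

/-- If `f = ε(·) y`, then `g(a₁) ⊗ f(a₂) = g(a) ⊗ y`. -/
theorem map_comul_of_counit_right {f : A →ₗ[K] H} {y : H} (hf : ∀ a, f a = counit (R := K) a • y)
    (g : A →ₗ[K] B) (a : A) : TensorProduct.map g f (comul a) = g a ⊗ₜ y := by
  have key : ∀ t : A ⊗[K] A, TensorProduct.map g f t =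
      TensorProduct.map g (LinearMap.toSpanSingleton K H y) (counit.lTensor A t) := by
    intro t
    induction t with
    | zero => simp only [map_zero]
    | add s t hs ht => simp only [map_add, hs, ht]
    | tmul a b => rw [TensorProduct.map_tmul, hf]; rfl
  rw [key, lTensor_counit_comul, TensorProduct.map_tmul, LinearMap.toSpanSingleton_apply, one_smul]

end CoalgebraAux

namespace MatchedPair

open Coalgebra CoalgebraAux

section

variable {K : Type u} {A : Type v} {H : Type w} [Field K] [Ring A] [Ring H]
  [HopfAlgebra K A] [HopfAlgebra K H]

theorem ext_left_right {P Q : MatchedPair K A H} (hl : P.left = Q.left) (hr : P.right = Q.right) :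
    P = Q := by
  cases P
  cases Q
  cases hl
  cases hr
  rfl

variable (P : MatchedPair K A H)

/-- The map `a ↦ y ▷ a`. -/
noncomputable def leftAct (y : H) : A →ₗ[K] A := P.left.toLinearMap ∘ₗ TensorProduct.mk K H A y

/-- The map `a ↦ y ◁ a`. -/
noncomputable def rightAct (y : H) : A →ₗ[K] H := P.right.toLinearMap ∘ₗ TensorProduct.mk K H A y

theorem leftAct_apply (y : H) (a : A) : P.leftAct y a = P.left (y ⊗ₜ a) := rfl

theorem rightAct_apply (y : H) (a : A) : P.rightAct y a = P.right (y ⊗ₜ a) := rfl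

theorem leftAct_mul (y z : H) (a : A) : P.leftAct (y * z) a = P.leftAct y (P.leftAct z a) :=
  P.mul_left y z a

theorem leftAct_leftAct {y z : H} (hzy : z * y = 1) (a : A) :
    P.leftAct z (P.leftAct y a) = a := by
  rw [← leftAct_mul, hzy]
  exact P.one_left a

variable {y : H} (hy : IsGroupLikeElem K y)
include hy

theorem leftAct_one : P.leftAct y 1 = 1 := by
  rw [leftAct_apply, P.left_one, hy.counit_eq_one, map_one]

theorem counit_leftAct (a : A) : counit (R := K) (P.leftAct y a) = counit (R := K) a := by
  rw [leftAct_apply]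
  erw [CoalgHomClass.counit_comp_apply P.left]
  rw [TensorProduct.counit_tmul, hy.counit_eq_one, smul_eq_mul, mul_one]

theorem comul_leftAct (a : A) :
    comul (R := K) (P.leftAct y a) = TensorProduct.map (P.leftAct y) (P.leftAct y) (comul a) := by
  rw [leftAct, TensorProduct.map_comp, LinearMap.comp_apply (TensorProduct.map _ _),
    ← comul_tmul_of_isGroupLikeElem hy]
  exact (CoalgHomClass.map_comp_comul_apply P.left _).symm

theorem isGroupLikeElem_leftAct {a : A} (ha : IsGroupLikeElem K a) :
    IsGroupLikeElem K (P.leftAct y a) :=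
  ⟨by rw [counit_leftAct P hy, ha.counit_eq_one], by
    rw [comul_leftAct P hy, ha.comul_eq_tmul_self, TensorProduct.map_tmul]⟩

theorem leftAct_mem_span {a : A} (ha : a ∈ Submodule.span K {u : A | IsGroupLikeElem K u}) :
    P.leftAct y a ∈ Submodule.span K {u : A | IsGroupLikeElem K u} := by
  have h1 : Submodule.span K {u : A | IsGroupLikeElem K u} ≤
      (Submodule.span K {u : A | IsGroupLikeElem K u}).comap (P.leftAct y) :=
    Submodule.span_le.mpr fun u hu =>
      Submodule.subset_span (isGroupLikeElem_leftAct P hy hu)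
  exact h1 ha

theorem compat_act (a : A) :
    TensorProduct.map (P.rightAct y) (P.leftAct y) (comul a) =
      TensorProduct.comm K A H (TensorProduct.map (P.leftAct y) (P.rightAct y) (comul a)) := by
  have h1 := P.compat y a
  rw [comul_tmul_of_isGroupLikeElem hy] at h1
  rw [leftAct, rightAct, TensorProduct.map_comp, TensorProduct.map_comp]
  exact h1

/-- If `y ◁ a = ε(a) y` for all `a`, then `y` acts on `A` by an algebra map. -/
theorem leftAct_map_mul (hr : ∀ a, P.rightAct y a = counit (R := K) a • y) (a b : A) :
    P.leftAct y (a * b) = P.leftAct y a * P.leftAct y b := by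
  have h1 := P.left_mul y a b
  rw [comul_tmul_of_isGroupLikeElem hy, ← LinearMap.comp_apply (TensorProduct.map _ _),
    ← TensorProduct.map_comp] at h1
  rw [leftAct_apply, h1, map_comul_of_counit_right (y := P.leftAct y b)]
  · rfl
  · intro a
    change P.left (P.rightAct y a ⊗ₜ b) = _
    rw [hr, ← TensorProduct.smul_tmul', map_smul]
    rfl

end

section

variable {K : Type u} [Field K] {m : ℕ} {q : K} {hm : 2 ≤ m} {hq : IsPrimitiveRoot q m}
  {H : Type w} [Ring H] [HopfAlgebra K H] (P : MatchedPair K (Taft hm hq) H)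
  {y z : H} (hy : IsGroupLikeElem K y) (hz : IsGroupLikeElem K z) (hzy : z * y = 1)
include hy hz hzy

open Taft

omit hy in
/-- The inverse action `z ▷ ·` preserves the span of the group-like elements, which misses `x`. -/
theorem leftAct_x_notMem_span :
    P.leftAct y (x hm hq) ∉ Submodule.span K {u : Taft hm hq | IsGroupLikeElem K u} :=
  fun hx => x_notMem_span (leftAct_leftAct P hzy (x hm hq) ▸ leftAct_mem_span P hz hx)

omit hz in
theorem leftAct_h_ne_one : P.leftAct y (h hm hq) ≠ 1 := fun hh => by
  have h1 := leftAct_leftAct P hzy (h hm hq)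
  have h2 := leftAct_leftAct P hzy (1 : Taft hm hq)
  rw [hh] at h1
  rw [leftAct_one P hy] at h2
  have h3 := coord_h_pow hm hq 1 0 1
  rw [pow_one, ← h1, h2, coord_one, if_neg (fun hc => natCast_one_ne_zero hm hc.1),
    if_pos (by simp)] at h3
  exact zero_ne_one h3

omit hz hzy in
/-- The compatibility condition at `x`, paired with a linear form on `H`. -/
theorem dual_compat_x (f : Module.Dual K H) :
    f (P.rightAct y (h hm hq) - y) • P.leftAct y (x hm hq) =
      f (P.rightAct y (x hm hq)) • (P.leftAct y (h hm hq) - 1) := by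
  have h1 := congrArg (TensorProduct.lid K (Taft hm hq)) <|
    congrArg (f.rTensor (Taft hm hq)) (compat_act P hy (x hm hq))
  have h2 : P.rightAct y 1 = y := P.right_one y
  simp only [comul_x, map_add, TensorProduct.map_tmul, TensorProduct.comm_tmul,
    LinearMap.rTensor_tmul, TensorProduct.lid_tmul, leftAct_one P hy, h2] at h1
  rw [map_sub, sub_smul, smul_sub]
  linear_combination (norm := module) -h1

/-- Otherwise `y ▷ x` would be a combination of the group-like elements `y ▷ h` and `1`. -/
theorem rightAct_h : P.rightAct y (h hm hq) = y := by
  rw [← sub_eq_zero, ← Module.forall_dual_apply_eq_zero_iff K]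
  intro f
  by_contra hf
  refine leftAct_x_notMem_span P hz hzy ((Submodule.smul_mem_iff _ hf).mp ?_)
  rw [dual_compat_x P hy]
  exact Submodule.smul_mem _ _ (Submodule.sub_mem _
    (Submodule.subset_span (isGroupLikeElem_leftAct P hy isGroupLikeElem_h))
    (Submodule.subset_span IsGroupLikeElem.one))

theorem rightAct_x : P.rightAct y (x hm hq) = 0 := by
  rw [← Module.forall_dual_apply_eq_zero_iff K]
  intro f
  have h1 := dual_compat_x P hy f
  rw [rightAct_h P hy hz hzy, sub_self, map_zero, zero_smul] at h1
  exact (smul_eq_zero.mp h1.symm).resolve_right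
    (sub_ne_zero.mpr (leftAct_h_ne_one P hy hzy))

/-- The right action of the Taft algebra is trivial. -/
theorem rightAct_eq (a : Taft hm hq) : P.rightAct y a = counit (R := K) a • y := by
  have ha : a ∈ Algebra.adjoin K {h hm hq, x hm hq} := adjoin_eq_top hm hq ▸ Algebra.mem_top
  induction ha using Algebra.adjoin_induction with
  | mem a ha =>
    rcases ha with rfl | rfl
    · rw [rightAct_h P hy hz hzy, counit_h, one_smul]
    · rw [rightAct_x P hy hz hzy, counit_x, zero_smul]
  | algebraMap r =>
    rw [Algebra.algebraMap_eq_smul_one, map_smul, map_smul, Bialgebra.counit_one, smul_eq_mul,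
      mul_one]
    exact congrArg (r • ·) (P.right_one y)
  | add a b _ _ ha hb => rw [map_add, map_add, ha, hb, add_smul]
  | mul a b _ _ ha hb =>
    change P.right (y ⊗ₜ (a * b)) = _
    rw [rightAct_apply] at ha hb
    rw [P.right_mul, ha, ← TensorProduct.smul_tmul', map_smul, hb, smul_smul,
      Bialgebra.counit_mul]

/-- An invertible group-like element of `H` fixes `h` and scales `x`. -/
theorem leftAct_h_and_x : P.leftAct y (h hm hq) = h hm hq ∧
    P.leftAct y (x hm hq) = coord hm hq 0 1 (P.leftAct y (x hm hq)) • x hm hq := by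
  obtain ⟨i, hi⟩ := exists_eq_h_pow (isGroupLikeElem_leftAct P hy (isGroupLikeElem_h (hm := hm)
    (hq := hq)))
  have hw : comul (R := K) (P.leftAct y (x hm hq)) =
      P.leftAct y (x hm hq) ⊗ₜ (h hm hq ^ i) + 1 ⊗ₜ P.leftAct y (x hm hq) := by
    rw [comul_leftAct P hy, comul_x, map_add, TensorProduct.map_tmul, TensorProduct.map_tmul, hi,
      leftAct_one P hy]
  obtain ⟨h1, r, hr⟩ := skew_classification hw (leftAct_x_notMem_span P hz hzy)
  have hh : P.leftAct y (h hm hq) = h hm hq := hi.trans h1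
  refine ⟨hh, ?_⟩
  -- The relation `x h = q h x` excludes the multiple of `h - 1`.
  have hrel : P.leftAct y (x hm hq) * h hm hq = q • (h hm hq * P.leftAct y (x hm hq)) := by
    have h2 := leftAct_map_mul P hy (rightAct_eq P hy hz hzy)
    have h3 := h2 (x hm hq) (h hm hq)
    rwa [x_mul_h, map_smul, h2, hh, eq_comm] at h3
  have h2 : (r * (1 - q)) • (h hm hq * (h hm hq - 1)) = 0 := by
    generalize coord hm hq 0 1 (P.leftAct y (x hm hq)) = t at hr
    rw [hr] at hrel
    have h4 : r • ((h hm hq - 1) * h hm hq) = q • r • (h hm hq * (h hm hq - 1)) := by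
      simpa only [add_mul, mul_add, smul_mul_assoc, mul_smul_comm, x_mul_h, smul_add,
        smul_comm t q, add_right_inj] using hrel
    rw [mul_sub, sub_smul, mul_one, mul_comm r q, mul_smul q r, ← h4, sub_eq_zero]
    congr 1
    noncomm_ring
  have h3 : h hm hq * (h hm hq - 1) ≠ 0 := fun h0 => by
    have h4 := congrArg (h hm hq ^ (m - 1) * ·) h0
    simp only [← mul_assoc, inv_mul_h, one_mul, mul_zero] at h4
    have h5 := congrArg (coord hm hq 0 0) h4
    have h6 := coord_h_pow hm hq 0 0 1
    rw [pow_one, Nat.cast_one, if_neg (fun hc => natCast_one_ne_zero hm hc.1.symm)] at h6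
    rw [map_sub, h6, coord_one, if_pos ⟨rfl, rfl⟩, map_zero] at h5
    norm_num at h5
  have h4 : r = 0 := by
    refine (mul_eq_zero.mp ((smul_eq_zero.mp h2).resolve_right h3)).resolve_right ?_
    exact sub_ne_zero.mpr (hq.ne_one (by omega)).symm
  rw [h4, zero_smul, add_zero] at hr
  exact hr

end

end MatchedPair

/-! ### Smash products: the matched pair of a group acting by bialgebra endomorphisms -/

namespace MatchedPair

open Coalgebra CoalgebraAux

variable {K : Type u} {A : Type v} {G : Type w} [Field K] [Ring A] [HopfAlgebra K A] [Group G]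

theorem isGroupLikeElem_of (g : G) : IsGroupLikeElem K (MonoidAlgebra.of K G g) :=
  ⟨by rw [MonoidAlgebra.of_apply, MonoidAlgebra.counit_single, CommSemiring.counit_apply], by
    rw [MonoidAlgebra.of_apply, MonoidAlgebra.comul_single, CommSemiring.comul_apply,
      TensorProduct.map_tmul]
    rfl⟩

variable (ρ : G →* (A →ₐc[K] A))

/-- The linear extension to `K[G]` of an action of `G` on `A`. -/
noncomputable def groupAct : MonoidAlgebra K G →ₐ[K] Module.End K A :=
  MonoidAlgebra.lift K (Module.End K A) G
    { toFun g := (ρ g : A →ₗ[K] A)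
      map_one' := by rw [map_one]; rfl
      map_mul' g g' := by rw [map_mul]; rfl }

theorem groupAct_of (g : G) (a : A) : groupAct ρ (MonoidAlgebra.of K G g) a = ρ g a := by
  rw [groupAct, MonoidAlgebra.lift_of]
  rfl

/-- The left action `g ▷ a = ρ(g)(a)`. -/
noncomputable def smashLeft : MonoidAlgebra K G ⊗[K] A →ₗ[K] A :=
  TensorProduct.lift (groupAct ρ).toLinearMap

theorem smashLeft_tmul (y : MonoidAlgebra K G) (a : A) :
    smashLeft ρ (y ⊗ₜ a) = groupAct ρ y a := rfl

theorem smashLeft_comp_mk (g : G) : smashLeft ρ ∘ₗ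
    TensorProduct.mk K (MonoidAlgebra K G) A (MonoidAlgebra.of K G g) = (ρ g : A →ₗ[K] A) :=
  LinearMap.ext fun a => groupAct_of ρ g a

/-- The trivial right action `y ◁ a = ε(a) y`. -/
noncomputable def trivialRight (K : Type u) (A : Type v) (G : Type w) [Field K] [Ring A]
    [HopfAlgebra K A] [Group G] : MonoidAlgebra K G ⊗[K] A →ₗ[K] MonoidAlgebra K G :=
  (TensorProduct.rid K _).toLinearMap ∘ₗ counit.lTensor _

theorem trivialRight_tmul (y : MonoidAlgebra K G) (a : A) :
    trivialRight K A G (y ⊗ₜ a) = counit (R := K) a • y := rfl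

theorem linearMap_ext_of {W : Type*} [AddCommGroup W] [Module K W]
    {f f' : MonoidAlgebra K G ⊗[K] A →ₗ[K] W}
    (hf : ∀ (g : G) (a : A), f (MonoidAlgebra.of K G g ⊗ₜ a) = f' (MonoidAlgebra.of K G g ⊗ₜ a)) :
    f = f' := by
  refine TensorProduct.ext' fun y a => ?_
  induction y using MonoidAlgebra.induction_on with
  | of g => exact hf g a
  | add y z hy hz => rw [TensorProduct.add_tmul, map_add, map_add, hy, hz]
  | smul r y hy => rw [← TensorProduct.smul_tmul', map_smul, map_smul, hy]

theorem map_comul_of {B C : Type*} [AddCommGroup B] [AddCommGroup C] [Module K B] [Module K C]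
    (f : MonoidAlgebra K G ⊗[K] A →ₗ[K] B) (f' : MonoidAlgebra K G ⊗[K] A →ₗ[K] C)
    (g : G) (a : A) :
    TensorProduct.map f f' (comul (MonoidAlgebra.of K G g ⊗ₜ[K] a)) =
      TensorProduct.map (f ∘ₗ TensorProduct.mk K _ A (MonoidAlgebra.of K G g))
        (f' ∘ₗ TensorProduct.mk K _ A (MonoidAlgebra.of K G g)) (comul a) := by
  rw [comul_tmul_of_isGroupLikeElem (isGroupLikeElem_of g), TensorProduct.map_comp]
  rfl

/-- The left action as a coalgebra map. -/
noncomputable def smashLeftHom : MonoidAlgebra K G ⊗[K] A →ₗc[K] A where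
  __ := smashLeft ρ
  counit_comp := linearMap_ext_of fun g a => by
    change counit (R := K) (smashLeft ρ (MonoidAlgebra.of K G g ⊗ₜ a)) = _
    rw [smashLeft_tmul, groupAct_of, TensorProduct.counit_tmul, (isGroupLikeElem_of g).counit_eq_one,
      smul_eq_mul, mul_one]
    exact CoalgHomClass.counit_comp_apply (ρ g) a
  map_comp_comul := linearMap_ext_of fun g a => by
    change TensorProduct.map (smashLeft ρ) (smashLeft ρ) (comul (MonoidAlgebra.of K G g ⊗ₜ[K] a)) =
      comul (smashLeft ρ (MonoidAlgebra.of K G g ⊗ₜ a))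
    rw [map_comul_of, smashLeft_comp_mk, smashLeft_tmul, groupAct_of]
    exact CoalgHomClass.map_comp_comul_apply (ρ g) a

/-- The trivial right action as a coalgebra map. -/
noncomputable def trivialRightHom (K : Type u) (A : Type v) (G : Type w) [Field K] [Ring A]
    [HopfAlgebra K A] [Group G] : MonoidAlgebra K G ⊗[K] A →ₗc[K] MonoidAlgebra K G where
  __ := trivialRight K A G
  counit_comp := linearMap_ext_of fun g a => by
    change counit (R := K) (trivialRight K A G (MonoidAlgebra.of K G g ⊗ₜ a)) = _
    rw [trivialRight_tmul, map_smul, TensorProduct.counit_tmul,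
      (isGroupLikeElem_of g).counit_eq_one]
  map_comp_comul := linearMap_ext_of fun g a => by
    change TensorProduct.map (trivialRight K A G) (trivialRight K A G)
      (comul (MonoidAlgebra.of K G g ⊗ₜ[K] a)) =
      comul (trivialRight K A G (MonoidAlgebra.of K G g ⊗ₜ a))
    rw [map_comul_of, map_comul_of_counit_left (y := MonoidAlgebra.of K G g) (fun _ => rfl),
      trivialRight_tmul, map_smul, (isGroupLikeElem_of g).comul_eq_tmul_self,
      ← TensorProduct.tmul_smul]
    rfl

/-- The matched pair with `g ▷ a = ρ(g)(a)` and `g ◁ a = ε(a) g`. -/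
noncomputable def ofGroupAct : MatchedPair K A (MonoidAlgebra K G) where
  left := smashLeftHom ρ
  right := trivialRightHom K A G
  one_left a := by
    change groupAct ρ 1 a = a
    rw [map_one, Module.End.one_apply]
  mul_left y z a := by
    change groupAct ρ (y * z) a = groupAct ρ y (groupAct ρ z a)
    rw [map_mul, Module.End.mul_apply]
  right_one y := by
    change counit (R := K) (1 : A) • y = y
    rw [Bialgebra.counit_one, one_smul]
  right_mul y a b := by
    change counit (R := K) (a * b) • y = counit (R := K) b • counit (R := K) a • y
    rw [Bialgebra.counit_mul, smul_smul, mul_comm]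
  left_one y := by
    change groupAct ρ y 1 = algebraMap K A (counit y)
    induction y using MonoidAlgebra.induction_on with
    | of g => rw [groupAct_of, map_one, (isGroupLikeElem_of g).counit_eq_one, map_one]
    | add y z hy hz => simp only [map_add, LinearMap.add_apply, hy, hz]
    | smul r y hy =>
      rw [map_smul, LinearMap.smul_apply, hy, map_smul, smul_eq_mul, map_mul, Algebra.smul_def]
  one_right a := by
    change counit (R := K) a • (1 : MonoidAlgebra K G) = _
    rw [Algebra.algebraMap_eq_smul_one]
  left_mul y a b := by
    change smashLeft ρ (y ⊗ₜ (a * b)) = LinearMap.mul' K A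
      (TensorProduct.map (smashLeft ρ)
        (smashLeft ρ ∘ₗ (TensorProduct.mk K _ A).flip b ∘ₗ trivialRight K A G)
        (comul (y ⊗ₜ[K] a)))
    induction y using MonoidAlgebra.induction_on with
    | of g =>
      rw [map_comul_of, map_comul_of_counit_right (y := ρ g b), smashLeft_comp_mk, smashLeft_tmul,
        groupAct_of, map_mul]
      · rfl
      · intro a
        change smashLeft ρ ((counit (R := K) a • MonoidAlgebra.of K G g) ⊗ₜ b) = _
        rw [← TensorProduct.smul_tmul', map_smul, smashLeft_tmul, groupAct_of]
    | add y z hy hz => simp only [TensorProduct.add_tmul, map_add, hy, hz]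
    | smul r y hy => simp only [← TensorProduct.smul_tmul', map_smul, hy]
  mul_right y z a := by
    change trivialRight K A G ((y * z) ⊗ₜ a) = LinearMap.mul' K _
      (TensorProduct.map
        (trivialRight K A G ∘ₗ TensorProduct.mk K _ A y ∘ₗ smashLeft ρ) (trivialRight K A G)
        (comul (z ⊗ₜ[K] a)))
    induction z using MonoidAlgebra.induction_on with
    | of g =>
      rw [map_comul_of, map_comul_of_counit_left (y := y), trivialRight_tmul]
      · exact (mul_smul_comm _ _ _).symm
      · intro a
        change counit (R := K) (groupAct ρ (MonoidAlgebra.of K G g) a) • y = _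
        rw [groupAct_of]
        congr 1
        exact CoalgHomClass.counit_comp_apply (ρ g) a
    | add z z' hz hz' => simp only [mul_add, TensorProduct.add_tmul, map_add, hz, hz']
    | smul r z hz => simp only [mul_smul_comm, ← TensorProduct.smul_tmul', map_smul, hz]
  compat y a := by
    change TensorProduct.map (trivialRight K A G) (smashLeft ρ) (comul (y ⊗ₜ[K] a)) =
      TensorProduct.comm K A _
        (TensorProduct.map (smashLeft ρ) (trivialRight K A G) (comul (y ⊗ₜ[K] a)))
    induction y using MonoidAlgebra.induction_on with
    | of g =>
      rw [map_comul_of, map_comul_of, map_comul_of_counit_left (y := MonoidAlgebra.of K G g)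
        (fun _ => rfl), map_comul_of_counit_right (y := MonoidAlgebra.of K G g) (fun _ => rfl),
        TensorProduct.comm_tmul]
    | add y z hy hz => simp only [TensorProduct.add_tmul, map_add, hy, hz]
    | smul r y hy => simp only [← TensorProduct.smul_tmul', map_smul, hy]

theorem ofGroupAct_left_of (g : G) (a : A) :
    (ofGroupAct ρ).left (MonoidAlgebra.of K G g ⊗ₜ a) = ρ g a := groupAct_of ρ g a

theorem braid_ofGroupAct_of (g : G) (a : A) :
    (ofGroupAct ρ).braid (MonoidAlgebra.of K G g ⊗ₜ a) = ρ g a ⊗ₜ MonoidAlgebra.of K G g :=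
  (map_comul_of _ _ g a).trans <|
    (map_comul_of_counit_right (y := MonoidAlgebra.of K G g) (fun _ => rfl) _ a).trans <|
      congrArg (· ⊗ₜ MonoidAlgebra.of K G g) (groupAct_of ρ g a)

namespace BicrossedProduct

/-- The embedding `a ↦ a ⋈ 1` as an algebra map. -/
noncomputable def inlHom {H : Type w} [Ring H] [HopfAlgebra K H] (P : MatchedPair K A H) :
    A →ₐ[K] P.BicrossedProduct :=
  AlgHom.ofLinearMap (inl P) rfl (inl_mul P)

/-- The embedding `y ↦ 1 ⋈ y` as an algebra map. -/
noncomputable def inrHom {H : Type w} [Ring H] [HopfAlgebra K H] (P : MatchedPair K A H) :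
    H →ₐ[K] P.BicrossedProduct :=
  AlgHom.ofLinearMap (inr P) rfl (inr_mul P)

theorem inrHom_mul_inlHom (g : G) (a : A) :
    inrHom (ofGroupAct ρ) (MonoidAlgebra.of K G g) * inlHom (ofGroupAct ρ) a =
      inlHom (ofGroupAct ρ) (ρ g a) * inrHom (ofGroupAct ρ) (MonoidAlgebra.of K G g) := by
  change inr _ _ * inl _ _ = inl _ _ * inr _ _
  rw [inl_mul_inr, inl_apply, inr_apply, mk_mul_mk, braid_ofGroupAct_of, lr_tmul, one_mul, mul_one]
  rfl

section

variable {H : Type w} [Ring H] [HopfAlgebra K H] (P : MatchedPair K A H)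

theorem comul_inl (a : A) : comul (R := K) (inlHom P a) =
    TensorProduct.map (inlHom P).toLinearMap (inlHom P).toLinearMap (comul a) := by
  change comul (R := K) (mk P a 1) = _
  rw [comul_mk, Bialgebra.comul_one, Algebra.TensorProduct.one_def]
  generalize comul (R := K) a = t
  induction t with
  | zero => rw [TensorProduct.zero_tmul, map_zero, map_zero]
  | add s t hs ht => rw [TensorProduct.add_tmul, map_add, map_add, hs, ht]
  | tmul a b => rfl

theorem comul_inr (y : H) : comul (R := K) (inrHom P y) =
    TensorProduct.map (inrHom P).toLinearMap (inrHom P).toLinearMap (comul y) := by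
  change comul (R := K) (mk P 1 y) = _
  rw [comul_mk, Bialgebra.comul_one, Algebra.TensorProduct.one_def]
  generalize comul (R := K) y = t
  induction t with
  | zero => rw [TensorProduct.tmul_zero, map_zero, map_zero]
  | add s t hs ht => rw [TensorProduct.tmul_add, map_add, map_add, hs, ht]
  | tmul a b => rfl

theorem counit_inl (a : A) : counit (R := K) (inlHom P a) = counit (R := K) a := by
  change counit (R := K) (mk P a 1) = _
  rw [counit_mk, Bialgebra.counit_one, one_mul]

theorem counit_inr (y : H) : counit (R := K) (inrHom P y) = counit (R := K) y := by
  change counit (R := K) (mk P 1 y) = _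
  rw [counit_mk, Bialgebra.counit_one, mul_one]

end

end BicrossedProduct

end MatchedPair

/-! ### Matched pairs of the Taft algebra and a group algebra -/

namespace Taft

variable {K : Type u} [Field K] {m : ℕ} {q : K} (hm : 2 ≤ m) (hq : IsPrimitiveRoot q m)

theorem bialgHom_ext {B : Type*} [Semiring B] [Bialgebra K B] {f g : Taft hm hq →ₐc[K] B}
    (h1 : f (h hm hq) = g (h hm hq)) (h2 : f (x hm hq) = g (x hm hq)) : f = g := by
  have key : (f : Taft hm hq →ₐ[K] B) = g := algHom_ext h1 h2
  exact DFunLike.ext _ _ fun z => DFunLike.congr_fun key z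

/-- The algebra endomorphism `h ↦ h`, `x ↦ r x`. -/
def scaleAlgHom (r : K) : Taft hm hq →ₐ[K] Taft hm hq :=
  lift (h hm hq) (r • x hm hq) (h_pow hm hq)
    (by rw [smul_pow, x_pow, smul_zero])
    (by rw [smul_mul_assoc, x_mul_h, mul_smul_comm, smul_comm])

/-- The bialgebra endomorphism `h ↦ h`, `x ↦ r x`. -/
noncomputable def scale (r : K) : Taft hm hq →ₐc[K] Taft hm hq :=
  BialgHom.ofAlgHom (scaleAlgHom hm hq r)
    (algHom_ext (by simp [scaleAlgHom, counit_h]) (by simp [scaleAlgHom, counit_x]))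
    (algHom_ext (by simp [scaleAlgHom, comul_h])
      (by simp [scaleAlgHom, comul_x, TensorProduct.smul_tmul']))

theorem scale_h (r : K) : scale hm hq r (h hm hq) = h hm hq := lift_h _ _ _

theorem scale_x (r : K) : scale hm hq r (x hm hq) = r • x hm hq := lift_x _ _ _

theorem scale_h_pow_mul_x_pow (r : K) (i j : ℕ) :
    scale hm hq r (h hm hq ^ i * x hm hq ^ j) = r ^ j • (h hm hq ^ i * x hm hq ^ j) := by
  rw [map_mul, map_pow, map_pow, scale_h, scale_x, smul_pow, mul_smul_comm]

/-- The action of a group on the Taft algebra by scaling `x` with a character. -/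
noncomputable def scaleAct {G : Type w} [Group G] (γ : G →* K) :
    G →* (Taft hm hq →ₐc[K] Taft hm hq) where
  toFun g := scale hm hq (γ g)
  map_one' := bialgHom_ext hm hq (scale_h hm hq _) (by
    rw [scale_x, map_one, one_smul]
    rfl)
  map_mul' g g' := bialgHom_ext hm hq
    (by
      change _ = scale hm hq _ (scale hm hq _ _)
      simp only [scale_h])
    (by
      change _ = scale hm hq _ (scale hm hq _ _)
      rw [scale_x, scale_x, map_smul, scale_x, map_mul, mul_comm, mul_smul])

end Taft

namespace MatchedPair

open Taft

variable {K : Type u} [Field K] {m : ℕ} {q : K} {hm : 2 ≤ m} {hq : IsPrimitiveRoot q m}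
  {G : Type w} [Group G]

/-- The matched pair with `g ▷ h = h`, `g ▷ x = γ(g) x` and `g ◁ a = ε(a) g`. -/
noncomputable def ofChar (hm : 2 ≤ m) (hq : IsPrimitiveRoot q m) (γ : G →* K) :
    MatchedPair K (Taft hm hq) (MonoidAlgebra K G) :=
  ofGroupAct (scaleAct hm hq γ)

theorem ofChar_left (γ : G →* K) (g : G) (i j : ℕ) :
    (ofChar hm hq γ).left (MonoidAlgebra.of K G g ⊗ₜ (h hm hq ^ i * x hm hq ^ j)) =
      γ g ^ j • (h hm hq ^ i * x hm hq ^ j) :=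
  (ofGroupAct_left_of _ g _).trans (scale_h_pow_mul_x_pow hm hq _ i j)

theorem ofChar_injective :
    Function.Injective (ofChar hm hq : (G →* K) → MatchedPair K (Taft hm hq) _) := by
  intro γ γ' hγ
  ext g
  have h1 : ∀ δ : G →* K,
      coord hm hq 0 1 ((ofChar hm hq δ).left (MonoidAlgebra.of K G g ⊗ₜ x hm hq)) = δ g := by
    intro δ
    have h2 := ofChar_left (hm := hm) (hq := hq) δ g 0 1
    rw [pow_zero, one_mul, pow_one, pow_one] at h2
    rw [h2, map_smul, coord_x, if_pos ⟨rfl, rfl⟩, smul_eq_mul, mul_one]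
  rw [← h1 γ, hγ, h1]

variable (P : MatchedPair K (Taft hm hq) (MonoidAlgebra K G))

theorem of_inv_mul_of (g : G) :
    MonoidAlgebra.of K G g⁻¹ * MonoidAlgebra.of K G g = 1 := by
  rw [← map_mul, inv_mul_cancel, map_one]

theorem leftAct_of_x (g : G) : P.leftAct (MonoidAlgebra.of K G g) (x hm hq) =
    coord hm hq 0 1 (P.leftAct (MonoidAlgebra.of K G g) (x hm hq)) • x hm hq :=
  (leftAct_h_and_x P (isGroupLikeElem_of g) (isGroupLikeElem_of g⁻¹) (of_inv_mul_of g)).2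

/-- The character `γ` with `g ▷ x = γ(g) x`. -/
noncomputable def toChar : G →* K where
  toFun g := coord hm hq 0 1 (P.leftAct (MonoidAlgebra.of K G g) (x hm hq))
  map_one' := by
    rw [map_one, leftAct_apply, P.one_left, coord_x, if_pos ⟨rfl, rfl⟩]
  map_mul' g g' := by
    rw [map_mul, leftAct_mul, leftAct_of_x P g', map_smul, map_smul, map_smul, coord_x,
      if_pos ⟨rfl, rfl⟩, smul_eq_mul, smul_eq_mul, mul_one, mul_comm]

theorem ofChar_toChar : ofChar hm hq P.toChar = P := by
  refine ext_left_right ?_ ?_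
  · suffices h1 : (ofChar hm hq P.toChar).left.toLinearMap = P.left.toLinearMap from
      DFunLike.ext _ _ fun t => LinearMap.congr_fun h1 t
    refine linearMap_ext_of fun g a => ?_
    have hr := rightAct_eq P (isGroupLikeElem_of g) (isGroupLikeElem_of g⁻¹) (of_inv_mul_of g)
    have key : (scale hm hq (P.toChar g) : Taft hm hq →ₐ[K] Taft hm hq) =
        AlgHom.ofLinearMap (P.leftAct (MonoidAlgebra.of K G g))
          (leftAct_one P (isGroupLikeElem_of g))
          (leftAct_map_mul P (isGroupLikeElem_of g) hr) :=
      algHom_ext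
        ((scale_h hm hq _).trans
          (leftAct_h_and_x P (isGroupLikeElem_of g) (isGroupLikeElem_of g⁻¹)
            (of_inv_mul_of g)).1.symm)
        ((scale_x hm hq _).trans (leftAct_of_x P g).symm)
    exact (ofGroupAct_left_of _ g a).trans (DFunLike.congr_fun key a)
  · suffices h1 : (ofChar hm hq P.toChar).right.toLinearMap = P.right.toLinearMap from
      DFunLike.ext _ _ fun t => LinearMap.congr_fun h1 t
    exact linearMap_ext_of fun g a => (rightAct_eq P (isGroupLikeElem_of g)
      (isGroupLikeElem_of g⁻¹) (of_inv_mul_of g) a).symm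

/-- The matched pairs of the Taft algebra and `K[G]` correspond to the characters of `G`. -/
noncomputable def charEquiv (hm : 2 ≤ m) (hq : IsPrimitiveRoot q m) (G : Type w) [Group G] :
    (G →* K) ≃ MatchedPair K (Taft hm hq) (MonoidAlgebra K G) :=
  Equiv.ofBijective (ofChar hm hq) ⟨ofChar_injective, fun P => ⟨P.toChar, ofChar_toChar P⟩⟩

end MatchedPair

/-! ### Characters of the split metacyclic group -/

namespace Metacyclic

variable {K : Type u} [Field K] {k l n : ℕ}

theorem c_pow : c k l n ^ l = 1 :=
  PresentedGroup.one_of_mem (rels := {r | MetacyclicRel k l n r}) MetacyclicRel.c_pow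

theorem d_pow : d k l n ^ n = 1 :=
  PresentedGroup.one_of_mem (rels := {r | MetacyclicRel k l n r}) MetacyclicRel.d_pow

theorem c_mul_d : c k l n * d k l n = d k l n ^ k * c k l n :=
  mul_inv_eq_one.mp
    (PresentedGroup.one_of_mem (rels := {r | MetacyclicRel k l n r}) MetacyclicRel.c_mul_d)

theorem pow_eq_self_of_gcd (hk : 1 ≤ k) {s : Kˣ} (hs : s ^ n.gcd (k - 1) = 1) :
    s ^ n = 1 ∧ s ^ k = s := by
  obtain ⟨h1, h2⟩ := pow_gcd_eq_one.mp hs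
  refine ⟨h1, ?_⟩
  conv_lhs => rw [← Nat.sub_add_cancel hk, pow_succ, h2, one_mul]

/-- The character with `c ↦ β` and `d ↦ σ`. -/
def charUnits (hk : 1 ≤ k) (β : rootsOfUnity l K) (σ : rootsOfUnity (n.gcd (k - 1)) K) :
    Metacyclic k l n →* Kˣ :=
  PresentedGroup.toGroup (f := fun | .c => (β : Kˣ) | .d => (σ : Kˣ)) (by
    rintro r (_ | _ | _)
    · rw [map_pow, FreeGroup.lift_apply_of]
      exact (mem_rootsOfUnity _ _).mp β.2
    · rw [map_pow, FreeGroup.lift_apply_of]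
      exact (pow_eq_self_of_gcd hk ((mem_rootsOfUnity _ _).mp σ.2)).1
    · simp only [map_mul, map_inv, map_pow, FreeGroup.lift_apply_of]
      rw [(pow_eq_self_of_gcd hk ((mem_rootsOfUnity _ _).mp σ.2)).2, mul_comm (β : Kˣ), mul_inv_cancel])

theorem charUnits_c (hk : 1 ≤ k) (β : rootsOfUnity l K) (σ : rootsOfUnity (n.gcd (k - 1)) K) :
    charUnits hk β σ (c k l n) = β := PresentedGroup.toGroup.of _

theorem charUnits_d (hk : 1 ≤ k) (β : rootsOfUnity l K) (σ : rootsOfUnity (n.gcd (k - 1)) K) :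
    charUnits hk β σ (d k l n) = σ := PresentedGroup.toGroup.of _

theorem hom_ext {M : Type*} [Monoid M] {f g : Metacyclic k l n →* M}
    (h1 : f (c k l n) = g (c k l n)) (h2 : f (d k l n) = g (d k l n)) : f = g := by
  have key : f.toHomUnits = g.toHomUnits := PresentedGroup.ext fun
    | .c => Units.ext h1
    | .d => Units.ext h2
  ext y
  exact congrArg Units.val (DFunLike.congr_fun key y)

/-- A character `χ` of the group is determined by `(χ(c), χ(d))`, an arbitrary element of
`U_l(K) × U_{(n, k - 1)}(K)`: the relation `c d = d ^ k c` amounts to `χ(d) ^ (k - 1) = 1`. -/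
noncomputable def charEquiv (K : Type u) [Field K] (hk : 1 ≤ k) :
    rootsOfUnity l K × rootsOfUnity (n.gcd (k - 1)) K ≃ (Metacyclic k l n →* K) where
  toFun p := (Units.coeHom K).comp (charUnits hk p.1 p.2)
  invFun χ :=
    (⟨χ.toHomUnits (c k l n), by
        rw [mem_rootsOfUnity, ← map_pow, c_pow, map_one]⟩,
      ⟨χ.toHomUnits (d k l n), by
        rw [mem_rootsOfUnity, pow_gcd_eq_one]
        refine ⟨by rw [← map_pow, d_pow, map_one], ?_⟩
        have h1 := congrArg χ.toHomUnits (c_mul_d (k := k) (l := l) (n := n))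
        rw [map_mul, map_mul, map_pow, mul_comm, mul_left_inj] at h1
        refine mul_right_cancel (b := χ.toHomUnits (d k l n)) ?_
        rw [one_mul, ← pow_succ, Nat.sub_add_cancel hk]
        exact h1.symm⟩)
  left_inv p := Prod.ext
    (Subtype.ext (Units.ext (show ((charUnits hk p.1 p.2 (c k l n) : Kˣ) : K) = _ by
      rw [charUnits_c])))
    (Subtype.ext (Units.ext (show ((charUnits hk p.1 p.2 (d k l n) : Kˣ) : K) = _ by
      rw [charUnits_d])))
  right_inv χ := hom_ext (congrArg Units.val (charUnits_c hk _ _))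
    (congrArg Units.val (charUnits_d hk _ _))

theorem charEquiv_c (hk : 1 ≤ k) (β : rootsOfUnity l K) (σ : rootsOfUnity (n.gcd (k - 1)) K) :
    charEquiv K hk (β, σ) (c k l n) = ((β : Kˣ) : K) :=
  congrArg Units.val (charUnits_c hk β σ)

theorem charEquiv_d (hk : 1 ≤ k) (β : rootsOfUnity l K) (σ : rootsOfUnity (n.gcd (k - 1)) K) :
    charEquiv K hk (β, σ) (d k l n) = ((σ : Kˣ) : K) :=
  congrArg Units.val (charUnits_d hk β σ)

end Metacyclic

/-! ### The bicrossed products -/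

namespace TaftMetacyclic

open MatchedPair BicrossedProduct Coalgebra

variable {K : Type u} [Field K] {m : ℕ} {q : K} (hm : 2 ≤ m) (hq : IsPrimitiveRoot q m)
  {k l n : ℕ} (hl : 1 ≤ l) (hn : 1 ≤ n) {β σ : K} (γ : Metacyclic k l n →* K)
  (hc : γ (Metacyclic.c k l n) = β) (hd : γ (Metacyclic.d k l n) = σ)

/-- The element `1 ⋈ g`. -/
noncomputable def groupElem (g : Metacyclic k l n) : (ofChar hm hq γ).BicrossedProduct :=
  inrHom (ofChar hm hq γ) (MonoidAlgebra.of K _ g)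

/-- The element `a ⋈ 1`. -/
noncomputable def taftElem (a : Taft hm hq) : (ofChar hm hq γ).BicrossedProduct :=
  inlHom (ofChar hm hq γ) a

theorem groupElem_mul_taftElem (g : Metacyclic k l n) (a : Taft hm hq) :
    groupElem hm hq γ g * taftElem hm hq γ a =
      taftElem hm hq γ (Taft.scale hm hq (γ g) a) * groupElem hm hq γ g :=
  inrHom_mul_inlHom _ g a

theorem groupElem_mul_h (g : Metacyclic k l n) :
    groupElem hm hq γ g * taftElem hm hq γ (Taft.h hm hq) =
      taftElem hm hq γ (Taft.h hm hq) * groupElem hm hq γ g := by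
  rw [groupElem_mul_taftElem, Taft.scale_h]

theorem groupElem_mul_x (g : Metacyclic k l n) :
    groupElem hm hq γ g * taftElem hm hq γ (Taft.x hm hq) =
      γ g • (taftElem hm hq γ (Taft.x hm hq) * groupElem hm hq γ g) := by
  rw [groupElem_mul_taftElem, Taft.scale_x, taftElem, map_smul, smul_mul_assoc]
  rfl

/-- The algebra map to the bicrossed product that sends `c`, `d`, `h`, `x` to `1 ⋈ c`, `1 ⋈ d`,
`h ⋈ 1`, `x ⋈ 1`. -/
noncomputable def toBicrossed :
    TaftMetacyclic hm hq (k := k) hl hn β σ →ₐ[K] (ofChar hm hq γ).BicrossedProduct :=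
  lift (groupElem hm hq γ (Metacyclic.c k l n)) (groupElem hm hq γ (Metacyclic.d k l n))
    (taftElem hm hq γ (Taft.h hm hq)) (taftElem hm hq γ (Taft.x hm hq))
    (by rw [groupElem, ← map_pow, ← map_pow, Metacyclic.c_pow, map_one, map_one])
    (by rw [groupElem, ← map_pow, ← map_pow, Metacyclic.d_pow, map_one, map_one])
    (by rw [taftElem, ← map_pow, Taft.h_pow, map_one])
    (by rw [taftElem, ← map_pow, Taft.x_pow, map_zero])
    (groupElem_mul_h hm hq γ _) (groupElem_mul_h hm hq γ _)
    (by simp only [groupElem, ← map_mul, ← map_pow, Metacyclic.c_mul_d])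
    (hc ▸ groupElem_mul_x hm hq γ _) (hd ▸ groupElem_mul_x hm hq γ _)
    (by
      simp only [taftElem]
      rw [← map_mul, ← map_mul, ← map_smul, Taft.x_mul_h])

/-- The inclusion of the Taft algebra. -/
def ofTaft (β σ : K) : Taft hm hq →ₐ[K] TaftMetacyclic hm hq (k := k) hl hn β σ :=
  Taft.lift (h hm hq hl hn β σ) (x hm hq hl hn β σ) (h_pow hm hq hl hn β σ)
    (x_pow hm hq hl hn β σ) (x_mul_h hm hq hl hn β σ)

/-- The map from the group to the units of the presented algebra. -/
def ofMetacyclicUnits (β σ : K) :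
    Metacyclic k l n →* (TaftMetacyclic hm hq (k := k) hl hn β σ)ˣ :=
  PresentedGroup.toGroup (f := fun
      | .c => ⟨c hm hq hl hn β σ, c hm hq hl hn β σ ^ (l - 1), c_mul_inv hm hq hl hn β σ,
          inv_mul_c hm hq hl hn β σ⟩
      | .d => ⟨d hm hq hl hn β σ, d hm hq hl hn β σ ^ (n - 1), d_mul_inv hm hq hl hn β σ,
          inv_mul_d hm hq hl hn β σ⟩) (by
    rintro r (_ | _ | _)
    · rw [map_pow, FreeGroup.lift_apply_of]
      exact Units.ext (c_pow hm hq hl hn β σ)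
    · rw [map_pow, FreeGroup.lift_apply_of]
      exact Units.ext (d_pow hm hq hl hn β σ)
    · simp only [map_mul, map_inv, map_pow, FreeGroup.lift_apply_of]
      rw [mul_inv_eq_one]
      exact Units.ext (c_mul_d hm hq hl hn β σ))

/-- The map from the group algebra to the presented algebra. -/
noncomputable def ofGroupAlgebra (β σ : K) :
    MonoidAlgebra K (Metacyclic k l n) →ₐ[K] TaftMetacyclic hm hq (k := k) hl hn β σ :=
  MonoidAlgebra.lift K _ _ ((Units.coeHom _).comp (ofMetacyclicUnits hm hq hl hn β σ))

theorem ofGroupAlgebra_c :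
    ofGroupAlgebra hm hq hl hn β σ (MonoidAlgebra.of K _ (Metacyclic.c k l n)) =
      c hm hq hl hn β σ := by
  rw [ofGroupAlgebra, MonoidAlgebra.lift_of]
  change (ofMetacyclicUnits hm hq hl hn β σ (Metacyclic.c k l n)).val = _
  rw [ofMetacyclicUnits, Metacyclic.c, PresentedGroup.toGroup.of]

theorem ofGroupAlgebra_d :
    ofGroupAlgebra hm hq hl hn β σ (MonoidAlgebra.of K _ (Metacyclic.d k l n)) =
      d hm hq hl hn β σ := by
  rw [ofGroupAlgebra, MonoidAlgebra.lift_of]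
  change (ofMetacyclicUnits hm hq hl hn β σ (Metacyclic.d k l n)).val = _
  rw [ofMetacyclicUnits, Metacyclic.d, PresentedGroup.toGroup.of]

/-- The linear map `a ⋈ y ↦ a y` to the presented algebra. -/
noncomputable def ofBicrossed (β σ : K) : (ofChar hm hq γ).BicrossedProduct →ₗ[K]
    TaftMetacyclic hm hq (k := k) hl hn β σ :=
  LinearMap.mul' K _ ∘ₗ
    TensorProduct.map (ofTaft hm hq hl hn β σ).toLinearMap
      (ofGroupAlgebra hm hq hl hn β σ).toLinearMap ∘ₗ
    (BialgebraData.Carrier.linearEquiv _).toLinearMap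

theorem ofBicrossed_mk (a : Taft hm hq) (y : MonoidAlgebra K (Metacyclic k l n)) :
    ofBicrossed hm hq hl hn γ β σ (mk (ofChar hm hq γ) a y) =
      ofTaft hm hq hl hn β σ a * ofGroupAlgebra hm hq hl hn β σ y := rfl

theorem toBicrossed_ofTaft (a : Taft hm hq) :
    toBicrossed hm hq hl hn γ hc hd (ofTaft hm hq hl hn β σ a) = taftElem hm hq γ a := by
  have key : (toBicrossed hm hq hl hn γ hc hd).comp (ofTaft hm hq hl hn β σ) =
      inlHom (ofChar hm hq γ) :=
    Taft.algHom_ext (by simp [ofTaft, toBicrossed, taftElem])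
      (by simp [ofTaft, toBicrossed, taftElem])
  exact DFunLike.congr_fun key a

theorem toBicrossed_ofGroupAlgebra (y : MonoidAlgebra K (Metacyclic k l n)) :
    toBicrossed hm hq hl hn γ hc hd (ofGroupAlgebra hm hq hl hn β σ y) =
      inrHom (ofChar hm hq γ) y := by
  have key : (toBicrossed hm hq hl hn γ hc hd).comp (ofGroupAlgebra hm hq hl hn β σ) =
      inrHom (ofChar hm hq γ) := by
    refine (MonoidAlgebra.lift K _ _).symm.injective (Metacyclic.hom_ext ?_ ?_)
    · change toBicrossed hm hq hl hn γ hc hd (ofGroupAlgebra hm hq hl hn β σ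
        (MonoidAlgebra.of K _ (Metacyclic.c k l n))) = _
      rw [ofGroupAlgebra_c, toBicrossed, lift_c]
      rfl
    · change toBicrossed hm hq hl hn γ hc hd (ofGroupAlgebra hm hq hl hn β σ
        (MonoidAlgebra.of K _ (Metacyclic.d k l n))) = _
      rw [ofGroupAlgebra_d, toBicrossed, lift_d]
      rfl
  exact DFunLike.congr_fun key y

theorem toBicrossed_comp_ofBicrossed :
    (toBicrossed hm hq hl hn γ hc hd).toLinearMap ∘ₗ ofBicrossed hm hq hl hn γ β σ =
      LinearMap.id :=
  ext_mk _ fun a y => by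
    change toBicrossed hm hq hl hn γ hc hd (ofBicrossed hm hq hl hn γ β σ (mk _ a y)) = mk _ a y
    rw [ofBicrossed_mk, map_mul, toBicrossed_ofTaft, toBicrossed_ofGroupAlgebra]
    exact inl_mul_inr _ a y

/-- If `t` commutes with `h` and commutes with `x` up to the factor `r`, then `t a = φ(a) t` for
the scaling map `φ` with `h ↦ h`, `x ↦ r x`. -/
theorem mul_ofTaft {t : TaftMetacyclic hm hq (k := k) hl hn β σ} {r : K}
    (h1 : t * h hm hq hl hn β σ = h hm hq hl hn β σ * t)
    (h2 : t * x hm hq hl hn β σ = r • (x hm hq hl hn β σ * t)) (a : Taft hm hq) :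
    t * ofTaft hm hq hl hn β σ a = ofTaft hm hq hl hn β σ (Taft.scale hm hq r a) * t := by
  have ha : a ∈ Algebra.adjoin K {Taft.h hm hq, Taft.x hm hq} :=
    Taft.adjoin_eq_top hm hq ▸ Algebra.mem_top
  induction ha using Algebra.adjoin_induction with
  | mem a ha =>
    rcases ha with rfl | rfl
    · rw [Taft.scale_h, ofTaft, Taft.lift_h, h1]
    · rw [Taft.scale_x, map_smul, ofTaft, Taft.lift_x, h2, smul_mul_assoc]
  | algebraMap r' =>
    rw [AlgHomClass.commutes, AlgHomClass.commutes, AlgHomClass.commutes, Algebra.commutes]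
  | add a b _ _ ha hb => simp only [map_add, mul_add, add_mul, ha, hb]
  | mul a b _ _ ha hb => simp only [map_mul]; rw [← mul_assoc, ha, mul_assoc, hb, mul_assoc]

/-- The products `a y` span the presented algebra, as their span is stable under left
multiplication by the generators. -/
theorem ofBicrossed_surjective : Function.Surjective (ofBicrossed hm hq hl hn γ β σ) := by
  set R := LinearMap.range (ofBicrossed hm hq hl hn γ β σ)
  have hmem : ∀ a y, ofTaft hm hq hl hn β σ a * ofGroupAlgebra hm hq hl hn β σ y ∈ R :=
    fun a y => ⟨_, ofBicrossed_mk hm hq hl hn γ a y⟩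
  -- Elements of the range may be assumed to be products `a y`.
  have hstable : ∀ t : TaftMetacyclic hm hq (k := k) hl hn β σ,
      (∀ a y, t * (ofTaft hm hq hl hn β σ a * ofGroupAlgebra hm hq hl hn β σ y) ∈ R) →
      ∀ s ∈ R, t * s ∈ R := by
    rintro t ht _ ⟨⟨v⟩, rfl⟩
    induction v with
    | zero =>
      change t * ofBicrossed hm hq hl hn γ β σ 0 ∈ R
      rw [map_zero, mul_zero]
      exact R.zero_mem
    | add v w hv hw =>
      have hvw := R.add_mem hv hw
      rw [← mul_add, ← map_add] at hvw
      exact hvw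
    | tmul a y => exact ht a y
  have key : ∀ t : TaftMetacyclic hm hq (k := k) hl hn β σ, ∀ s ∈ R, t * s ∈ R := by
    intro t
    have ht : t ∈ Algebra.adjoin K {c hm hq (k := k) hl hn β σ, d hm hq hl hn β σ,
        h hm hq hl hn β σ, x hm hq hl hn β σ} := adjoin_eq_top hm hq hl hn β σ ▸ Algebra.mem_top
    induction ht using Algebra.adjoin_induction with
    | mem g hg =>
      refine hstable g fun a y => ?_
      rcases hg with rfl | rfl | rfl | rfl
      · rw [← mul_assoc, mul_ofTaft hm hq hl hn (c_mul_h ..) (c_mul_x ..), mul_assoc,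
          ← ofGroupAlgebra_c, ← map_mul]
        exact hmem _ _
      · rw [← mul_assoc, mul_ofTaft hm hq hl hn (d_mul_h ..) (d_mul_x ..), mul_assoc,
          ← ofGroupAlgebra_d, ← map_mul]
        exact hmem _ _
      · have h1 : ofTaft hm hq hl hn β σ (Taft.h hm hq) = h hm hq (k := k) hl hn β σ :=
          Taft.lift_h _ _ _
        rw [← mul_assoc, ← h1, ← map_mul]
        exact hmem _ _
      · have h1 : ofTaft hm hq hl hn β σ (Taft.x hm hq) = x hm hq (k := k) hl hn β σ :=
          Taft.lift_x _ _ _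
        rw [← mul_assoc, ← h1, ← map_mul]
        exact hmem _ _
    | algebraMap r =>
      intro s hs
      rw [← Algebra.smul_def]
      exact R.smul_mem _ hs
    | add y z _ _ hy hz => intro s hs; rw [add_mul]; exact R.add_mem (hy s hs) (hz s hs)
    | mul y z _ _ hy hz => intro s hs; rw [mul_assoc]; exact hy _ (hz s hs)
  intro t
  have h1 := key t _ (hmem 1 1)
  rwa [map_one, map_one, mul_one, mul_one] at h1

theorem toBicrossed_bijective : Function.Bijective (toBicrossed hm hq hl hn γ hc hd) := by
  have hinv : ∀ s, toBicrossed hm hq hl hn γ hc hd (ofBicrossed hm hq hl hn γ β σ s) = s :=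
    fun s => LinearMap.congr_fun (toBicrossed_comp_ofBicrossed hm hq hl hn γ hc hd) s
  refine ⟨fun s t hst => ?_, fun s => ⟨_, hinv s⟩⟩
  obtain ⟨s, rfl⟩ := ofBicrossed_surjective hm hq hl hn γ s
  obtain ⟨t, rfl⟩ := ofBicrossed_surjective hm hq hl hn γ t
  rw [hinv, hinv] at hst
  rw [hst]

theorem toBicrossed_c : toBicrossed hm hq hl hn γ hc hd (c hm hq hl hn β σ) =
    inrHom _ (MonoidAlgebra.of K _ (Metacyclic.c k l n)) := lift_c ..

theorem toBicrossed_d : toBicrossed hm hq hl hn γ hc hd (d hm hq hl hn β σ) =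
    inrHom _ (MonoidAlgebra.of K _ (Metacyclic.d k l n)) := lift_d ..

theorem toBicrossed_h : toBicrossed hm hq hl hn γ hc hd (h hm hq hl hn β σ) =
    inlHom _ (Taft.h hm hq) := lift_h ..

theorem toBicrossed_x : toBicrossed hm hq hl hn γ hc hd (x hm hq hl hn β σ) =
    inlHom _ (Taft.x hm hq) := lift_x ..

/-- The map from the presented Hopf algebra to the bicrossed product, as a bialgebra map. -/
noncomputable def toBicrossedHom :
    TaftMetacyclic hm hq (k := k) hl hn β σ →ₐc[K] (ofChar hm hq γ).BicrossedProduct :=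
  BialgHom.ofAlgHom (toBicrossed hm hq hl hn γ hc hd)
    (algHom_ext
      (by
        change counit (R := K) (toBicrossed hm hq hl hn γ hc hd (c hm hq hl hn β σ)) =
          counit (R := K) (c hm hq hl hn β σ)
        rw [toBicrossed_c, counit_inr, counit_c, (isGroupLikeElem_of _).counit_eq_one])
      (by
        change counit (R := K) (toBicrossed hm hq hl hn γ hc hd (d hm hq hl hn β σ)) =
          counit (R := K) (d hm hq hl hn β σ)
        rw [toBicrossed_d, counit_inr, counit_d, (isGroupLikeElem_of _).counit_eq_one])
      (by
        change counit (R := K) (toBicrossed hm hq hl hn γ hc hd (h hm hq hl hn β σ)) =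
          counit (R := K) (h hm hq hl hn β σ)
        rw [toBicrossed_h, counit_inl, counit_h, Taft.counit_h])
      (by
        change counit (R := K) (toBicrossed hm hq hl hn γ hc hd (x hm hq hl hn β σ)) =
          counit (R := K) (x hm hq hl hn β σ)
        rw [toBicrossed_x, counit_inl, counit_x, Taft.counit_x]))
    (algHom_ext
      (by
        change Algebra.TensorProduct.map _ _ (comul (R := K) (c hm hq (k := k) hl hn β σ)) =
          comul (R := K) (toBicrossed hm hq hl hn γ hc hd _)
        rw [comul_c, Algebra.TensorProduct.map_tmul, toBicrossed_c, comul_inr,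
          (isGroupLikeElem_of _).comul_eq_tmul_self]
        rfl)
      (by
        change Algebra.TensorProduct.map _ _ (comul (R := K) (d hm hq (k := k) hl hn β σ)) =
          comul (R := K) (toBicrossed hm hq hl hn γ hc hd _)
        rw [comul_d, Algebra.TensorProduct.map_tmul, toBicrossed_d, comul_inr,
          (isGroupLikeElem_of _).comul_eq_tmul_self]
        rfl)
      (by
        change Algebra.TensorProduct.map _ _ (comul (R := K) (h hm hq (k := k) hl hn β σ)) =
          comul (R := K) (toBicrossed hm hq hl hn γ hc hd _)
        rw [comul_h, Algebra.TensorProduct.map_tmul, toBicrossed_h, comul_inl, Taft.comul_h]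
        rfl)
      (by
        change Algebra.TensorProduct.map _ _ (comul (R := K) (x hm hq (k := k) hl hn β σ)) =
          comul (R := K) (toBicrossed hm hq hl hn γ hc hd _)
        rw [comul_x, map_add, Algebra.TensorProduct.map_tmul, Algebra.TensorProduct.map_tmul,
          toBicrossed_x, toBicrossed_h, comul_inl, Taft.comul_x, map_add, map_one,
          TensorProduct.map_tmul, TensorProduct.map_tmul, AlgHom.toLinearMap_apply,
          AlgHom.toLinearMap_apply, AlgHom.toLinearMap_apply, map_one]))

/-- The bicrossed product of the matched pair of the character `γ` is `T^{γ(c),γ(d)}`. -/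
noncomputable def bicrossedEquiv :
    (ofChar hm hq γ).BicrossedProduct ≃ₐc[K] TaftMetacyclic hm hq (k := k) hl hn β σ :=
  (BialgEquiv.ofBijective (toBicrossedHom hm hq hl hn γ hc hd)
    (toBicrossed_bijective hm hq hl hn γ hc hd)).symm

end TaftMetacyclic

theorem mainTheorem2 {K : Type u} [Field K] {m : ℕ} (hm : 2 ≤ m) {q : K}
    (hq : IsPrimitiveRoot q m) {k l n : ℕ} (hk : 1 ≤ k) (hl : 1 ≤ l) (hn : 1 ≤ n)
    (hkl : k ^ l ≡ 1 [MOD n]) :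
    ∃ e : rootsOfUnity l K × rootsOfUnity (n.gcd (k - 1)) K ≃
        MatchedPair K (Taft hm hq) (MonoidAlgebra K (Metacyclic k l n)),
      (∀ (β : rootsOfUnity l K) (σ : rootsOfUnity (n.gcd (k - 1)) K),
        ∀ t < n, ∀ i < l, ∀ j' < m, ∀ j < m,
          (e (β, σ)).left
              (MonoidAlgebra.of K (Metacyclic k l n) (Metacyclic.d k l n ^ t * Metacyclic.c k l n ^ i)
                ⊗ₜ[K] (Taft.h hm hq ^ j' * Taft.x hm hq ^ j)) =
            (((β : Kˣ) : K) ^ (i * j) * ((σ : Kˣ) : K) ^ (t * j)) •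
              (Taft.h hm hq ^ j' * Taft.x hm hq ^ j) ∧
          (e (β, σ)).right
              (MonoidAlgebra.of K (Metacyclic k l n) (Metacyclic.d k l n ^ t * Metacyclic.c k l n ^ i)
                ⊗ₜ[K] (Taft.h hm hq ^ j' * Taft.x hm hq ^ j)) =
            Coalgebra.counit (R := K) (Taft.h hm hq ^ j' * Taft.x hm hq ^ j) •
              MonoidAlgebra.of K (Metacyclic k l n)
                (Metacyclic.d k l n ^ t * Metacyclic.c k l n ^ i)) ∧
      ∀ P : MatchedPair K (Taft hm hq) (MonoidAlgebra K (Metacyclic k l n)),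
        ∃ (β : rootsOfUnity l K) (σ : rootsOfUnity (n.gcd (k - 1)) K),
          e (β, σ) = P ∧
          Nonempty (P.BicrossedProduct ≃ₐc[K]
            TaftMetacyclic hm hq (k := k) hl hn ((β : Kˣ) : K) ((σ : Kˣ) : K)) := by
  refine ⟨(Metacyclic.charEquiv K hk).trans (MatchedPair.charEquiv hm hq _), ?_, ?_⟩
  · intro β σ t _ i _ j' _ j _
    refine ⟨?_, rfl⟩
    have h1 := MatchedPair.ofChar_left (hm := hm) (hq := hq) (Metacyclic.charEquiv K hk (β, σ))
      (Metacyclic.d k l n ^ t * Metacyclic.c k l n ^ i) j' j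
    rw [map_mul (Metacyclic.charEquiv K hk (β, σ)), map_pow, map_pow, Metacyclic.charEquiv_c,
      Metacyclic.charEquiv_d, mul_pow, ← pow_mul, ← pow_mul, mul_comm (_ ^ (t * j))] at h1
    exact h1
  · intro P
    obtain ⟨⟨β, σ⟩, rfl⟩ := ((Metacyclic.charEquiv (k := k) (l := l) (n := n) K hk).trans
      (MatchedPair.charEquiv hm hq _)).surjective P
    exact ⟨β, σ, rfl, ⟨TaftMetacyclic.bicrossedEquiv hm hq hl hn _
      (Metacyclic.charEquiv_c hk β σ) (Metacyclic.charEquiv_d hk β σ)⟩⟩
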